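/- Let $n\ge 1$, let $h$ be a formal parameter and $\mathcal A=\mathbb C[[h]]$. Let $P$ be the permutation operator on $\mathbb C^n\otimes\mathbb C^n$ and let $R(u)=f(u)\bigl(1+\tfrac hu P\bigr)$, where $f(u)=1+\sum_{k\ge1}f_ku^{-k}$, $f_k\in\mathbb C\,h^k$, is the unique series with $f(u-nh)=\frac{u^2-h^2}{u^2}f(u)$. The Yangian double of $\mathfrak{gl}_n$ at the critical level is the $h$-torsion-free, $h$-adically complete associative $\mathcal A$-algebra $\mathrm{DY}_{cr}$ topologically generated by elements $l_{ij}^{(r)}$ ($1\le i,j\le n$, $r\in\mathbb Z$) and $c$, subject to $c=-n$, to $[L^{\pm}(u),c]=0$ and to $$R(u-v)L_1^{\pm}(u)L_2^{\pm}(v)=L_2^{\pm}(v)L_1^{\pm}(u)R(u-v),$$ $$R\bigl(u-v-\tfrac12hc\bigr)L_1^{+}(u)L_2^{-}(v)=L_2^{-}(v)L_1^{+}(u)R\bigl(u-v+\tfrac12hc\bigr),$$ where common factors $h$ in the coefficients of the relations are cancelled, $R(u-v\mp\frac12hc)$ is expanded in powers of $u^{-1}$, and $L^{\pm}(u)=(l^{\pm}_{ij}(u))$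 with $$l_{ij}^{+}(u)=\delta_{ij}-h\sum_{r\ge0}l_{ij}^{(r)}u^{-r-1},\qquad l_{ij}^{-}(u)=\delta_{ij}+h\sum_{r<0}l_{ij}^{(r)}u^{-r-1}.$$ Here and below $L_a^{\pm}(u)$ denotes $L^{\pm}(u)$ acting in the $a$-th tensor factor $\mathbb C^n$. The vacuum module $V_h(\mathfrak{gl}_n)$ is the quotient of $\mathrm{DY}_{cr}$ by the ($h$-adically closed) left ideal generated by all $l_{ij}^{(r)}$ with $r\ge0$; $\mathbf 1$ is the image of $1$; and the subspace of invariants is $$\mathfrak Z_h(\mathfrak{gl}_n)=\{v\in V_h(\mathfrak{gl}_n)\mid L^{+}(z)v=Iv\},$$ where $I$ is the identity matrix. For $k=1,\dots,n$ put $$\bar\ell_k(u)=\mathrm{tr}_{1,\dots,k}\,A_k\,L_1^{-}(u_1)\cdots L_k^{-}(u_k),\qquad u_a=u+(a-1)h,$$ where $A_k=\frac1{k!}\sum_{\sigma\in\mathfrak S_k}\mathrm{sgn}(\sigma)\,\sigma$ is the antisymmetrizer on $(\mathbb C^n)^{\otimes k}$; this is a power series in $u$ with coefficients in $\mathrm{DY}_{cr}$.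 Then for every $k=1,\dots,n$ all coefficients of the series $\bar\ell_k(u)\mathbf 1$ belong to $\mathfrak Z_h(\mathfrak{gl}_n)$. Moreover, all coefficients of all the series $\bar\ell_1(u),\dots,\bar\ell_n(u)$ commute with each other in $\mathrm{DY}_{cr}$. -/

import Mathlib

namespace YangianDouble

open PowerSeries Kronecker

/-! ### The ground ring `ℂ[[h]]` -/

/-- The ring `ℂ[[h]]`. It is a separate type so that its elements always act as scalars on
power series in the spectral parameters. -/
def Scalars : Type := PowerSeries ℂ

noncomputable instance : CommRing Scalars := inferInstanceAs (CommRing (PowerSeries ℂ))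

/-- The formal parameter `h`. -/
noncomputable def hbar : Scalars := (PowerSeries.X : PowerSeries ℂ)

/-- A complex number as an element of `ℂ[[h]]`. -/
noncomputable def const : ℂ →+* Scalars := (PowerSeries.C : ℂ →+* PowerSeries ℂ)

/-! ### The normalised Yang R-matrix -/

/-- The numbers `a_k` with `f(u) = ∑ a_k h^k u^{-k}`, where `f(u) = 1 + O(u^{-1})` is the solution
of `f(u - n h) = (1 - h²/u²) f(u)`. -/
noncomputable def fNum (n : ℕ) : ℕ → ℂ
  | 0 => 1
  | m + 1 => -(fNum n m + ∑ k : Fin m, fNum n (k + 1) * ((m + 1).choose k : ℂ) *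
      (n : ℂ) ^ (m + 1 - (k : ℕ))) / (((m : ℂ) + 1) * n)

/-- The coefficient `f_k ∈ ℂ[[h]]` of `u^{-k}` in `f(u)`. -/
noncomputable def fCoeff (n k : ℕ) : Scalars := const (fNum n k) * hbar ^ k

section RMatrix

variable {S : Type} [Ring S]

/-- `(u - w)⁻¹ = ∑_{m ≥ 0} w^m u^{-m-1}`, as a power series in `X = u⁻¹`. -/
noncomputable def invSub (w : S) : PowerSeries S := X * PowerSeries.mk fun m => w ^ m

/-- The permutation `P` of the two factors of `ℂⁿ ⊗ ℂⁿ`. -/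
def permMatrix (n : ℕ) (S : Type) [Ring S] : Matrix (Fin n × Fin n) (Fin n × Fin n) S :=
  Matrix.of fun x y => if x.1 = y.2 ∧ x.2 = y.1 then 1 else 0

variable [Algebra Scalars S]

/-- `f(u - w) = ∑_k f_k (u - w)^{-k}`, as a power series in `X = u⁻¹`
(`(u - w)^{-k}` only involves powers `u^{-m}` with `m ≥ k`). -/
noncomputable def fShift (n : ℕ) (w : S) : PowerSeries S :=
  PowerSeries.mk fun m => ∑ k ∈ Finset.range (m + 1), fCoeff n k • coeff m (invSub w ^ k)

/-- `R(u - w) = f(u - w) (1 + h (u - w)⁻¹ P)`, as a matrix of power series in `X = u⁻¹`. -/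
noncomputable def RMatrix (n : ℕ) (w : S) :
    Matrix (Fin n × Fin n) (Fin n × Fin n) (PowerSeries S) :=
  fShift n w • (1 + (hbar • invSub w) • permMatrix n (PowerSeries S))

end RMatrix

theorem one_sub_mul_invSub {S : Type} [Ring S] (w : S) : (1 - X * C w) * invSub w = X := by
  have key : (1 - X * C w) * PowerSeries.mk (fun m => w ^ m) = 1 := by
    ext m
    rw [sub_mul, one_mul, mul_assoc, map_sub, coeff_one]
    cases m with
    | zero => simp
    | succ m => simp [coeff_succ_X_mul, coeff_C_mul, pow_succ']
  have comm : Commute (1 - X * C w) (X : PowerSeries S) := (PowerSeries.commute_X _)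
  rw [invSub, ← mul_assoc, comm.eq, mul_assoc, key, mul_one]

theorem coeff_invSub_pow {S : Type} [CommRing S] (w : S) (k j : ℕ) :
    coeff (k + 1 + j) (invSub w ^ (k + 1)) = ((k + j).choose k : S) * w ^ j := by
  have h : (PowerSeries.mk fun m => w ^ m) = rescale w (PowerSeries.mk 1) := by
    ext m
    simp
  rw [invSub, mul_pow, add_comm (k + 1) j, coeff_X_pow_mul, h, ← map_pow,
    mk_one_pow_eq_mk_choose_add, coeff_rescale, coeff_mk, mul_comm]

/-- The functional equation `f(u - n h) = (1 - h²/u²) f(u)`. -/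
theorem fShift_functional_equation (n : ℕ) (hn : n ≠ 0) :
    fShift n ((n : Scalars) * hbar) =
      (1 - C (hbar ^ 2) * X ^ 2) * PowerSeries.mk (fCoeff n) := by
  have hterm : ∀ M j : ℕ, j ≤ M + 1 →
      fCoeff n (j + 1) • coeff (M + 2) (invSub ((n : Scalars) * hbar) ^ (j + 1)) =
        const (fNum n (j + 1) * ((M + 1).choose j : ℂ) * (n : ℂ) ^ (M + 1 - j)) *
          hbar ^ (M + 2) := by
    intro M j hj
    obtain ⟨i, hi⟩ := Nat.exists_eq_add_of_le hj
    have e1 : M + 2 = j + 1 + i := by omega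
    have e2 : M + 1 - j = i := by omega
    rw [e2, e1, coeff_invSub_pow, ← hi, fCoeff]
    simp only [map_mul, map_pow, map_natCast, smul_eq_mul]
    ring
  ext m
  rw [sub_mul, one_mul, mul_assoc, map_sub, coeff_mk, coeff_C_mul, fShift, coeff_mk]
  match m with
  | 0 => simp
  | 1 =>
    have h1 := coeff_invSub_pow ((n : Scalars) * hbar) 0 0
    simp only [zero_add, add_zero, pow_one, pow_zero, Nat.choose_self, Nat.cast_one,
      mul_one] at h1
    rw [coeff_X_pow_mul']
    simp [Finset.sum_range_succ, coeff_one, h1]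
  | M + 2 =>
    rw [Finset.sum_range_succ', coeff_X_pow_mul, coeff_mk]
    rw [Finset.sum_congr rfl fun j hj => hterm M j (by have := Finset.mem_range.1 hj; omega)]
    rw [Finset.sum_range_succ, Finset.sum_range_succ, ← Fin.sum_univ_eq_sum_range (fun j =>
      const (fNum n (j + 1) * ((M + 1).choose j : ℂ) * (n : ℂ) ^ (M + 1 - j)) * hbar ^ (M + 2))]
    have hrec : (∑ k : Fin M, fNum n (k + 1) * ((M + 1).choose k : ℂ) *
        (n : ℂ) ^ (M + 1 - (k : ℕ))) = -fNum n M - fNum n (M + 1) * (((M : ℂ) + 1) * n) := by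
      have h0 : ((M : ℂ) + 1) * n ≠ 0 :=
        mul_ne_zero (by exact_mod_cast Nat.succ_ne_zero M) (by exact_mod_cast hn)
      rw [fNum, div_mul_cancel₀ _ h0]
      ring
    rw [← Finset.sum_mul, ← map_sum, hrec]
    simp only [fCoeff, pow_zero, coeff_one, Nat.choose_self, Nat.choose_succ_self_right,
      Nat.sub_self, Nat.add_sub_cancel_left, map_sub, map_neg, map_mul, map_add, map_one,
      map_natCast, Nat.cast_add, Nat.cast_one, pow_one]
    simp only [show M + 1 + 1 = M + 2 from rfl, Nat.add_eq_zero_iff, OfNat.ofNat_ne_zero,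
      and_false, if_false, smul_zero, add_zero]
    ring

/-! ### The generating matrices -/

section LMatrix

variable {n : ℕ} {B : Type} [Ring B] [Algebra Scalars B]

/-- `L⁺(u) = 1 - h ∑_{r ≥ 0} l^{(r)} u^{-r-1}`, in powers of `X = u⁻¹`. -/
noncomputable def LPlus (l : Fin n → Fin n → ℤ → B) : Matrix (Fin n) (Fin n) (PowerSeries B) :=
  1 - Matrix.of fun i j => X * PowerSeries.mk fun r : ℕ => hbar • l i j r

/-- `L⁻(u) = 1 + h ∑_{r < 0} l^{(r)} u^{-r-1}`, in powers of `X = u`. -/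
noncomputable def LMinus (l : Fin n → Fin n → ℤ → B) : Matrix (Fin n) (Fin n) (PowerSeries B) :=
  1 + Matrix.of fun i j => PowerSeries.mk fun p : ℕ => hbar • l i j (-(p : ℤ) - 1)

/-- A series in the first spectral parameter as a series in both; the outer variable of
`B[[v]][[u]]` belongs to the first parameter, the inner one to the second. -/
noncomputable def outer : PowerSeries B →+* PowerSeries (PowerSeries B) := PowerSeries.map C

/-- A series in the second spectral parameter as a series in both. -/
noncomputable def inner : PowerSeries B →+* PowerSeries (PowerSeries B) := C

/-- `M₁ = M(u) ⊗ 1`. -/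
noncomputable def leg₁ (M : Matrix (Fin n) (Fin n) (PowerSeries B)) :
    Matrix (Fin n × Fin n) (Fin n × Fin n) (PowerSeries (PowerSeries B)) :=
  M.map outer ⊗ₖ 1

/-- `M₂ = 1 ⊗ M(v)`. -/
noncomputable def leg₂ (M : Matrix (Fin n) (Fin n) (PowerSeries B)) :
    Matrix (Fin n × Fin n) (Fin n × Fin n) (PowerSeries (PowerSeries B)) :=
  1 ⊗ₖ M.map inner

end LMatrix

/-! ### The Yangian double at the critical level -/

/-- The generators `l_{ij}^{(r)}` (`r ∈ ℤ`) and `c`. -/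
inductive Gen (n : ℕ) : Type
  | l (i j : Fin n) (r : ℤ) : Gen n
  | c : Gen n

/-- The free associative `ℂ[[h]]`-algebra on the generators. -/
abbrev Free (n : ℕ) : Type := FreeAlgebra Scalars (Gen n)

noncomputable def genL (n : ℕ) (i j : Fin n) (r : ℤ) : Free n := FreeAlgebra.ι Scalars (Gen.l i j r)

noncomputable def genC (n : ℕ) : Free n := FreeAlgebra.ι Scalars Gen.c

/-- `R(u-v) L₁⁺(u) L₂⁺(v) - L₂⁺(v) L₁⁺(u) R(u-v)` in the variables `x = u⁻¹`, `y = v⁻¹`, multiplied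
by the invertible factor `f(u-v)⁻¹ (u-v)` and by `xy`: then `R(u-v)` becomes
`xy (u - v + h P) = y - x + h xy P`. -/
noncomputable def relPlusPlus (n : ℕ) :
    Matrix (Fin n × Fin n) (Fin n × Fin n) (PowerSeries (PowerSeries (Free n))) :=
  let x : PowerSeries (PowerSeries (Free n)) := outer X
  let y : PowerSeries (PowerSeries (Free n)) := inner X
  let R : Matrix (Fin n × Fin n) (Fin n × Fin n) (PowerSeries (PowerSeries (Free n))) :=
    (y - x) • 1 + (hbar • (x * y)) • permMatrix n _
  R * leg₁ (LPlus (genL n)) * leg₂ (LPlus (genL n))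
    - leg₂ (LPlus (genL n)) * leg₁ (LPlus (genL n)) * R

/-- `R(u-v) L₁⁻(u) L₂⁻(v) - L₂⁻(v) L₁⁻(u) R(u-v)` in the variables `u`, `v`, multiplied by the
invertible factor `f(u-v)⁻¹ (u-v)`: then `R(u-v)` becomes `u - v + h P`. -/
noncomputable def relMinusMinus (n : ℕ) :
    Matrix (Fin n × Fin n) (Fin n × Fin n) (PowerSeries (PowerSeries (Free n))) :=
  let u : PowerSeries (PowerSeries (Free n)) := outer X
  let v : PowerSeries (PowerSeries (Free n)) := inner X
  let R : Matrix (Fin n × Fin n) (Fin n × Fin n) (PowerSeries (PowerSeries (Free n))) :=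
    (u - v) • 1 + (hbar • (1 : PowerSeries (PowerSeries (Free n)))) • permMatrix n _
  R * leg₁ (LMinus (genL n)) * leg₂ (LMinus (genL n))
    - leg₂ (LMinus (genL n)) * leg₁ (LMinus (genL n)) * R

/-- `R(u - v - hc/2) L₁⁺(u) L₂⁻(v) - L₂⁻(v) L₁⁺(u) R(u - v + hc/2)` in the variables `u⁻¹` (outer)
and `v` (inner). -/
noncomputable def relPlusMinus (n : ℕ) :
    Matrix (Fin n × Fin n) (Fin n × Fin n) (PowerSeries (PowerSeries (Free n))) :=
  let v : PowerSeries (Free n) := X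
  let hc : PowerSeries (Free n) := C ((const (1 / 2) * hbar) • genC n)
  RMatrix n (v + hc) * leg₁ (LPlus (genL n)) * leg₂ (LMinus (genL n))
    - leg₂ (LMinus (genL n)) * leg₁ (LPlus (genL n)) * RMatrix n (v - hc)

/-- The coefficients of all the entries of a matrix of double series. -/
def coeffSet {n : ℕ} {B : Type} [Ring B]
    (M : Matrix (Fin n × Fin n) (Fin n × Fin n) (PowerSeries (PowerSeries B))) : Set B :=
  {z | ∃ x y a b, z = coeff b (coeff a (M x y))}

/-- The defining relators of the Yangian double of `gl_n`. -/
def relators (n : ℕ) : Set (Free n) :=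
  {z | ∃ i j r, z = genL n i j r * genC n - genC n * genL n i j r} ∪
    coeffSet (relPlusPlus n) ∪ coeffSet (relMinusMinus n) ∪ coeffSet (relPlusMinus n)

/-- The relators at the critical level: those of the Yangian double and `c = -n`. -/
def criticalRelators (n : ℕ) : Set (Free n) := relators n ∪ {genC n + (n : Free n)}

/-- The two-sided ideal generated by the relators, with common powers of `h` cancelled: the
coefficients of the matrix relations are divisible by `h²` in the free algebra, and the Yangian
double, being a flat deformation of an enveloping algebra, has no `h`-torsion. -/
noncomputable def relIdeal (n : ℕ) : Ideal (Free n) where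
  carrier := {z | ∃ N : ℕ, hbar ^ N • z ∈ TwoSidedIdeal.span (criticalRelators n)}
  zero_mem' := ⟨0, by simp⟩
  add_mem' := by
    rintro a b ⟨N, hN⟩ ⟨M, hM⟩
    refine ⟨N + M, ?_⟩
    rw [smul_add]
    refine TwoSidedIdeal.add_mem _ ?_ ?_
    · rw [add_comm, pow_add, mul_smul, Algebra.smul_def (hbar ^ M)]
      exact TwoSidedIdeal.mul_mem_left _ _ _ hN
    · rw [pow_add, mul_smul, Algebra.smul_def (hbar ^ N)]
      exact TwoSidedIdeal.mul_mem_left _ _ _ hM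
  smul_mem' := by
    rintro a z ⟨N, hN⟩
    refine ⟨N, ?_⟩
    rw [smul_eq_mul, ← mul_smul_comm]
    exact TwoSidedIdeal.mul_mem_left _ _ _ hN

instance (n : ℕ) : (relIdeal n).IsTwoSided where
  mul_mem_of_left := by
    rintro a b ⟨N, hN⟩
    refine ⟨N, ?_⟩
    rw [← smul_mul_assoc]
    exact TwoSidedIdeal.mul_mem_right _ _ _ hN

/-- The Yangian double of `gl_n` at the critical level `c = -n`, before completion. -/
def DYcr (n : ℕ) : Type := Free n ⧸ relIdeal n

noncomputable instance (n : ℕ) : Ring (DYcr n) := inferInstanceAs (Ring (Free n ⧸ relIdeal n))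

noncomputable instance (n : ℕ) : Algebra Scalars (DYcr n) :=
  inferInstanceAs (Algebra Scalars (Free n ⧸ relIdeal n))

/-! ### The `h`-adic completion -/

section Completion

variable (D : Type) [Ring D] [Algebra Scalars D]

/-- The two-sided ideal `h^N D`. -/
noncomputable def hIdeal (N : ℕ) : Ideal D where
  carrier := {x | ∃ y, x = hbar ^ N • y}
  zero_mem' := ⟨0, by simp⟩
  add_mem' := by
    rintro a b ⟨y, rfl⟩ ⟨z, rfl⟩
    exact ⟨y + z, by simp⟩
  smul_mem' := by
    rintro a b ⟨y, rfl⟩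
    exact ⟨a * y, by simp⟩

instance (N : ℕ) : (hIdeal D N).IsTwoSided where
  mul_mem_of_left := by
    rintro a b ⟨y, rfl⟩
    exact ⟨y * b, by simp⟩

/-- The `h`-adic completion `lim D / h^N D`, as the algebra of compatible families. -/
noncomputable def hCompletion : Subalgebra Scalars (∀ N : ℕ, D ⧸ hIdeal D N) where
  carrier := {x | ∀ N, ∃ d : D, ∀ M ≤ N, x M = Ideal.Quotient.mk (hIdeal D M) d}
  mul_mem' := by
    intro a b ha hb N
    obtain ⟨d, hd⟩ := ha N
    obtain ⟨e, he⟩ := hb N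
    exact ⟨d * e, fun M hM => by rw [Pi.mul_apply, hd M hM, he M hM, map_mul]⟩
  add_mem' := by
    intro a b ha hb N
    obtain ⟨d, hd⟩ := ha N
    obtain ⟨e, he⟩ := hb N
    exact ⟨d + e, fun M hM => by rw [Pi.add_apply, hd M hM, he M hM, map_add]⟩
  algebraMap_mem' := fun r _ => ⟨algebraMap Scalars D r, fun _ _ => rfl⟩

variable {D}

/-- The canonical map from `D` to its completion. -/
noncomputable def toCompletion (d : D) : hCompletion D :=
  ⟨fun N => Ideal.Quotient.mk (hIdeal D N) d, fun _ => ⟨d, fun _ _ => rfl⟩⟩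

/-- The `h`-adically convergent sum `∑_{m ≥ 0} h^m y_m`. Modulo `h^N` only the terms with `m < N`
contribute. -/
noncomputable def hSum (y : ℕ → hCompletion D) : hCompletion D :=
  ⟨fun N => ∑ m ∈ Finset.range N, hbar ^ m • (y m).1 N, by
    intro N
    choose d hd using fun m => (y m).2 N
    refine ⟨∑ m ∈ Finset.range N, hbar ^ m • d m, fun M hM => ?_⟩
    rw [map_sum, ← Finset.sum_subset (Finset.range_mono hM)]
    · refine Finset.sum_congr rfl fun m _ => ?_
      rw [hd m M hM]
      rfl
    · intro m _ hm
      refine Ideal.Quotient.eq_zero_iff_mem.2 ⟨hbar ^ (m - M) • d m, ?_⟩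
      rw [smul_smul, ← pow_add, Nat.add_sub_cancel' (by simpa using hm)]⟩

/-- The shift `g(u) ↦ g(u + a h)`: the coefficient of `u^p` in `g(u + a h)` is
`∑_m binom(m + p, p) (a h)^m g_{m + p}`. -/
noncomputable def hShift (a : ℕ) (g : PowerSeries (hCompletion D)) :
    PowerSeries (hCompletion D) :=
  PowerSeries.mk fun p => hSum fun m => (((m + p).choose p * a ^ m : ℕ)) • coeff (m + p) g

end Completion

/-- The `h`-adically completed Yangian double of `gl_n` at the critical level. -/
def DY (n : ℕ) : Type := hCompletion (DYcr n)

noncomputable instance (n : ℕ) : Ring (DY n) := inferInstanceAs (Ring (hCompletion (DYcr n)))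

noncomputable instance (n : ℕ) : Algebra Scalars (DY n) :=
  inferInstanceAs (Algebra Scalars (hCompletion (DYcr n)))

/-- The element `l_{ij}^{(r)}` of the completed Yangian double at the critical level. -/
noncomputable def el (n : ℕ) (i j : Fin n) (r : ℤ) : DY n :=
  toCompletion (D := DYcr n) (Ideal.Quotient.mk (relIdeal n) (genL n i j r))

/-! ### The series `ℓ̄_k(u)` -/

/-- The antisymmetrizer `A_k = (1/k!) ∑_σ sgn(σ) σ` on `(ℂⁿ)^{⊗ k}`; a basis of this space is indexed
by the maps `Fin k → Fin n`. -/
noncomputable def antisymmetrizer (n k : ℕ) : Matrix (Fin k → Fin n) (Fin k → Fin n) Scalars :=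
  const (1 / (k.factorial : ℂ)) • ∑ σ : Equiv.Perm (Fin k),
    (Equiv.Perm.sign σ : ℤ) • Matrix.of fun I J => if ∀ a, I (σ a) = J a then 1 else 0

/-- The matrix `M_a`: `M` acting in the `a`-th tensor factor of `(ℂⁿ)^{⊗ k}`. -/
def leg {n k : ℕ} {S : Type} [Ring S] (a : Fin k) (M : Matrix (Fin n) (Fin n) S) :
    Matrix (Fin k → Fin n) (Fin k → Fin n) S :=
  Matrix.of fun I J => if ∀ b, b ≠ a → I b = J b then M (I a) (J a) else 0

/-- `L⁻(u + a h)`. -/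
noncomputable def LMinusShift (n a : ℕ) : Matrix (Fin n) (Fin n) (PowerSeries (DY n)) :=
  (LMinus (el n)).map (hShift (D := DYcr n) a)

/-- `ℓ̄_k(u) = tr_{1,…,k} A_k L₁⁻(u₁) ⋯ L_k⁻(u_k)` with `u_a = u + (a - 1) h`; the index `a` runs
from `0` to `k - 1` here. -/
noncomputable def ellBar (n k : ℕ) : PowerSeries (DY n) :=
  Matrix.trace ((antisymmetrizer n k).map (algebraMap Scalars (PowerSeries (DY n))) *
    (List.ofFn fun a : Fin k => leg a (LMinusShift n a)).prod)

/-! ### The vacuum module and its invariants -/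

/-- The closure, in the `h`-adic topology, of the left ideal generated by all `l_{ij}^{(r)}` with
`r ≥ 0`. -/
noncomputable def vacuumIdeal (n : ℕ) : Ideal (DY n) where
  carrier := {x | ∀ N : ℕ, ∃ y ∈ Ideal.span {z : DY n | ∃ i j, ∃ r : ℤ, 0 ≤ r ∧ z = el n i j r},
    ∃ z : DY n, x = y + hbar ^ N • z}
  zero_mem' := fun _ => ⟨0, Submodule.zero_mem _, 0, by simp⟩
  add_mem' := by
    intro a b ha hb N
    obtain ⟨y, hy, z, rfl⟩ := ha N
    obtain ⟨y', hy', z', hz'⟩ := hb N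
    exact ⟨y + y', Submodule.add_mem _ hy hy', z + z', by rw [hz', smul_add]; abel⟩
  smul_mem' := by
    intro a b hb N
    obtain ⟨y, hy, z, rfl⟩ := hb N
    exact ⟨a * y, Ideal.mul_mem_left _ _ hy, a * z, by
      rw [smul_eq_mul, mul_add, mul_smul_comm]⟩

/-- The vacuum module `V_h(gl_n)` at the critical level. -/
def VacuumModule (n : ℕ) : Type := DY n ⧸ vacuumIdeal n

noncomputable instance (n : ℕ) : AddCommGroup (VacuumModule n) :=
  inferInstanceAs (AddCommGroup (DY n ⧸ vacuumIdeal n))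

noncomputable instance (n : ℕ) : Module (DY n) (VacuumModule n) :=
  inferInstanceAs (Module (DY n) (DY n ⧸ vacuumIdeal n))

noncomputable instance (n : ℕ) : Module Scalars (VacuumModule n) :=
  inferInstanceAs (Module Scalars (DY n ⧸ vacuumIdeal n))

instance (n : ℕ) : SMulCommClass (DY n) Scalars (VacuumModule n) where
  smul_comm a r v := by
    obtain ⟨x, rfl⟩ := Submodule.Quotient.mk_surjective (vacuumIdeal n) v
    exact congrArg (Submodule.Quotient.mk (p := vacuumIdeal n)) (mul_smul_comm r a x)

/-- The vacuum vector, the image of `1`. -/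
noncomputable def vacuum (n : ℕ) : VacuumModule n := Submodule.Quotient.mk (p := vacuumIdeal n) 1

/-- The subspace of invariants `{v | L⁺(z) v = I v}`; the equation is one between series in `z⁻¹`
for every matrix entry. -/
noncomputable def invariants (n : ℕ) : Submodule Scalars (VacuumModule n) where
  carrier := {v | ∀ (i j : Fin n) (a : ℕ), coeff a (LPlus (el n) i j) • v =
    coeff a ((1 : Matrix (Fin n) (Fin n) (PowerSeries (DY n))) i j) • v}
  zero_mem' := fun i j a => by simp
  add_mem' := by
    intro v w hv hw i j a
    rw [smul_add, smul_add, hv i j a, hw i j a]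
  smul_mem' := by
    intro r v hv i j a
    rw [smul_comm, hv i j a, ← smul_comm]

end YangianDouble

namespace YangianDouble

open PowerSeries Kronecker

/-! ### Permutations and legs -/

/-! Everything rests on fusion. At `v = u + h` the factor `u - v + hP` becomes `-h(1 - P)`. After
cancelling `h`, which is allowed because the algebra is torsion-free, the RLL relation gives `(1 -
P) L₁⁻(u) L₂⁻(u+h) (1 + P) = 0`. This is the property `Fusible`. Applied to all adjacent pairs, it
yields `A W A = A W` (`Absorbs`) for the antisymmetrizer `A` and `W = L₁⁻(u₁) ⋯ L_k⁻(u_k)`. Suitably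
ordered products of R-matrices have the same property, by the Yang–Baxter equation. Entries do not
commute, so the trace is cyclic only for factors with central entries, such as `A` and R-matrices.
The property `Absorbs` is what makes this restricted cyclicity sufficient.

Invariance (`sub_one_mul_trace_mem`). The level `c = -n` is used twice. The two R-matrices in the
mixed relation have arguments differing by `nh`, so the equation for `f(u - nh)` replaces the ratio
of their normalising factors by `1 - c_a²`, where `c_a = h/(z-w_a)` with `w_a = u_a - nh/2`.
Multiplying by `1 - c_a P` then gives `L⁺(z) L_a⁻ = X_a L_a⁻ L⁺(z) Y_a` with `X_a = 1 - c_a P`, `Y_a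
= 1 + c_a' P` and `c_a' = h/(z-w_a-nh)`. The same shift gives `c_a' - c_a = n c_a c_a'`, which is
crossing symmetry: `X_a` and `Y_a` are inverse to each other after a partial transposition. Hence
`L⁺(z) tr A W = tr A (∏ X_a) W L⁺(z) (∏ Y_a)`, the last product in reverse order. On the vacuum
`L⁺(z)` may be replaced by `1`. Absorption and cyclicity of `A` allow `∏ X_a` and `∏ Y_a` to
surround `A W`, and crossing cancels them. The auxiliary space of `L⁺` is absorbed into the
coefficient ring, where `L⁺(z)` is a single element `Z`.

Commutativity (`trace_mul_trace_comm`). The product of the two traces is one trace `tr A₁A₂W₁W₂`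
over `k + m` tensor factors. A product `RR` of the polynomial R-matrices `u_a - v_b + hP` takes
`W₁W₂` to `W₂W₁`, and a product `SS` of the factors `u_a - v_b - hP` inverts it up to `p = ∏ ((u_a -
v_b)² - h²)`. Evaluating `tr A₁A₂ RR W₁W₂ SS` in two ways gives the equality after multiplication by
`p`. The scalar `p` is not invertible among power series in `u` and `v`, but it is regular: modulo
`h^N` each linear factor is the regular element `u - v` plus a nilpotent
(`eq_zero_of_spectral_difference`). -/

theorem eq_update_iff {Λ : Type} [DecidableEq Λ] {n : ℕ} (a : Λ) (I J : Λ → Fin n) (j : Fin n) :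
    J = Function.update I a j ↔ (∀ b, b ≠ a → I b = J b) ∧ j = J a := by
  constructor
  · rintro rfl
    refine ⟨fun b hb => ?_, by simp⟩
    simp [hb]
  · rintro ⟨h, rfl⟩
    ext b
    by_cases hb : b = a
    · subst hb; simp
    · simp [hb, h b hb]

section Legs

variable {Λ : Type} [Fintype Λ] [DecidableEq Λ] {n : ℕ} {B : Type} [Ring B]

/-- The action of the permutations of the tensor factors on `(ℂⁿ)^{⊗ Λ}`. -/
def permRep (Λ : Type) [Fintype Λ] [DecidableEq Λ] (n : ℕ) (B : Type) [Ring B] :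
    Equiv.Perm Λ →* Matrix (Λ → Fin n) (Λ → Fin n) B where
  toFun σ := Matrix.of fun I J => if I ∘ σ = J then 1 else 0
  map_one' := by
    ext I J
    simp [Matrix.one_apply]
  map_mul' σ τ := by
    ext I J
    simp only [Matrix.mul_apply, Matrix.of_apply, Equiv.Perm.coe_mul, ite_mul, one_mul, zero_mul,
      Finset.sum_ite_eq, Finset.mem_univ, if_true]
    rfl

theorem permRep_apply (σ : Equiv.Perm Λ) (I J : Λ → Fin n) :
    permRep Λ n B σ I J = if I ∘ σ = J then 1 else 0 := rfl

theorem permRep_mul_apply (σ : Equiv.Perm Λ) (W : Matrix (Λ → Fin n) (Λ → Fin n) B)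
    (I J : Λ → Fin n) : (permRep Λ n B σ * W) I J = W (I ∘ σ) J := by
  simp [Matrix.mul_apply, permRep_apply]

theorem mul_permRep_apply (σ : Equiv.Perm Λ) (W : Matrix (Λ → Fin n) (Λ → Fin n) B)
    (I J : Λ → Fin n) : (W * permRep Λ n B σ) I J = W I (J ∘ σ.symm) := by
  have h : ∀ K : Λ → Fin n, K ∘ σ = J ↔ K = J ∘ σ.symm := by
    intro K
    constructor
    · rintro rfl
      ext a
      simp
    · rintro rfl
      ext a
      simp
  simp [Matrix.mul_apply, permRep_apply, h]

theorem trace_permRep_mul (σ : Equiv.Perm Λ) (W : Matrix (Λ → Fin n) (Λ → Fin n) B) :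
    Matrix.trace (permRep Λ n B σ * W) = Matrix.trace (W * permRep Λ n B σ) := by
  simp only [Matrix.trace, Matrix.diag_apply, permRep_mul_apply, mul_permRep_apply]
  refine Fintype.sum_equiv (Equiv.arrowCongr σ.symm (Equiv.refl _)) _ _ fun I => ?_
  congr 1
  ext a
  simp [Equiv.arrowCongr]

/-- The matrix `M` acting in the tensor factor labelled by `a`. -/
def legOf (a : Λ) (M : Matrix (Fin n) (Fin n) B) : Matrix (Λ → Fin n) (Λ → Fin n) B :=
  Matrix.of fun I J => if ∀ b, b ≠ a → I b = J b then M (I a) (J a) else 0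

theorem legOf_apply (a : Λ) (M : Matrix (Fin n) (Fin n) B) (I J : Λ → Fin n) :
    legOf a M I J = if ∀ b, b ≠ a → I b = J b then M (I a) (J a) else 0 := rfl

theorem leg_eq_legOf {k : ℕ} (a : Fin k) (M : Matrix (Fin n) (Fin n) B) :
    leg a M = legOf a M := by
  ext I J
  rw [legOf_apply]
  show (if _ then _ else _) = _
  split_ifs <;> rfl

theorem legOf_eq_sum (a : Λ) (M : Matrix (Fin n) (Fin n) B) (I J : Λ → Fin n) :
    legOf a M I J = ∑ j, if J = Function.update I a j then M (I a) j else 0 := by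
  simp only [eq_update_iff, legOf_apply]
  split_ifs with h
  · simp only [and_iff_right h]
    simp
  · exact (Finset.sum_eq_zero fun j _ => if_neg fun hj => h hj.1).symm

theorem legOf_mul_apply (a : Λ) (M : Matrix (Fin n) (Fin n) B)
    (W : Matrix (Λ → Fin n) (Λ → Fin n) B) (I J : Λ → Fin n) :
    (legOf a M * W) I J = ∑ j, M (I a) j * W (Function.update I a j) J := by
  simp only [Matrix.mul_apply, legOf_eq_sum, Finset.sum_mul]
  rw [Finset.sum_comm]
  simp

theorem legOf_mul_legOf_apply {a b : Λ} (hab : a ≠ b) (M N : Matrix (Fin n) (Fin n) B)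
    (I J : Λ → Fin n) : (legOf a M * legOf b N) I J =
      if ∀ c, c ≠ a → c ≠ b → I c = J c then M (I a) (J a) * N (I b) (J b) else 0 := by
  rw [legOf_mul_apply, Finset.sum_eq_single (J a)]
  · rw [legOf_apply, Function.update_of_ne hab.symm]
    have h : (∀ c, c ≠ b → Function.update I a (J a) c = J c) ↔
        ∀ c, c ≠ a → c ≠ b → I c = J c := by
      refine forall_congr' fun c => ?_
      by_cases hc : c = a
      · subst hc; simp
      · simp [hc]
    simp [h]
  · intro j _ hj
    rw [legOf_apply, if_neg, mul_zero]
    intro h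
    exact hj (by simpa using h a hab)
  · simp

theorem legOf_mul_legOf_same (a : Λ) (M N : Matrix (Fin n) (Fin n) B) :
    legOf a M * legOf a N = legOf a (M * N) := by
  ext I J
  rw [legOf_mul_apply, legOf_apply]
  simp only [legOf_apply, Matrix.mul_apply, Function.update_self]
  have h : ∀ j, (∀ c, c ≠ a → Function.update I a j c = J c) ↔ ∀ c, c ≠ a → I c = J c := by
    intro j
    refine forall₂_congr fun c hc => ?_
    simp [hc]
  simp only [h]
  split_ifs <;> simp

theorem legOf_scalar (a : Λ) (z : B) :
    legOf a (Matrix.scalar (Fin n) z) = Matrix.scalar (Λ → Fin n) z := by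
  ext I J
  simp only [legOf_apply, Matrix.scalar_apply, Matrix.diagonal_apply]
  by_cases h : I = J
  · subst h; simp
  · rw [if_neg h]
    split_ifs with h1 h2
    · exfalso
      refine h (funext fun b => ?_)
      by_cases hb : b = a
      · rw [hb, h2]
      · exact h1 b hb
    · rfl
    · rfl

theorem legOf_commute {a b : Λ} (hab : a ≠ b) {M N : Matrix (Fin n) (Fin n) B}
    (h : ∀ i j k l, Commute (M i j) (N k l)) : Commute (legOf a M) (legOf b N) := by
  ext I J
  rw [legOf_mul_legOf_apply hab, legOf_mul_legOf_apply hab.symm, (h _ _ _ _).eq]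
  have : (∀ c, c ≠ a → c ≠ b → I c = J c) ↔ (∀ c, c ≠ b → c ≠ a → I c = J c) :=
    forall_congr' fun c => ⟨fun h1 h2 h3 => h1 h3 h2, fun h1 h2 h3 => h1 h3 h2⟩
  simp [this]

theorem permRep_mul_legOf (σ : Equiv.Perm Λ) (a : Λ) (M : Matrix (Fin n) (Fin n) B) :
    permRep Λ n B σ * legOf a M = legOf (σ a) M * permRep Λ n B σ := by
  ext I J
  rw [permRep_mul_apply, mul_permRep_apply, legOf_apply, legOf_apply]
  have : (∀ b, b ≠ a → (I ∘ σ) b = J b) ↔ ∀ b, b ≠ σ a → I b = (J ∘ σ.symm) b := by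
    rw [← σ.forall_congr_right (q := fun b => b ≠ σ a → I b = (J ∘ σ.symm) b)]
    refine forall_congr' fun b => ?_
    simp
  rw [if_congr this rfl rfl]
  simp

theorem permRep_swap_commute {a b c : Λ} (ha : c ≠ a) (hb : c ≠ b)
    (M : Matrix (Fin n) (Fin n) B) :
    Commute (permRep Λ n B (Equiv.swap a b)) (legOf c M) := by
  rw [Commute, SemiconjBy, permRep_mul_legOf, Equiv.swap_apply_of_ne_of_ne ha hb]

/-- Legs in distinct factors do not share summation indices, so each entry is a single product. Its
order is that of the list, which matters because entries do not commute. -/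
theorem prod_legOf_apply (X : Λ → Matrix (Fin n) (Fin n) B) (l : List Λ) (hl : l.Nodup)
    (I J : Λ → Fin n) : (l.map fun a => legOf a (X a)).prod I J =
      if ∀ c, c ∉ l → I c = J c then (l.map fun a => X a (I a) (J a)).prod else 0 := by
  induction l generalizing I with
  | nil => simp [Matrix.one_apply, funext_iff]
  | cons a l ih =>
    have ha : a ∉ l := (List.nodup_cons.1 hl).1
    rw [List.map_cons, List.prod_cons, legOf_mul_apply, Finset.sum_eq_single (J a)]
    · rw [ih (List.nodup_cons.1 hl).2]
      have h : (∀ c, c ∉ l → Function.update I a (J a) c = J c) ↔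
          ∀ c, c ∉ a :: l → I c = J c := by
        refine forall_congr' fun c => ?_
        by_cases hc : c = a
        · subst hc; simp
        · simp [hc]
      have h2 : (l.map fun b => X b (Function.update I a (J a) b) (J b)) =
          l.map fun b => X b (I b) (J b) := by
        refine List.map_congr_left fun b hb => ?_
        rw [Function.update_of_ne]
        rintro rfl
        exact ha hb
      simp only [h, h2, List.map_cons, List.prod_cons]
      split_ifs <;> simp
    · intro j _ hj
      rw [ih (List.nodup_cons.1 hl).2, if_neg, mul_zero]
      intro h
      exact hj (by simpa using h a ha)
    · simp

/-- Two matrices `M`, `N` with `(1 - P) M₁ N₂ (1 + P) = 0`. -/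
def Fusible (M N : Matrix (Fin n) (Fin n) B) : Prop :=
  ∀ i j k l, M i j * N k l + M i l * N k j = M k j * N i l + M k l * N i j

/-- Justifies the definition of `Fusible`: its four products are the entries of `(1 - P) M_a N_b (1
+ P)`, moved to the two sides of an equation. -/
theorem Fusible.legOf_mul {M N : Matrix (Fin n) (Fin n) B} (h : Fusible M N) {a b : Λ}
    (hab : a ≠ b) : (1 - permRep Λ n B (Equiv.swap a b)) * (legOf a M * legOf b N) *
      (1 + permRep Λ n B (Equiv.swap a b)) = 0 := by
  ext I J
  have hc : ∀ K : Λ → Fin n, ∀ c, c ≠ a → c ≠ b → K (Equiv.swap a b c) = K c :=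
    fun K c h1 h2 => by rw [Equiv.swap_apply_of_ne_of_ne h1 h2]
  have e1 : (∀ c, c ≠ a → c ≠ b → I (Equiv.swap a b c) = J c) ↔
      ∀ c, c ≠ a → c ≠ b → I c = J c :=
    forall_congr' fun c => forall₂_congr fun h1 h2 => by rw [hc I _ h1 h2]
  have e2 : (∀ c, c ≠ a → c ≠ b → I c = J (Equiv.swap a b c)) ↔
      ∀ c, c ≠ a → c ≠ b → I c = J c :=
    forall_congr' fun c => forall₂_congr fun h1 h2 => by rw [hc J _ h1 h2]
  have e3 : (∀ c, c ≠ a → c ≠ b → I (Equiv.swap a b c) = J (Equiv.swap a b c)) ↔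
      ∀ c, c ≠ a → c ≠ b → I c = J c :=
    forall_congr' fun c => forall₂_congr fun h1 h2 => by rw [hc I _ h1 h2, hc J _ h1 h2]
  rw [mul_add, mul_one, sub_mul, one_mul, Matrix.add_apply, mul_permRep_apply]
  simp only [Matrix.sub_apply, permRep_mul_apply, legOf_mul_legOf_apply hab, Function.comp_apply,
    Equiv.symm_swap, e1, e2, e3, Equiv.swap_apply_left, Equiv.swap_apply_right, Matrix.zero_apply]
  split_ifs
  · have := h (I a) (J a) (I b) (J b)
    rw [← sub_eq_zero] at this
    rw [← this]
    abel
  · simp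

end Legs

/-! ### Triangularity with respect to an idempotent -/

section Absorbs

variable {E : Type} [Ring E]

/-- The property `A W = A W A`. -/
def Absorbs (A W : E) : Prop := A * W * A = A * W

/-- Insert `A` after `W`, let it absorb `V`, and remove it again: `AWVA = AWAVA = AWAV = AWV`. -/
theorem Absorbs.mul {A W V : E} (hW : Absorbs A W) (hV : Absorbs A V) : Absorbs A (W * V) := by
  unfold Absorbs at *
  rw [← mul_assoc, ← hW, mul_assoc (A * W), mul_assoc (A * W), hV]

theorem Absorbs.one {A : E} (hA : A * A = A) : Absorbs A 1 := by
  simp [Absorbs, hA]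

theorem Absorbs.list_prod {A : E} (hA : A * A = A) {l : List E} (h : ∀ W ∈ l, Absorbs A W) :
    Absorbs A l.prod := by
  induction l with
  | nil => exact Absorbs.one hA
  | cons a l ih =>
    rw [List.prod_cons]
    exact (h a (by simp)).mul (ih fun W hW => h W (by simp [hW]))

theorem absorbs_of_commute {A W : E} (hA : A * A = A) (h : Commute A W) : Absorbs A W := by
  rw [Absorbs, h.eq, mul_assoc, hA]

theorem absorbs_mul {A A' W : E} (hc : Commute A A') (h : Absorbs A W) (h' : Absorbs A' W) :
    Absorbs (A * A') W := by
  unfold Absorbs at *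
  calc A * A' * W * (A * A') = A' * (A * W * A) * A' := by
        rw [hc.eq]; simp only [mul_assoc]; rw [hc.eq]
    _ = A * (A' * W * A') := by rw [h, ← mul_assoc, ← hc.eq]; simp only [mul_assoc]
    _ = A * A' * W := by rw [h', mul_assoc]

end Absorbs

/-! ### Antisymmetrizers -/

section Antisymmetrizer

variable {E : Type} [Ring E] [Algebra Scalars E] {k : ℕ}

/-- The image of the antisymmetrizer under a homomorphism from a symmetric group. -/
noncomputable def antisymm (ρ : Equiv.Perm (Fin k) →* E) : E :=
  const (1 / (k.factorial : ℂ)) • ∑ σ : Equiv.Perm (Fin k), (Equiv.Perm.sign σ : ℤ) • ρ σ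

theorem antisymm_mul (ρ : Equiv.Perm (Fin k) →* E) (τ : Equiv.Perm (Fin k)) :
    antisymm ρ * ρ τ = (Equiv.Perm.sign τ : ℤ) • antisymm ρ := by
  rw [antisymm, smul_mul_assoc, Finset.sum_mul, smul_comm]
  refine congrArg (fun e : E => const (1 / (k.factorial : ℂ)) • e) ?_
  rw [Finset.smul_sum]
  refine Fintype.sum_equiv (Equiv.mulRight τ) _ _ fun σ => ?_
  rw [Equiv.coe_mulRight, smul_smul, map_mul, map_mul, smul_mul_assoc]
  congr 1
  rcases Int.units_eq_one_or (Equiv.Perm.sign τ) with h | h <;> simp [h]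

theorem mul_antisymm_of {ρ : Equiv.Perm (Fin k) →* E} {W : E}
    (h : ∀ τ, W * ρ τ = (Equiv.Perm.sign τ : ℤ) • W) : W * antisymm ρ = W := by
  rw [antisymm, mul_smul_comm, Finset.mul_sum]
  have : ∀ σ ∈ (Finset.univ : Finset (Equiv.Perm (Fin k))),
      W * ((Equiv.Perm.sign σ : ℤ) • ρ σ) = W := by
    intro σ _
    rw [mul_smul_comm, h, smul_smul]
    rcases Int.units_eq_one_or (Equiv.Perm.sign σ) with h | h <;> simp [h]
  rw [Finset.sum_congr rfl this, Finset.sum_const, Finset.card_univ, Fintype.card_perm,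
    Fintype.card_fin, ← Nat.cast_smul_eq_nsmul Scalars, smul_smul, ← map_natCast const, ← map_mul,
    one_div, inv_mul_cancel₀ (by exact_mod_cast Nat.factorial_ne_zero k), map_one, one_smul]

theorem antisymm_mul_self (ρ : Equiv.Perm (Fin k) →* E) :
    antisymm ρ * antisymm ρ = antisymm ρ :=
  mul_antisymm_of (antisymm_mul ρ)

/-- Adjacent transpositions generate the symmetric group, so a sign change under each of them gives
the sign character on the right of `W`. -/
theorem mul_antisymm_of_adjacent {ρ : Equiv.Perm (Fin k) →* E} {W : E}
    (h : ∀ a b : Fin k, (b : ℕ) = a + 1 → W * ρ (Equiv.swap a b) = -W) :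
    W * antisymm ρ = W := by
  refine mul_antisymm_of fun τ => ?_
  match k with
  | 0 => simp [Subsingleton.elim τ 1]
  | k + 1 =>
    have hτ : τ ∈ Submonoid.closure
        (Set.range fun i : Fin k => Equiv.swap i.castSucc i.succ) := by
      rw [Equiv.Perm.mclosure_swap_castSucc_succ]
      trivial
    induction hτ using Submonoid.closure_induction with
    | mem x hx =>
      obtain ⟨i, rfl⟩ := hx
      rw [h _ _ (by simp), Equiv.Perm.sign_swap i.castSucc_lt_succ.ne]
      simp
    | one => simp
    | mul x y _ _ hx hy =>
      rw [map_mul, ← mul_assoc, hx, smul_mul_assoc, hy, smul_smul, map_mul]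
      simp

theorem eq_zero_of_two_mul {x : E} (h : x + x = 0) : x = 0 := by
  have h1 : const (1 / 2) • (x + x) = x := by
    rw [← two_smul Scalars, smul_smul, ← map_ofNat const 2, ← map_mul]
    norm_num
  rw [← h1, h, smul_zero]

/-- If `M_a M_b` can be fused, where `a`, `b` are consecutive in a list, then so can the product of
all `M_c`. -/
theorem antisymm_mul_prod_mul {ρ : Equiv.Perm (Fin k) →* E} {M : Fin k → E} {a b : Fin k}
    (hab : a ≠ b)
    (hM : ∀ c, c ≠ a → c ≠ b → Commute (ρ (Equiv.swap a b)) (M c))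
    (hf : (1 - ρ (Equiv.swap a b)) * (M a * M b) * (1 + ρ (Equiv.swap a b)) = 0)
    {l₁ l₂ : List (Fin k)} (hl : (l₁ ++ a :: b :: l₂).Nodup) :
    antisymm ρ * ((l₁ ++ a :: b :: l₂).map M).prod * ρ (Equiv.swap a b) =
      -(antisymm ρ * ((l₁ ++ a :: b :: l₂).map M).prod) := by
  rw [List.nodup_append] at hl
  obtain ⟨-, h2, h3⟩ := hl
  rw [List.nodup_cons, List.nodup_cons] at h2
  obtain ⟨h4, h5, -⟩ := h2
  have c1 : Commute (ρ (Equiv.swap a b)) (l₁.map M).prod := by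
    refine Commute.list_prod_right _ _ fun x hx => ?_
    obtain ⟨c, hc, rfl⟩ := List.mem_map.1 hx
    refine hM c (fun h => ?_) fun h => ?_
    · exact h3 c hc a (by simp) h
    · exact h3 c hc b (by simp) h
  have c2 : Commute (ρ (Equiv.swap a b)) (l₂.map M).prod := by
    refine Commute.list_prod_right _ _ fun x hx => ?_
    obtain ⟨c, hc, rfl⟩ := List.mem_map.1 hx
    refine hM c (fun h => ?_) fun h => ?_
    · exact h4 (by simp [← h, hc])
    · exact h5 (by simp [← h, hc])
  have hA : antisymm ρ * (1 - ρ (Equiv.swap a b)) = antisymm ρ + antisymm ρ := by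
    rw [mul_sub, mul_one, antisymm_mul, Equiv.Perm.sign_swap hab]
    simp
  simp only [List.map_append, List.map_cons, List.prod_append, List.prod_cons]
  generalize ρ (Equiv.swap a b) = P at *
  generalize (l₁.map M).prod = W₁ at *
  generalize (l₂.map M).prod = W₂ at *
  rw [eq_neg_iff_add_eq_zero]
  -- Doubling turns `A` into `A + A = A(1 - P)`. The factor `1 - P` then moves past `W₁` to meet `M
  -- a * M b`.
  refine eq_zero_of_two_mul ?_
  have e : antisymm ρ * (W₁ * (M a * (M b * W₂))) * P + antisymm ρ * (W₁ * (M a * (M b * W₂))) =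
      antisymm ρ * (W₁ * (M a * M b) * (1 + P) * W₂) := by
    have : W₁ * (M a * M b) * (1 + P) * W₂ =
        W₁ * (M a * M b) * (P * W₂) + W₁ * (M a * M b) * W₂ := by noncomm_ring
    rw [this, c2.eq]
    noncomm_ring
  have c3 : (1 - P) * W₁ = W₁ * (1 - P) := by rw [sub_mul, mul_sub, c1.eq]; simp
  rw [e, ← add_mul, ← hA]
  calc antisymm ρ * (1 - P) * (W₁ * (M a * M b) * (1 + P) * W₂)
      = antisymm ρ * (((1 - P) * W₁) * (M a * M b) * (1 + P) * W₂) := by noncomm_ring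
    _ = antisymm ρ * W₁ * ((1 - P) * (M a * M b) * (1 + P)) * W₂ := by rw [c3]; noncomm_ring
    _ = 0 := by rw [hf]; simp

theorem finRange_eq_append {a b : Fin k} (hab : (b : ℕ) = a + 1) :
    ∃ l₁ l₂, List.finRange k = l₁ ++ a :: b :: l₂ := by
  refine ⟨(List.finRange k).take a, (List.finRange k).drop (a + 2), ?_⟩
  conv_lhs => rw [← List.take_append_drop a (List.finRange k)]
  rw [List.drop_eq_getElem_cons (by simp), List.drop_eq_getElem_cons (by simp; omega)]
  simp only [List.getElem_finRange, Fin.cast_mk, Fin.eta]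
  have : (⟨(a : ℕ) + 1, by omega⟩ : Fin k) = b := Fin.ext hab.symm
  simp [this]

/-- Fusion of neighbours suffices, since an adjacent transposition commutes with all the other
factors and a product over `Fin k` puts the two fusible factors side by side. -/
theorem absorbs_prod {ρ : Equiv.Perm (Fin k) →* E} {M : Fin k → E}
    (hM : ∀ a b c, c ≠ a → c ≠ b → Commute (ρ (Equiv.swap a b)) (M c))
    (hf : ∀ a b : Fin k, (b : ℕ) = a + 1 →
      (1 - ρ (Equiv.swap a b)) * (M a * M b) * (1 + ρ (Equiv.swap a b)) = 0) :
    Absorbs (antisymm ρ) ((List.finRange k).map M).prod := by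
  refine mul_antisymm_of_adjacent fun a b hab => ?_
  obtain ⟨l₁, l₂, hl⟩ := finRange_eq_append hab
  have hne : a ≠ b := fun h => by rw [h] at hab; omega
  rw [hl]
  exact antisymm_mul_prod_mul hne (hM a b) (hf a b hab) (hl ▸ List.nodup_finRange k)

theorem absorbs_prod_reverse {ρ : Equiv.Perm (Fin k) →* E} {M : Fin k → E}
    (hM : ∀ a b c, c ≠ a → c ≠ b → Commute (ρ (Equiv.swap a b)) (M c))
    (hf : ∀ a b : Fin k, (b : ℕ) = a + 1 →
      (1 - ρ (Equiv.swap a b)) * (M b * M a) * (1 + ρ (Equiv.swap a b)) = 0) :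
    Absorbs (antisymm ρ) ((List.finRange k).reverse.map M).prod := by
  refine mul_antisymm_of_adjacent fun a b hab => ?_
  obtain ⟨l₁, l₂, hl⟩ := finRange_eq_append hab
  have hne : b ≠ a := fun h => by rw [h] at hab; omega
  have hl' : (List.finRange k).reverse = l₂.reverse ++ b :: a :: l₁.reverse := by
    rw [hl]; simp
  rw [hl', Equiv.swap_comm]
  refine antisymm_mul_prod_mul hne (hM b a) ?_ (hl' ▸ List.nodup_reverse.2 (List.nodup_finRange k))
  rw [Equiv.swap_comm]
  exact hf a b hab

end Antisymmetrizer

/-! ### Partial traces and crossing symmetry -/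

section Crossing

variable {n : ℕ} {B : Type} [Ring B]

/-- The reversed order nests the pairs `X_a`, `Y_a`, so the sums collapse from the inside outwards.
No commutation between entries is needed. -/
theorem sum_prod_mul_prod_reverse {k : ℕ} (X Y : Fin k → Matrix (Fin n) (Fin n) B)
    (h : ∀ a j l, ∑ i, X a i j * Y a l i = if j = l then 1 else 0) (P Q : Fin k → Fin n) :
    ∑ I : Fin k → Fin n, (List.ofFn fun a => X a (I a) (P a)).prod *
      (List.ofFn fun a => Y a (Q a) (I a)).reverse.prod = if P = Q then 1 else 0 := by
  induction k with
  | zero => simp [Subsingleton.elim P Q]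
  | succ k ih =>
    rw [← (Fin.consEquiv fun _ : Fin (k + 1) => Fin n).sum_comp, Fintype.sum_prod_type]
    simp only [Fin.consEquiv_apply, List.ofFn_succ, Fin.cons_zero, Fin.cons_succ, List.prod_cons,
      List.reverse_cons, List.prod_append, List.prod_nil, mul_one]
    have e : ∀ i : Fin n, ∑ I : Fin k → Fin n,
        X 0 i (P 0) * (List.ofFn fun a : Fin k => X a.succ (I a) (P a.succ)).prod *
          ((List.ofFn fun a : Fin k => Y a.succ (Q a.succ) (I a)).reverse.prod * Y 0 (Q 0) i) =
        if (fun a : Fin k => P a.succ) = (fun a => Q a.succ) then X 0 i (P 0) * Y 0 (Q 0) i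
          else 0 := by
      intro i
      have := ih (fun a => X a.succ) (fun a => Y a.succ) (fun a => h a.succ)
        (fun a => P a.succ) (fun a => Q a.succ)
      calc _ = X 0 i (P 0) * (if (fun a : Fin k => P a.succ) = (fun a => Q a.succ) then 1 else 0) *
            Y 0 (Q 0) i := by
            rw [← this, Finset.mul_sum, Finset.sum_mul]
            exact Finset.sum_congr rfl fun _ _ => by simp only [mul_assoc]
        _ = _ := by split_ifs <;> simp
    have hPQ : P = Q ↔ P 0 = Q 0 ∧ (fun a : Fin k => P a.succ) = (fun a => Q a.succ) := by
      rw [funext_iff, Fin.forall_fin_succ, funext_iff]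
    simp only [e, hPQ]
    by_cases h1 : (fun a : Fin k => P a.succ) = (fun a => Q a.succ)
    · simp [h1, h]
    · simp [h1]

theorem prod_legOf_finRange_apply {k : ℕ} (X : Fin k → Matrix (Fin n) (Fin n) B)
    (I J : Fin k → Fin n) : ((List.finRange k).map fun a => legOf a (X a)).prod I J =
      (List.ofFn fun a => X a (I a) (J a)).prod := by
  rw [prod_legOf_apply _ _ (List.nodup_finRange k), if_pos (by simp), List.ofFn_eq_map]

theorem prod_legOf_reverse_finRange_apply {k : ℕ} (X : Fin k → Matrix (Fin n) (Fin n) B)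
    (I J : Fin k → Fin n) : ((List.finRange k).reverse.map fun a => legOf a (X a)).prod I J =
      (List.ofFn fun a => X a (I a) (J a)).reverse.prod := by
  rw [prod_legOf_apply _ _ (List.nodup_reverse.2 (List.nodup_finRange k)), if_pos (by simp),
    List.ofFn_eq_map, List.map_reverse]

/-- Entries of `N` can be pulled to the left of those of the `X_a`. The outer trace index then
contracts `X_a` against `Y_a` in the transposed pattern of the crossing relation. -/
theorem trace_crossing {k : ℕ} (X Y : Fin k → Matrix (Fin n) (Fin n) B)
    (h : ∀ a j l, ∑ i, X a i j * Y a l i = if j = l then 1 else 0)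
    (N : Matrix (Fin k → Fin n) (Fin k → Fin n) B)
    (hN : ∀ a i j P Q, Commute (X a i j) (N P Q)) :
    Matrix.trace (((List.finRange k).map fun a => legOf a (X a)).prod * N *
      ((List.finRange k).reverse.map fun a => legOf a (Y a)).prod) = Matrix.trace N := by
  have hc : ∀ I P P' Q, Commute (((List.finRange k).map fun a => legOf a (X a)).prod I P)
      (N P' Q) := by
    intro I P P' Q
    rw [prod_legOf_finRange_apply]
    refine Commute.list_prod_left _ _ fun x hx => ?_
    obtain ⟨a, rfl⟩ := (List.mem_ofFn' _ _).1 hx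
    exact hN _ _ _ _ _
  simp only [Matrix.trace, Matrix.diag_apply]
  calc ∑ I, (((List.finRange k).map fun a => legOf a (X a)).prod * N *
          ((List.finRange k).reverse.map fun a => legOf a (Y a)).prod) I I
      = ∑ I, ∑ Q, ∑ P, N P Q * (((List.finRange k).map fun a => legOf a (X a)).prod I P *
          ((List.finRange k).reverse.map fun a => legOf a (Y a)).prod Q I) := by
        refine Finset.sum_congr rfl fun I _ => ?_
        rw [Matrix.mul_apply]
        refine Finset.sum_congr rfl fun Q _ => ?_
        rw [Matrix.mul_apply, Finset.sum_mul]
        refine Finset.sum_congr rfl fun P _ => ?_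
        rw [(hc I P P Q).eq, mul_assoc]
    _ = ∑ Q, ∑ P, N P Q * ∑ I, ((List.finRange k).map fun a => legOf a (X a)).prod I P *
          ((List.finRange k).reverse.map fun a => legOf a (Y a)).prod Q I := by
        rw [Finset.sum_comm]
        refine Finset.sum_congr rfl fun Q _ => ?_
        rw [Finset.sum_comm]
        simp only [Finset.mul_sum]
    _ = ∑ Q, N Q Q := by
        simp only [prod_legOf_finRange_apply, prod_legOf_reverse_finRange_apply,
          sum_prod_mul_prod_reverse X Y h]
        simp

end Crossing

/-! ### Moving an element through a fused trace -/

section Invariance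

variable {n k : ℕ} {B : Type} [Ring B] [Algebra Scalars B]

/-- The antisymmetrizer on `(ℂⁿ)^{⊗ k}` with coefficients in `B`. -/
noncomputable def antisymmMatrix (n k : ℕ) (B : Type) [Ring B] [Algebra Scalars B] :
    Matrix (Fin k → Fin n) (Fin k → Fin n) B :=
  antisymm (permRep (Fin k) n B)

/-- A combination of permutation matrices only relabels the diagonal, so cyclicity holds over a
noncommutative ring. -/
theorem trace_antisymmMatrix_mul (W : Matrix (Fin k → Fin n) (Fin k → Fin n) B) :
    Matrix.trace (antisymmMatrix n k B * W) = Matrix.trace (W * antisymmMatrix n k B) := by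
  simp only [antisymmMatrix, antisymm, smul_mul_assoc, mul_smul_comm, Finset.sum_mul,
    Finset.mul_sum, Matrix.trace_smul, Matrix.trace_sum, trace_permRep_mul]

theorem antisymmMatrix_apply_mem_center (I J : Fin k → Fin n) :
    antisymmMatrix n k B I J ∈ Subring.center B := by
  rw [Subring.mem_center_iff]
  intro b
  simp only [antisymmMatrix, antisymm, Matrix.smul_apply, Matrix.sum_apply, permRep_apply,
    mul_smul_comm, smul_mul_assoc, Finset.mul_sum, Finset.sum_mul]
  congr 1
  refine Finset.sum_congr rfl fun σ _ => ?_
  split_ifs <;> simp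

/-- If `Z L_a = X_a L_a Z Y_a`, where `X_a`, `Y_a` are numerical matrices related by crossing
symmetry and `Z` acts as the identity modulo a left ideal, then `Z` fixes
`tr A_k L_1 ⋯ L_k` modulo that ideal. -/
theorem sub_one_mul_trace_mem (X L Y : Fin k → Matrix (Fin n) (Fin n) B) (Z : B)
    (S : Subring B) (J : Ideal B)
    (hX : ∀ a i j, X a i j ∈ S) (hY : ∀ a i j, Y a i j ∈ S)
    (hS : ∀ s ∈ S, ∀ a i j, Commute s (L a i j))
    (hXf : ∀ a b : Fin k, (b : ℕ) = a + 1 → Fusible (X a) (X b))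
    (hLf : ∀ a b : Fin k, (b : ℕ) = a + 1 → Fusible (L a) (L b))
    (hYf : ∀ a b : Fin k, (b : ℕ) = a + 1 → Fusible (Y b) (Y a))
    (hcross : ∀ a j l, ∑ i, X a i j * Y a l i = if j = l then 1 else 0)
    (hrel : ∀ a, Matrix.scalar (Fin n) Z * L a = X a * L a * Matrix.scalar (Fin n) Z * Y a)
    (hJ : ∀ s ∈ S, (Z - 1) * s ∈ J) :
    (Z - 1) * Matrix.trace (antisymmMatrix n k B *
      ((List.finRange k).map fun a => legOf a (L a)).prod) ∈ J := by
  have hA := antisymm_mul_self (permRep (Fin k) n B)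
  have hne : ∀ a b : Fin k, (b : ℕ) = a + 1 → a ≠ b := fun a b hab h => by
    rw [h] at hab; omega
  have aX : Absorbs (antisymmMatrix n k B) ((List.finRange k).map fun a => legOf a (X a)).prod :=
    absorbs_prod (fun a b c ha hb => permRep_swap_commute ha hb _)
      fun a b hab => (hXf a b hab).legOf_mul (hne a b hab)
  have aL : Absorbs (antisymmMatrix n k B) ((List.finRange k).map fun a => legOf a (L a)).prod :=
    absorbs_prod (fun a b c ha hb => permRep_swap_commute ha hb _)
      fun a b hab => (hLf a b hab).legOf_mul (hne a b hab)
  have aY : Absorbs (antisymmMatrix n k B)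
      ((List.finRange k).reverse.map fun a => legOf a (Y a)).prod :=
    absorbs_prod_reverse (fun a b c ha hb => permRep_swap_commute ha hb _)
      fun a b hab => by
        rw [Equiv.swap_comm]
        exact (hYf a b hab).legOf_mul (hne a b hab).symm
  -- Each passage of `Z` leaves `X_a` on the left and `Y_a` on the right. The factors `Y_a`
  -- therefore accumulate in reverse order, the order in which both fusion and crossing apply to
  -- them.
  have hZ : ∀ l : List (Fin k), l.Nodup → Matrix.scalar (Fin k → Fin n) Z *
      (l.map fun a => legOf a (L a)).prod = (l.map fun a => legOf a (X a)).prod *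
        (l.map fun a => legOf a (L a)).prod * Matrix.scalar (Fin k → Fin n) Z *
          (l.reverse.map fun a => legOf a (Y a)).prod := by
    intro l hl
    induction l with
    | nil => simp
    | cons a l ih =>
      have hal : a ∉ l := (List.nodup_cons.1 hl).1
      have e : Matrix.scalar (Fin k → Fin n) Z * legOf a (L a) =
          legOf a (X a) * legOf a (L a) * Matrix.scalar (Fin k → Fin n) Z * legOf a (Y a) := by
        rw [← legOf_scalar a, legOf_mul_legOf_same, legOf_mul_legOf_same, legOf_mul_legOf_same,
          legOf_mul_legOf_same, hrel]
      have hYL : Commute (legOf a (Y a)) (l.map fun a => legOf a (L a)).prod := by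
        refine Commute.list_prod_right _ _ fun x hx => ?_
        obtain ⟨b, hb, rfl⟩ := List.mem_map.1 hx
        exact legOf_commute (fun h : a = b => hal (h ▸ hb)) fun i j p q => hS _ (hY a i j) _ _ _
      have hXL : Commute (legOf a (L a)) (l.map fun a => legOf a (X a)).prod := by
        refine Commute.list_prod_right _ _ fun x hx => ?_
        obtain ⟨b, hb, rfl⟩ := List.mem_map.1 hx
        exact legOf_commute (fun h : a = b => hal (h ▸ hb)) fun i j p q =>
          (hS _ (hX b p q) _ _ _).symm
      have ih := ih (List.nodup_cons.1 hl).2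
      simp only [List.map_cons, List.prod_cons, List.reverse_cons, List.map_append, List.map_nil,
        List.prod_append, List.prod_nil, mul_one]
      generalize (l.map fun a => legOf a (L a)).prod = WL at *
      generalize (l.map fun a => legOf a (X a)).prod = WX at *
      generalize (l.reverse.map fun a => legOf a (Y a)).prod = WY at *
      generalize legOf a (X a) = x at *
      generalize legOf a (L a) = y at *
      generalize legOf a (Y a) = z at *
      generalize Matrix.scalar (Fin k → Fin n) Z = c at *
      calc c * (y * WL) = (c * y) * WL := (mul_assoc _ _ _).symm
        _ = x * y * c * (z * WL) := by rw [e, mul_assoc]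
        _ = x * y * (c * WL) * z := by rw [hYL.eq]; simp only [mul_assoc]
        _ = x * (y * WX) * WL * c * WY * z := by rw [ih]; simp only [mul_assoc]
        _ = x * WX * (y * WL) * c * (WY * z) := by rw [hXL.eq]; simp only [mul_assoc]
  have hZ := hZ _ (List.nodup_finRange k)
  have hN : ∀ s ∈ S, ∀ P Q, Commute s ((antisymmMatrix n k B *
      ((List.finRange k).map fun a => legOf a (L a)).prod) P Q) := by
    intro s hs P Q
    rw [Matrix.mul_apply]
    refine Commute.sum_right _ _ _ fun R _ => Commute.mul_right ?_ ?_
    · exact Subring.mem_center_iff.1 (antisymmMatrix_apply_mem_center P R) s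
    · rw [prod_legOf_finRange_apply]
      refine Commute.list_prod_right _ _ fun x hx => ?_
      obtain ⟨a, rfl⟩ := (List.mem_ofFn' _ _).1 hx
      exact hS s hs _ _ _
  -- Absorption turns `A·WX` into `A·WX·A`. Moving the first `A` cyclically gives `WX·(A·WL·WY·A) =
  -- WX·(A·WL)·WY`, and crossing removes `WX` and `WY`.
  have htr : Matrix.trace (antisymmMatrix n k B *
      (((List.finRange k).map fun a => legOf a (X a)).prod *
        ((List.finRange k).map fun a => legOf a (L a)).prod *
          ((List.finRange k).reverse.map fun a => legOf a (Y a)).prod)) =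
      Matrix.trace (antisymmMatrix n k B *
        ((List.finRange k).map fun a => legOf a (L a)).prod) := by
    rw [← trace_crossing X Y hcross _ fun a i j P Q => hN _ (hX a i j) P Q]
    have aLY := aL.mul aY
    unfold Absorbs at aX aLY
    generalize ((List.finRange k).map fun a => legOf a (X a)).prod = WX at *
    generalize ((List.finRange k).map fun a => legOf a (L a)).prod = WL at *
    generalize ((List.finRange k).reverse.map fun a => legOf a (Y a)).prod = WY at *
    calc Matrix.trace (antisymmMatrix n k B * (WX * WL * WY))
        = Matrix.trace (antisymmMatrix n k B * (WX * antisymmMatrix n k B * (WL * WY))) := by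
          have : antisymmMatrix n k B * (WX * antisymmMatrix n k B * (WL * WY)) =
              antisymmMatrix n k B * WX * antisymmMatrix n k B * (WL * WY) := by
            simp only [mul_assoc]
          rw [this, aX]
          simp only [mul_assoc]
      _ = Matrix.trace (WX * (antisymmMatrix n k B * (WL * WY) * antisymmMatrix n k B)) := by
          rw [trace_antisymmMatrix_mul]; simp only [mul_assoc]
      _ = _ := by rw [aLY]; simp only [mul_assoc]
  have hscalar : ∀ (z : B) (W : Matrix (Fin k → Fin n) (Fin k → Fin n) B),
      z * Matrix.trace W = Matrix.trace (Matrix.scalar (Fin k → Fin n) z * W) := by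
    intro z W
    simp [Matrix.trace, Finset.mul_sum, Matrix.scalar_apply, Matrix.diagonal_mul]
  have hAZ : Commute (Matrix.scalar (Fin k → Fin n) Z) (antisymmMatrix n k B) := by
    ext I J
    simp only [Matrix.scalar_apply, Matrix.diagonal_mul, Matrix.mul_diagonal]
    exact Subring.mem_center_iff.1 (antisymmMatrix_apply_mem_center I J) Z
  -- By `htr`, the value of the right-hand side of `hZ` at `Z = 1` is the original trace, so
  -- subtracting it replaces `Z` by `Z - 1`.
  have key : (Z - 1) * Matrix.trace (antisymmMatrix n k B *
      ((List.finRange k).map fun a => legOf a (L a)).prod) =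
      Matrix.trace (antisymmMatrix n k B * ((List.finRange k).map fun a => legOf a (X a)).prod *
        ((List.finRange k).map fun a => legOf a (L a)).prod *
          (Matrix.scalar (Fin k → Fin n) (Z - 1) *
            ((List.finRange k).reverse.map fun a => legOf a (Y a)).prod)) := by
    rw [sub_mul, one_mul, hscalar, ← mul_assoc, hAZ.eq, mul_assoc, hZ, map_sub, map_one, sub_mul,
      one_mul, mul_sub, Matrix.trace_sub]
    conv_lhs => rw [← htr]
    simp only [mul_assoc]
  rw [key, Matrix.trace]
  refine J.sum_mem fun I _ => ?_
  rw [Matrix.diag_apply, Matrix.mul_apply]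
  refine J.sum_mem fun Q _ => J.mul_mem_left _ ?_
  rw [Matrix.scalar_apply, Matrix.diagonal_mul]
  -- `J` is only a left ideal. The factors to the left of `Z - 1` are harmless, whereas the entries
  -- of the `Y_a` on its right are covered by `hJ`, since they lie in `S`.
  refine hJ _ ?_
  rw [prod_legOf_reverse_finRange_apply]
  refine S.list_prod_mem fun x hx => ?_
  rw [List.mem_reverse, List.mem_ofFn'] at hx
  obtain ⟨a, rfl⟩ := hx
  exact hY _ _ _

end Invariance

/-! ### Products of R-matrices -/

section ListProducts

variable {E : Type} [Ring E] {α β : Type}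

theorem list_prod_mul_list_prod {f g : α → E} (l : List α) (hl : l.Nodup)
    (h : ∀ a b, a ≠ b → Commute (f a) (g b)) :
    (l.map f).prod * (l.map g).prod = (l.map fun a => f a * g a).prod := by
  induction l with
  | nil => simp
  | cons a l ih =>
    rw [List.nodup_cons] at hl
    have hc : Commute (l.map f).prod (g a) := by
      refine Commute.list_prod_left _ _ fun x hx => ?_
      obtain ⟨b, hb, rfl⟩ := List.mem_map.1 hx
      exact h b a fun e => hl.1 (e ▸ hb)
    simp only [List.map_cons, List.prod_cons]
    rw [← ih hl.2, mul_assoc, ← mul_assoc _ (g a), hc.eq]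
    simp only [mul_assoc]

/-- Lets a product of R-matrices be read by rows or by columns. One reading exposes fusion in the
first group of tensor factors, the other in the second. -/
theorem list_prod_comm {F : α → β → E} (la : List α) (lb : List β) (ha : la.Nodup)
    (hb : lb.Nodup) (h : ∀ a a' b b', a ≠ a' → b ≠ b' → Commute (F a b) (F a' b')) :
    (lb.map fun b => (la.map fun a => F a b).prod).prod =
      (la.map fun a => (lb.map fun b => F a b).prod).prod := by
  induction lb with
  | nil => simp
  | cons b lb ih =>
    rw [List.nodup_cons] at hb
    simp only [List.map_cons, List.prod_cons]
    rw [ih hb.2, list_prod_mul_list_prod la ha]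
    intro a a' haa'
    refine Commute.list_prod_right _ _ fun x hx => ?_
    obtain ⟨b', hb', rfl⟩ := List.mem_map.1 hx
    exact h _ _ _ _ haa' fun e => hb.1 (e ▸ hb')

/-- The innermost pair is a scalar and leaves the product, then the next pair becomes innermost.
This yields an inverse up to a scalar factor. -/
theorem list_prod_reverse_mul {K : Type} [CommRing K] [Algebra K E] {f g : α → E} {r : α → K}
    (l : List α) (h : ∀ a, f a * g a = algebraMap K E (r a)) :
    (l.reverse.map f).prod * (l.map g).prod = algebraMap K E (l.map r).prod := by
  induction l with
  | nil => simp
  | cons a l ih =>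
    simp only [List.map_cons, List.prod_cons, List.reverse_cons, List.map_append, List.map_nil,
      List.prod_append, List.prod_nil, mul_one]
    rw [mul_assoc, ← mul_assoc (f a), h, map_mul, ← ih, ← mul_assoc, ← mul_assoc,
      Algebra.commutes]

/-- Moving a single factor `L'_b` through the product of the `L_a`. -/
theorem train_single {R : α → E} {L : α → E} {T : E} (la : List α) (ha : la.Nodup)
    (hR : ∀ a, R a * (L a * T) = T * L a * R a)
    (hL : ∀ a a', a ≠ a' → Commute (R a) (L a')) :
    (la.map R).prod * ((la.map L).prod * T) = T * (la.map L).prod * (la.map R).prod := by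
  induction la with
  | nil => simp
  | cons a l ih =>
    rw [List.nodup_cons] at ha
    have c1 : Commute (l.map R).prod (L a) := by
      refine Commute.list_prod_left _ _ fun x hx => ?_
      obtain ⟨b, hb, rfl⟩ := List.mem_map.1 hx
      exact hL b a fun e => ha.1 (e ▸ hb)
    have c2 : Commute (R a) (l.map L).prod := by
      refine Commute.list_prod_right _ _ fun x hx => ?_
      obtain ⟨b, hb, rfl⟩ := List.mem_map.1 hx
      exact hL a b fun e => ha.1 (e ▸ hb)
    have ih := ih ha.2
    have hRa := hR a
    simp only [List.map_cons, List.prod_cons]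
    generalize (l.map R).prod = WR at *
    generalize (l.map L).prod = WL at *
    calc R a * WR * (L a * WL * T) = R a * (WR * L a) * (WL * T) := by simp only [mul_assoc]
      _ = R a * L a * (WR * (WL * T)) := by rw [c1.eq]; simp only [mul_assoc]
      _ = R a * (L a * T) * (WL * WR) := by rw [ih]; simp only [mul_assoc]
      _ = T * L a * (R a * WL) * WR := by rw [hRa]; simp only [mul_assoc]
      _ = T * (L a * WL) * (R a * WR) := by rw [c2.eq]; simp only [mul_assoc]

/-- The rightmost block of R-matrices carries the first `L'_b` through all the `L_a`; the remaining
blocks commute with that `L'_b`, and induction handles the rest. -/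
theorem train {R : α → β → E} {L : α → E} {L' : β → E} (la : List α) (lb : List β)
    (ha : la.Nodup) (hb : lb.Nodup)
    (hR : ∀ a b, R a b * (L a * L' b) = L' b * L a * R a b)
    (hL : ∀ a a' b, a ≠ a' → Commute (R a b) (L a'))
    (hL' : ∀ a b b', b ≠ b' → Commute (R a b) (L' b')) :
    (lb.reverse.map fun b => (la.map fun a => R a b).prod).prod *
        ((la.map L).prod * (lb.map L').prod) =
      (lb.map L').prod * (la.map L).prod *
        (lb.reverse.map fun b => (la.map fun a => R a b).prod).prod := by
  induction lb with
  | nil => simp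
  | cons b l ih =>
    rw [List.nodup_cons] at hb
    have c1 : Commute (la.map fun a => R a b).prod (l.map L').prod := by
      refine Commute.list_prod_left _ _ fun x hx => ?_
      obtain ⟨a, -, rfl⟩ := List.mem_map.1 hx
      refine Commute.list_prod_right _ _ fun x hx => ?_
      obtain ⟨b', hb', rfl⟩ := List.mem_map.1 hx
      exact hL' a b b' fun e => hb.1 (e ▸ hb')
    have c2 : Commute (l.reverse.map fun b => (la.map fun a => R a b).prod).prod (L' b) := by
      refine Commute.list_prod_left _ _ fun x hx => ?_
      obtain ⟨b', hb', rfl⟩ := List.mem_map.1 hx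
      refine Commute.list_prod_left _ _ fun x hx => ?_
      obtain ⟨a, -, rfl⟩ := List.mem_map.1 hx
      exact hL' a b' b fun e => hb.1 (e ▸ List.mem_reverse.1 hb')
    have h1 := train_single (R := fun a => R a b) (L := L) (T := L' b) la ha (fun a => hR a b)
      fun a a' h => hL a a' b h
    have ih := ih hb.2
    simp only [List.map_cons, List.prod_cons, List.reverse_cons, List.map_append, List.map_nil,
      List.prod_append, List.prod_nil, mul_one]
    generalize (l.reverse.map fun b => (la.map fun a => R a b).prod).prod = WR at *
    generalize (la.map fun a => R a b).prod = Rb at *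
    generalize (la.map L).prod = WL at *
    generalize (l.map L').prod = WL' at *
    calc WR * Rb * (WL * (L' b * WL')) = WR * (Rb * (WL * L' b)) * WL' := by
          simp only [mul_assoc]
      _ = WR * L' b * WL * (Rb * WL') := by rw [h1]; simp only [mul_assoc]
      _ = L' b * (WR * (WL * WL')) * Rb := by rw [c2.eq, c1.eq]; simp only [mul_assoc]
      _ = _ := by rw [ih]; simp only [mul_assoc]

end ListProducts

/-- The Yang–Baxter equation at a point where the R-matrix degenerates to `1 - P`. -/
theorem yangBaxter_fusion {K E : Type} [CommRing K] [Ring E] [Algebra K E] {P Q₁ Q₂ : E}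
    (hP : P * P = 1) (h1 : P * Q₁ = Q₂ * P) (h2 : Q₁ * Q₂ = P * Q₁) {c₁ c₂ d₁ d₂ : K}
    (hc : c₁ * d₂ - d₁ * c₂ + d₁ * d₂ = 0) :
    (1 - P) * ((c₁ • (1 : E) + d₁ • Q₁) * (c₂ • (1 : E) + d₂ • Q₂)) * (1 + P) = 0 := by
  have t0 : (1 - P) * (1 + P) = 0 := by
    rw [sub_mul, mul_add, mul_add, hP]; simp [add_comm]
  have hPm : P * (1 + P) = 1 + P := by rw [mul_add, hP, mul_one, add_comm]
  have hPm' : (1 - P) * P = -(1 - P) := by rw [sub_mul, hP, one_mul]; abel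
  have t1 : (1 - P) * Q₂ * (1 + P) = -((1 - P) * Q₁ * (1 + P)) := by
    calc (1 - P) * Q₂ * (1 + P) = (1 - P) * (Q₂ * P) * (1 + P) := by
          rw [← mul_assoc, mul_assoc _ P, hPm]
      _ = (1 - P) * P * Q₁ * (1 + P) := by rw [← h1]; simp only [mul_assoc]
      _ = _ := by rw [hPm']; simp only [neg_mul]
  have t2 : (1 - P) * (Q₁ * Q₂) * (1 + P) = -((1 - P) * Q₁ * (1 + P)) := by
    rw [h2, ← mul_assoc, hPm']; simp only [neg_mul]
  have e : (1 - P) * ((c₁ • (1 : E) + d₁ • Q₁) * (c₂ • (1 : E) + d₂ • Q₂)) * (1 + P) =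
      (c₁ * c₂) • ((1 - P) * (1 + P)) + (c₁ * d₂) • ((1 - P) * Q₂ * (1 + P)) +
        (d₁ * c₂) • ((1 - P) * Q₁ * (1 + P)) + (d₁ * d₂) • ((1 - P) * (Q₁ * Q₂) * (1 + P)) := by
    generalize 1 - P = U
    generalize 1 + P = V
    simp only [mul_add, add_mul, smul_mul_assoc, mul_smul_comm, smul_smul, one_mul, mul_one,
      smul_add]
    module
  rw [e, t0, t1, t2]
  calc _ = -((c₁ * d₂ - d₁ * c₂ + d₁ * d₂) • ((1 - P) * Q₁ * (1 + P))) := by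
        rw [smul_zero]; module
    _ = 0 := by rw [hc]; simp

/-! ### Products of traces -/

section Embed

variable {I₁ I₂ Idx : Type} [Fintype I₁] [Fintype I₂] [Fintype Idx] [DecidableEq I₁]
  [DecidableEq I₂] [DecidableEq Idx] {B : Type} [Ring B]

/-- The matrix `W ⊗ 1`. -/
def embed (e : Idx ≃ I₁ × I₂) : Matrix I₁ I₁ B →+* Matrix Idx Idx B where
  toFun W := (Matrix.blockDiagonal fun _ : I₂ => W).submatrix e e
  map_one' := by
    rw [show (fun _ : I₂ => (1 : Matrix I₁ I₁ B)) = 1 from rfl, Matrix.blockDiagonal_one,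
      Matrix.submatrix_one_equiv]
  map_mul' W V := by rw [Matrix.blockDiagonal_mul, Matrix.submatrix_mul_equiv]
  map_zero' := by
    rw [show (fun _ : I₂ => (0 : Matrix I₁ I₁ B)) = 0 from rfl, Matrix.blockDiagonal_zero]
    rfl
  map_add' W V := by
    rw [show (fun _ : I₂ => W + V) = (fun _ => W) + fun _ => V from rfl,
      Matrix.blockDiagonal_add]
    rfl

theorem embed_apply (e : Idx ≃ I₁ × I₂) (W : Matrix I₁ I₁ B) (x y : Idx) :
    embed e W x y = if (e x).2 = (e y).2 then W (e x).1 (e y).1 else 0 := rfl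

theorem embed_smul {R : Type} [CommRing R] [Algebra R B] (e : Idx ≃ I₁ × I₂) (c : R)
    (W : Matrix I₁ I₁ B) : embed e (c • W) = c • embed e W := by
  ext x y
  simp only [embed_apply, Matrix.smul_apply]
  split_ifs <;> simp

/-- Multiplicativity over complementary tensor factors holds for noncommuting entries because every
diagonal entry keeps the factor of `W` on the left. -/
theorem trace_embed_mul_embed (e : Idx ≃ I₁ × I₂) (e' : Idx ≃ I₂ × I₁)
    (he : ∀ x, e' x = (e x).swap) (W : Matrix I₁ I₁ B) (V : Matrix I₂ I₂ B) :
    Matrix.trace (embed e W * embed e' V) = Matrix.trace W * Matrix.trace V := by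
  simp only [Matrix.trace, Matrix.diag_apply, Finset.sum_mul_sum]
  rw [← Fintype.sum_prod_type', ← e.sum_comp]
  refine Finset.sum_congr rfl fun x _ => ?_
  rw [Matrix.mul_apply, Finset.sum_eq_single x]
  · simp [embed_apply, he]
  · intro y _ hy
    rw [embed_apply, embed_apply]
    simp only [he, Prod.snd_swap, Prod.fst_swap]
    split_ifs with h1 h2
    · exact absurd (e.injective (Prod.ext h2 h1.symm)) hy
    all_goals simp
  · simp

end Embed

/-! ### Commuting traces -/

section CommutingTraces

variable {n k m : ℕ} {B : Type} [Ring B]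

/-- The symmetric group of the first group of tensor factors. -/
def permRepLeft (n k m : ℕ) (B : Type) [Ring B] :
    Equiv.Perm (Fin k) →* Matrix (Fin k ⊕ Fin m → Fin n) (Fin k ⊕ Fin m → Fin n) B :=
  (permRep (Fin k ⊕ Fin m) n B).comp
    ((Equiv.Perm.sumCongrHom (Fin k) (Fin m)).comp (MonoidHom.inl _ _))

/-- The symmetric group of the second group of tensor factors. -/
def permRepRight (n k m : ℕ) (B : Type) [Ring B] :
    Equiv.Perm (Fin m) →* Matrix (Fin k ⊕ Fin m → Fin n) (Fin k ⊕ Fin m → Fin n) B :=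
  (permRep (Fin k ⊕ Fin m) n B).comp
    ((Equiv.Perm.sumCongrHom (Fin k) (Fin m)).comp (MonoidHom.inr _ _))

theorem permRepLeft_apply (σ : Equiv.Perm (Fin k)) :
    permRepLeft n k m B σ = permRep (Fin k ⊕ Fin m) n B (Equiv.Perm.sumCongr σ 1) := rfl

theorem permRepRight_apply (σ : Equiv.Perm (Fin m)) :
    permRepRight n k m B σ = permRep (Fin k ⊕ Fin m) n B (Equiv.Perm.sumCongr 1 σ) := rfl

theorem permRepLeft_swap (a b : Fin k) : permRepLeft n k m B (Equiv.swap a b) =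
    permRep (Fin k ⊕ Fin m) n B (Equiv.swap (Sum.inl a) (Sum.inl b)) := by
  rw [permRepLeft_apply, Equiv.Perm.sumCongr_swap_one]

theorem permRepRight_swap (a b : Fin m) : permRepRight n k m B (Equiv.swap a b) =
    permRep (Fin k ⊕ Fin m) n B (Equiv.swap (Sum.inr a) (Sum.inr b)) := by
  rw [permRepRight_apply, Equiv.Perm.sumCongr_one_swap]

/-- Splitting of the basis of `(ℂⁿ)^{⊗ (k + m)}`. -/
def splitLeft (n k m : ℕ) : (Fin k ⊕ Fin m → Fin n) ≃ (Fin k → Fin n) × (Fin m → Fin n) :=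
  Equiv.sumArrowEquivProdArrow _ _ _

/-- Splitting of the basis of `(ℂⁿ)^{⊗ (k + m)}`, with the second component first. -/
def splitRight (n k m : ℕ) : (Fin k ⊕ Fin m → Fin n) ≃ (Fin m → Fin n) × (Fin k → Fin n) :=
  (splitLeft n k m).trans (Equiv.prodComm _ _)

theorem embed_splitLeft_apply (W : Matrix (Fin k → Fin n) (Fin k → Fin n) B)
    (I J : Fin k ⊕ Fin m → Fin n) : embed (splitLeft n k m) W I J =
      if I ∘ Sum.inr = J ∘ Sum.inr then W (I ∘ Sum.inl) (J ∘ Sum.inl) else 0 := rfl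

theorem embed_splitRight_apply (W : Matrix (Fin m → Fin n) (Fin m → Fin n) B)
    (I J : Fin k ⊕ Fin m → Fin n) : embed (splitRight n k m) W I J =
      if I ∘ Sum.inl = J ∘ Sum.inl then W (I ∘ Sum.inr) (J ∘ Sum.inr) else 0 := rfl

theorem embed_splitLeft_permRep (σ : Equiv.Perm (Fin k)) :
    embed (splitLeft n k m) (permRep (Fin k) n B σ) = permRepLeft n k m B σ := by
  ext I J
  rw [embed_splitLeft_apply, permRepLeft_apply, permRep_apply, permRep_apply, ← ite_and]
  refine if_congr ?_ rfl rfl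
  simp only [funext_iff, Sum.forall, Function.comp_apply, Equiv.Perm.sumCongr_apply, Sum.map_inl,
    Sum.map_inr, Equiv.Perm.one_apply]
  exact and_comm

theorem embed_splitRight_permRep (σ : Equiv.Perm (Fin m)) :
    embed (splitRight n k m) (permRep (Fin m) n B σ) = permRepRight n k m B σ := by
  ext I J
  rw [embed_splitRight_apply, permRepRight_apply, permRep_apply, permRep_apply, ← ite_and]
  refine if_congr ?_ rfl rfl
  simp only [funext_iff, Sum.forall, Function.comp_apply, Equiv.Perm.sumCongr_apply, Sum.map_inl,
    Sum.map_inr, Equiv.Perm.one_apply]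

theorem embed_antisymm [Algebra Scalars B] {I₁ I₂ Idx : Type} [Fintype I₁] [Fintype I₂]
    [Fintype Idx] [DecidableEq I₁] [DecidableEq I₂] [DecidableEq Idx] (e : Idx ≃ I₁ × I₂)
    (ρ : Equiv.Perm (Fin k) →* Matrix I₁ I₁ B) (ρ' : Equiv.Perm (Fin k) →* Matrix Idx Idx B)
    (h : ∀ σ, embed e (ρ σ) = ρ' σ) : embed e (antisymm ρ) = antisymm ρ' := by
  simp only [antisymm, embed_smul, map_sum, map_zsmul, h]

theorem embed_splitLeft_legOf (a : Fin k) (M : Matrix (Fin n) (Fin n) B) :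
    embed (splitLeft n k m) (legOf a M) = legOf (Sum.inl a) M := by
  ext I J
  have h : (I ∘ Sum.inr = J ∘ Sum.inr ∧ ∀ b, b ≠ a → (I ∘ Sum.inl) b = (J ∘ Sum.inl) b) ↔
      ∀ b : Fin k ⊕ Fin m, b ≠ Sum.inl a → I b = J b := by
    simp only [funext_iff, Sum.forall, Function.comp_apply, ne_eq, Sum.inl.injEq, reduceCtorEq,
      not_false_eq_true, forall_const]
    exact and_comm
  rw [embed_splitLeft_apply, legOf_apply, legOf_apply]
  split_ifs with h1 h2 h3 h3 h3
  · rfl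
  · exact absurd (h.1 ⟨h1, h2⟩) h3
  · exact absurd (h.2 h3).2 h2
  · rfl
  · exact absurd (h.2 h3).1 h1
  · rfl

theorem embed_splitRight_legOf (a : Fin m) (M : Matrix (Fin n) (Fin n) B) :
    embed (splitRight n k m) (legOf a M) = legOf (Sum.inr a) M := by
  ext I J
  have h : (I ∘ Sum.inl = J ∘ Sum.inl ∧ ∀ b, b ≠ a → (I ∘ Sum.inr) b = (J ∘ Sum.inr) b) ↔
      ∀ b : Fin k ⊕ Fin m, b ≠ Sum.inr a → I b = J b := by
    simp only [funext_iff, Sum.forall, Function.comp_apply, ne_eq, Sum.inr.injEq, reduceCtorEq,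
      not_false_eq_true, forall_const]
  rw [embed_splitRight_apply, legOf_apply, legOf_apply]
  split_ifs with h1 h2 h3 h3 h3
  · rfl
  · exact absurd (h.1 ⟨h1, h2⟩) h3
  · exact absurd (h.2 h3).2 h2
  · rfl
  · exact absurd (h.2 h3).1 h1
  · rfl

section Cyclic

variable {Idx : Type} [Fintype Idx]

/-- Matrices that can be moved cyclically under the trace. -/
def TraceCyclic (V : Matrix Idx Idx B) : Prop :=
  ∀ W, Matrix.trace (V * W) = Matrix.trace (W * V)

theorem TraceCyclic.mul {U V : Matrix Idx Idx B} (hU : TraceCyclic U) (hV : TraceCyclic V) :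
    TraceCyclic (U * V) := fun W => by
  rw [mul_assoc, hU, mul_assoc, hV, mul_assoc]

theorem TraceCyclic.list_prod [DecidableEq Idx] {l : List (Matrix Idx Idx B)}
    (h : ∀ V ∈ l, TraceCyclic V) : TraceCyclic l.prod := by
  induction l with
  | nil => intro W; simp
  | cons a l ih =>
    rw [List.prod_cons]
    exact (h a (by simp)).mul (ih fun V hV => h V (by simp [hV]))

theorem TraceCyclic.antisymm [Algebra Scalars B] [DecidableEq Idx]
    {ρ : Equiv.Perm (Fin k) →* Matrix Idx Idx B}
    (h : ∀ σ, TraceCyclic (ρ σ)) : TraceCyclic (antisymm ρ) := fun W => by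
  simp only [YangianDouble.antisymm, smul_mul_assoc, mul_smul_comm, Finset.sum_mul,
    Finset.mul_sum, Matrix.trace_smul, Matrix.trace_sum, h _ W]

theorem TraceCyclic.linear [DecidableEq Idx] {K : Type} [CommRing K] [Algebra K B] (c d : K)
    {V : Matrix Idx Idx B} (h : TraceCyclic V) :
    TraceCyclic (c • (1 : Matrix Idx Idx B) + d • V) := fun W => by
  simp only [add_mul, mul_add, smul_mul_assoc, mul_smul_comm, Matrix.trace_add,
    Matrix.trace_smul, h W, one_mul, mul_one]

end Cyclic

theorem list_prod_smul_eq_zero {K M ι : Type} [CommRing K] [AddCommGroup M] [Module K M]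
    {r : ι → K} {l : List ι} (h : ∀ i, ∀ z : M, r i • z = 0 → z = 0) (z : M)
    (hz : (l.map r).prod • z = 0) : z = 0 := by
  induction l with
  | nil => simpa using hz
  | cons a l ih =>
    rw [List.map_cons, List.prod_cons, mul_smul] at hz
    exact ih (h a _ hz)

/-- The operator `c + d P_{ab}`. -/
def linearR {Λ : Type} [Fintype Λ] [DecidableEq Λ] (n : ℕ) (B : Type) [Ring B] {K : Type}
    [CommRing K] [Algebra K B] (c d : K) (a b : Λ) : Matrix (Λ → Fin n) (Λ → Fin n) B :=
  c • (1 : Matrix (Λ → Fin n) (Λ → Fin n) B) + d • permRep Λ n B (Equiv.swap a b)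

section LinearR

variable {Λ : Type} [Fintype Λ] [DecidableEq Λ] {K : Type} [CommRing K] [Algebra K B]

theorem linearR_traceCyclic (c d : K) (a b : Λ) : TraceCyclic (linearR n B c d a b) :=
  TraceCyclic.linear _ _ fun W => trace_permRep_mul _ W

/-- Unitarity, from `P² = 1`; it avoids inverting a spectral difference. -/
theorem linearR_mul_linearR (c d : K) (a b : Λ) :
    linearR n B c d a b * linearR n B c (-d) a b =
      algebraMap K (Matrix (Λ → Fin n) (Λ → Fin n) B) (c ^ 2 - d ^ 2) := by
  have h : permRep Λ n B (Equiv.swap a b) * permRep Λ n B (Equiv.swap a b) = 1 := by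
    rw [← map_mul, Equiv.swap_mul_self, map_one]
  rw [Algebra.algebraMap_eq_smul_one, linearR, linearR]
  simp only [add_mul, mul_add, smul_mul_assoc, mul_smul_comm, smul_smul, one_mul, mul_one, h,
    smul_add]
  module

theorem linearR_commute {W : Matrix (Λ → Fin n) (Λ → Fin n) B} (c d : K) {a b : Λ}
    (h : Commute (permRep Λ n B (Equiv.swap a b)) W) : Commute (linearR n B c d a b) W :=
  ((Commute.one_left W).smul_left c).add_left (h.smul_left d)

theorem swap_commute_of_ne {a b c d : Λ} (h1 : a ≠ c) (h2 : a ≠ d) (h3 : b ≠ c) (h4 : b ≠ d) :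
    Commute (permRep Λ n B (Equiv.swap a b)) (permRep Λ n B (Equiv.swap c d)) := by
  rw [Commute, SemiconjBy, ← map_mul, ← map_mul, Equiv.mul_swap_eq_swap_mul,
    Equiv.swap_apply_of_ne_of_ne h1.symm h3.symm, Equiv.swap_apply_of_ne_of_ne h2.symm h4.symm]

theorem linearR_commute_linearR (c d c' d' : K) {a b a' b' : Λ} (h1 : a ≠ a') (h2 : a ≠ b')
    (h3 : b ≠ a') (h4 : b ≠ b') :
    Commute (linearR n B c d a b) (linearR n B c' d' a' b') :=
  linearR_commute _ _ (linearR_commute _ _ (swap_commute_of_ne h1 h2 h3 h4).symm).symm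

/-- The instance of `yangBaxter_fusion` for `P_{aa'}`, `P_{ab}`, `P_{a'b}` with equal coefficients
`d`. The spectral parameters must increase by `d` from the first factor to the second. -/
theorem linearR_fusion {a a' b : Λ} (haa : a ≠ a') (ha : a ≠ b) (ha' : a' ≠ b) {c₁ c₂ d : K}
    (hc : d * (c₁ - c₂ + d) = 0) :
    (1 - permRep Λ n B (Equiv.swap a a')) *
      (linearR n B c₁ d a b * linearR n B c₂ d a' b) *
        (1 + permRep Λ n B (Equiv.swap a a')) = 0 := by
  refine yangBaxter_fusion ?_ ?_ ?_ (by linear_combination hc)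
  · rw [← map_mul, Equiv.swap_mul_self, map_one]
  · rw [← map_mul, ← map_mul, Equiv.mul_swap_eq_swap_mul, Equiv.swap_apply_left,
      Equiv.swap_apply_of_ne_of_ne ha.symm ha'.symm]
  · rw [← map_mul, ← map_mul, Equiv.mul_swap_eq_swap_mul, Equiv.swap_apply_right,
      Equiv.swap_apply_of_ne_of_ne haa.symm ha', Equiv.swap_comm a' a]

theorem linearR_comm (c d : K) (a b : Λ) : linearR n B c d a b = linearR n B c d b a := by
  rw [linearR, linearR, Equiv.swap_comm]

theorem linearR_legOf {a b : Λ} (hab : a ≠ b) (c d : K) (M N : Matrix (Fin n) (Fin n) B)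
    (h : ∀ i j p q, c • (M i j * N p q) + d • (M p j * N i q) =
      c • (N p q * M i j) + d • (N p j * M i q)) :
    linearR n B c d a b * (legOf a M * legOf b N) =
      legOf b N * legOf a M * linearR n B c d a b := by
  ext I J
  have hc : ∀ K : Λ → Fin n, ∀ c, c ≠ a → c ≠ b → K (Equiv.swap a b c) = K c :=
    fun K c h1 h2 => by rw [Equiv.swap_apply_of_ne_of_ne h1 h2]
  have e1 : (∀ c, c ≠ a → c ≠ b → I (Equiv.swap a b c) = J c) ↔
      ∀ c, c ≠ a → c ≠ b → I c = J c :=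
    forall_congr' fun c => forall₂_congr fun h1 h2 => by rw [hc I _ h1 h2]
  have e2 : (∀ c, c ≠ b → c ≠ a → I c = J (Equiv.swap a b c)) ↔
      ∀ c, c ≠ a → c ≠ b → I c = J c :=
    forall_congr' fun c => ⟨fun h h1 h2 => by rw [← hc J _ h1 h2, h h2 h1],
      fun h h1 h2 => by rw [hc J _ h2 h1, h h2 h1]⟩
  have e3 : (∀ c, c ≠ b → c ≠ a → I c = J c) ↔ ∀ c, c ≠ a → c ≠ b → I c = J c :=
    forall_congr' fun c => ⟨fun h h1 h2 => h h2 h1, fun h h1 h2 => h h2 h1⟩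
  simp only [linearR, add_mul, mul_add, smul_mul_assoc, mul_smul_comm, one_mul, mul_one,
    Matrix.add_apply, Matrix.smul_apply, permRep_mul_apply, mul_permRep_apply, Equiv.symm_swap,
    legOf_mul_legOf_apply hab, legOf_mul_legOf_apply hab.symm, Function.comp_apply, e1, e2, e3,
    Equiv.swap_apply_left, Equiv.swap_apply_right]
  split_ifs
  · exact h _ _ _ _
  · simp

end LinearR

variable {K : Type} [CommRing K] [Algebra K B]

/-- If the matrices `L_a`, `L'_b` satisfy RLL relations, then the traces of the fused products
commute. -/
theorem trace_mul_trace_comm [Algebra Scalars B] (L : Fin k → Matrix (Fin n) (Fin n) B)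
    (L' : Fin m → Matrix (Fin n) (Fin n) B) (u : Fin k → K) (v : Fin m → K) (h : K)
    (hu : ∀ a b : Fin k, (b : ℕ) = a + 1 → u b = u a + h)
    (hv : ∀ a b : Fin m, (b : ℕ) = a + 1 → v b = v a + h)
    (hLf : ∀ a b : Fin k, (b : ℕ) = a + 1 → Fusible (L a) (L b))
    (hLf' : ∀ a b : Fin m, (b : ℕ) = a + 1 → Fusible (L' a) (L' b))
    (hR : ∀ a b i j p q, (u a - v b) • (L a i j * L' b p q) + h • (L a p j * L' b i q) =
      (u a - v b) • (L' b p q * L a i j) + h • (L' b p j * L a i q))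
    (hreg : ∀ a b, ∀ z : B, ((u a - v b) ^ 2 - h ^ 2) • z = 0 → z = 0) :
    Commute
      (Matrix.trace (antisymmMatrix n k B * ((List.finRange k).map fun a => legOf a (L a)).prod))
      (Matrix.trace
        (antisymmMatrix n m B * ((List.finRange m).map fun b => legOf b (L' b)).prod)) := by
  have hne : ∀ {k : ℕ} (a b : Fin k), (b : ℕ) = a + 1 → a ≠ b := fun a b hab h => by
    rw [h] at hab; omega
  let R : K → Fin k → Fin m → Matrix (Fin k ⊕ Fin m → Fin n) (Fin k ⊕ Fin m → Fin n) B :=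
    fun d a b => linearR n B (u a - v b) d (Sum.inl a) (Sum.inr b)
  let A₁ := antisymm (permRepLeft n k m B)
  let A₂ := antisymm (permRepRight n k m B)
  let W₁ := ((List.finRange k).map fun a =>
    legOf (Λ := Fin k ⊕ Fin m) (n := n) (B := B) (Sum.inl a) (L a)).prod
  let W₂ := ((List.finRange m).map fun b =>
    legOf (Λ := Fin k ⊕ Fin m) (n := n) (B := B) (Sum.inr b) (L' b)).prod
  let RR := ((List.finRange m).reverse.map fun b =>
    ((List.finRange k).map fun a => R h a b).prod).prod
  let SS := ((List.finRange m).map fun b =>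
    ((List.finRange k).reverse.map fun a => R (-h) a b).prod).prod
  let p : K := ((List.finRange m).map fun b => ((List.finRange k).map fun a =>
    (u a - v b) ^ 2 - h ^ 2).prod).prod
  have e₁ : embed (splitLeft n k m) (antisymmMatrix n k B *
      ((List.finRange k).map fun a => legOf a (L a)).prod) = A₁ * W₁ := by
    rw [map_mul, antisymmMatrix, embed_antisymm _ _ _ embed_splitLeft_permRep, map_list_prod,
      List.map_map]
    congr 3
    ext1 a
    exact embed_splitLeft_legOf _ _
  have e₂ : embed (splitRight n k m) (antisymmMatrix n m B *
      ((List.finRange m).map fun b => legOf b (L' b)).prod) = A₂ * W₂ := by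
    rw [map_mul, antisymmMatrix, embed_antisymm _ _ _ embed_splitRight_permRep, map_list_prod,
      List.map_map]
    congr 3
    ext1 a
    exact embed_splitRight_legOf _ _
  have hA₁ : A₁ * A₁ = A₁ := antisymm_mul_self _
  have hA₂ : A₂ * A₂ = A₂ := antisymm_mul_self _
  have cA₁ : ∀ W, (∀ σ, Commute (permRepLeft n k m B σ) W) → Commute A₁ W := fun W hW =>
    (Commute.sum_left _ _ _ fun σ _ => (hW σ).smul_left _).smul_left _
  have cA₂ : ∀ W, (∀ σ, Commute (permRepRight n k m B σ) W) → Commute A₂ W := fun W hW =>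
    (Commute.sum_left _ _ _ fun σ _ => (hW σ).smul_left _).smul_left _
  have cA : Commute A₁ A₂ := by
    refine cA₁ _ fun σ => (cA₂ _ fun τ => ?_).symm
    rw [permRepLeft_apply, permRepRight_apply, Commute, SemiconjBy, ← map_mul, ← map_mul,
      Equiv.Perm.sumCongr_mul, Equiv.Perm.sumCongr_mul]
    simp
  have cA₁W₂ : Commute A₁ W₂ := by
    refine cA₁ _ fun σ => Commute.list_prod_right _ _ fun x hx => ?_
    obtain ⟨b, -, rfl⟩ := List.mem_map.1 hx
    rw [permRepLeft_apply, Commute, SemiconjBy, permRep_mul_legOf]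
    simp
  have cA₂W₁ : Commute A₂ W₁ := by
    refine cA₂ _ fun σ => Commute.list_prod_right _ _ fun x hx => ?_
    obtain ⟨b, -, rfl⟩ := List.mem_map.1 hx
    rw [permRepRight_apply, Commute, SemiconjBy, permRep_mul_legOf]
    simp
  have aW₁ : Absorbs A₁ W₁ := by
    refine absorbs_prod (fun a b c ha hb => ?_) fun a b hab => ?_
    · rw [permRepLeft_swap]
      exact permRep_swap_commute (by simpa using ha) (by simpa using hb) _
    · rw [permRepLeft_swap]
      exact (hLf a b hab).legOf_mul (by simpa using hne a b hab)
  have aW₂ : Absorbs A₂ W₂ := by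
    refine absorbs_prod (fun a b c ha hb => ?_) fun a b hab => ?_
    · rw [permRepRight_swap]
      exact permRep_swap_commute (by simpa using ha) (by simpa using hb) _
    · rw [permRepRight_swap]
      exact (hLf' a b hab).legOf_mul (by simpa using hne a b hab)
  -- Each antisymmetrizer absorbs its own product by fusion and the other one because it commutes
  -- with it.
  have aW : Absorbs (A₁ * A₂) (W₁ * W₂) :=
    absorbs_mul cA (aW₁.mul (absorbs_of_commute hA₁ cA₁W₂))
      ((absorbs_of_commute hA₂ cA₂W₁).mul aW₂)
  have hRc : ∀ d a a' b b', a ≠ a' → b ≠ b' → Commute (R d a b) (R d a' b') :=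
    fun d a a' b b' h1 h2 => linearR_commute_linearR _ _ _ _ (by simpa using h1) (by simp)
      (by simp) (by simpa using h2)
  have hRR : RR = ((List.finRange k).map fun a =>
      ((List.finRange m).reverse.map fun b => R h a b).prod).prod :=
    list_prod_comm _ _ (List.nodup_finRange k)
      (List.nodup_reverse.2 (List.nodup_finRange m)) (hRc h)
  have hSS : SS = ((List.finRange k).reverse.map fun a =>
      ((List.finRange m).map fun b => R (-h) a b).prod).prod :=
    list_prod_comm _ _ (List.nodup_reverse.2 (List.nodup_finRange k))
      (List.nodup_finRange m) (hRc (-h))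
  have aRR : Absorbs (A₁ * A₂) RR := by
    refine absorbs_mul cA (Absorbs.list_prod hA₁ fun W hW => ?_) ?_
    · obtain ⟨b, -, rfl⟩ := List.mem_map.1 hW
      refine absorbs_prod (fun a a' c ha hb => ?_) fun a a' hab => ?_
      · rw [permRepLeft_swap]
        exact (linearR_commute _ _ (swap_commute_of_ne (by simpa using ha) (by simpa using hb)
          (by simp) (by simp))).symm
      · rw [permRepLeft_swap]
        exact linearR_fusion (by simpa using hne a a' hab) (by simp) (by simp)
          (by rw [hu a a' hab]; ring)
    · rw [hRR]
      refine Absorbs.list_prod hA₂ fun W hW => ?_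
      obtain ⟨a, -, rfl⟩ := List.mem_map.1 hW
      -- The parameters `v_b` enter with a minus sign, so `u_a - v_b` increases by `h` when `b` runs
      -- downwards.
      refine absorbs_prod_reverse (fun b b' c ha hb => ?_) fun b b' hab => ?_
      · rw [permRepRight_swap]
        exact (linearR_commute _ _ (swap_commute_of_ne (by simp) (by simp)
          (by simpa using ha) (by simpa using hb))).symm
      · simp only [R]
        rw [permRepRight_swap, linearR_comm _ _ _ (Sum.inr b'), linearR_comm _ _ _ (Sum.inr b),
          Equiv.swap_comm]
        exact linearR_fusion (by simpa using (hne b b' hab).symm) (by simp) (by simp)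
          (by rw [hv b b' hab]; ring)
  have aSS : Absorbs (A₁ * A₂) SS := by
    refine absorbs_mul cA (Absorbs.list_prod hA₁ fun W hW => ?_) ?_
    · obtain ⟨b, -, rfl⟩ := List.mem_map.1 hW
      -- For the factors with `-h` the fusion condition changes sign, so both orders are opposite to
      -- those in `RR`.
      refine absorbs_prod_reverse (fun a a' c ha hb => ?_) fun a a' hab => ?_
      · rw [permRepLeft_swap]
        exact (linearR_commute _ _ (swap_commute_of_ne (by simpa using ha) (by simpa using hb)
          (by simp) (by simp))).symm
      · rw [permRepLeft_swap, Equiv.swap_comm]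
        exact linearR_fusion (by simpa using (hne a a' hab).symm) (by simp) (by simp)
          (by rw [hu a a' hab]; ring)
    · rw [hSS]
      refine Absorbs.list_prod hA₂ fun W hW => ?_
      obtain ⟨a, -, rfl⟩ := List.mem_map.1 hW
      refine absorbs_prod (fun b b' c ha hb => ?_) fun b b' hab => ?_
      · rw [permRepRight_swap]
        exact (linearR_commute _ _ (swap_commute_of_ne (by simp) (by simp)
          (by simpa using ha) (by simpa using hb))).symm
      · simp only [R]
        rw [permRepRight_swap, linearR_comm _ _ _ (Sum.inr b'), linearR_comm _ _ _ (Sum.inr b)]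
        exact linearR_fusion (by simpa using hne b b' hab) (by simp) (by simp)
          (by rw [hv b b' hab]; ring)
  have hRS' : ∀ a b, R h a b * R (-h) a b = algebraMap K _ ((u a - v b) ^ 2 - h ^ 2) :=
    fun a b => linearR_mul_linearR _ _ _ _
  have hSR' : ∀ a b, R (-h) a b * R h a b = algebraMap K _ ((u a - v b) ^ 2 - h ^ 2) := by
    intro a b
    have := linearR_mul_linearR (n := n) (B := B) (u a - v b) (-h) (Sum.inl a : Fin k ⊕ Fin m)
      (Sum.inr b)
    rwa [neg_neg, neg_sq] at this
  have hRS : RR * SS = algebraMap K _ p := by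
    refine list_prod_reverse_mul _ fun b => ?_
    have := list_prod_reverse_mul (List.finRange k).reverse fun a => hRS' a b
    rw [List.reverse_reverse] at this
    rw [this, List.map_reverse, List.prod_reverse]
  have hSR : SS * RR = algebraMap K _ p := by
    have := list_prod_reverse_mul
      (f := fun b => ((List.finRange k).reverse.map fun a => R (-h) a b).prod)
      (g := fun b => ((List.finRange k).map fun a => R h a b).prod)
      (List.finRange m).reverse fun b => list_prod_reverse_mul _ fun a => hSR' a b
    rw [List.reverse_reverse, List.map_reverse (l := List.finRange m) (f := fun b =>
      ((List.finRange k).map fun a => (u a - v b) ^ 2 - h ^ 2).prod), List.prod_reverse] at this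
    exact this
  have htrain : RR * (W₁ * W₂) = W₂ * W₁ * RR := by
    refine train _ _ (List.nodup_finRange k) (List.nodup_finRange m) (fun a b => ?_)
      (fun a a' b h1 => ?_) fun a b b' h1 => ?_
    · exact linearR_legOf (by simp) _ _ _ _ (hR a b)
    · exact linearR_commute _ _ (permRep_swap_commute (by simpa using h1.symm) (by simp) _)
    · exact linearR_commute _ _ (permRep_swap_commute (by simp) (by simpa using h1.symm) _)
  have tA : TraceCyclic (A₁ * A₂) :=
    (TraceCyclic.antisymm (ρ := permRepLeft n k m B) fun σ W => trace_permRep_mul _ W).mul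
      (TraceCyclic.antisymm (ρ := permRepRight n k m B) fun σ W => trace_permRep_mul _ W)
  have tSS : TraceCyclic SS := by
    refine TraceCyclic.list_prod fun V hV => ?_
    obtain ⟨b, -, rfl⟩ := List.mem_map.1 hV
    refine TraceCyclic.list_prod fun V hV => ?_
    obtain ⟨a, -, rfl⟩ := List.mem_map.1 hV
    exact linearR_traceCyclic _ _ _ _
  -- One trace is evaluated twice. `h1` carries `RR` through by `htrain` and cancels it against `SS`
  -- on the right. `h2` brings `SS` round to the left, where copies of `A₁ * A₂` inserted by
  -- absorption let it meet `RR`.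
  have key : p • (Matrix.trace (A₁ * A₂ * (W₁ * W₂)) - Matrix.trace (A₁ * A₂ * (W₂ * W₁))) = 0 := by
    have h1 : Matrix.trace (A₁ * A₂ * (RR * (W₁ * W₂)) * SS) =
        p • Matrix.trace (A₁ * A₂ * (W₂ * W₁)) := by
      rw [htrain, mul_assoc, mul_assoc (W₂ * W₁), hRS, ← Algebra.commutes, ← Algebra.smul_def,
        mul_smul_comm, Matrix.trace_smul]
    have h2 : Matrix.trace (A₁ * A₂ * (RR * (W₁ * W₂)) * SS) =
        p • Matrix.trace (A₁ * A₂ * (W₁ * W₂)) := by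
      unfold Absorbs at aRR aSS aW
      rw [← tSS]
      generalize A₁ * A₂ = A at *
      generalize W₁ * W₂ = W at *
      calc Matrix.trace (SS * (A * (RR * W))) = Matrix.trace (SS * (A * RR * A) * W) := by
            rw [aRR]; simp only [mul_assoc]
        _ = Matrix.trace (SS * (A * RR) * (A * W * A)) := by
            rw [aW]; simp only [mul_assoc]
        _ = Matrix.trace (SS * (A * RR) * (A * W) * A) := by simp only [mul_assoc]
        _ = Matrix.trace (A * SS * A * (RR * (A * W))) := by
            rw [← tA]; simp only [mul_assoc]
        _ = Matrix.trace (A * (SS * RR) * (A * W)) := by rw [aSS]; simp only [mul_assoc]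
        _ = p • Matrix.trace (A * A * W) := by
            rw [hSR, ← Algebra.commutes, ← Algebra.smul_def, smul_mul_assoc, Matrix.trace_smul,
              mul_assoc]
        _ = _ := by
            rw [mul_assoc, tA, aW]
    rw [smul_sub, ← h1, ← h2, sub_self]
  have key := sub_eq_zero.1 (list_prod_smul_eq_zero (fun b z hz =>
    list_prod_smul_eq_zero (fun a z hz => hreg a b z hz) z hz) _ key)
  rw [Commute, SemiconjBy, ← trace_embed_mul_embed (splitLeft n k m) (splitRight n k m)
    (fun _ => rfl), ← trace_embed_mul_embed (splitRight n k m) (splitLeft n k m)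
    (fun _ => rfl), e₁, e₂]
  have e3 : A₁ * W₁ * (A₂ * W₂) = A₁ * A₂ * (W₁ * W₂) := by
    rw [mul_assoc, ← mul_assoc W₁, ← cA₂W₁.eq]; simp only [mul_assoc]
  have e4 : A₂ * W₂ * (A₁ * W₁) = A₁ * A₂ * (W₂ * W₁) := by
    rw [mul_assoc, ← mul_assoc W₂, ← cA₁W₂.eq, cA.eq]; simp only [mul_assoc]
  rw [e3, e4, key]

end CommutingTraces

/-! ### Shifts in the completion -/

section Completion

variable {D : Type} [Ring D] [Algebra Scalars D]

/-- Reduction of the completion modulo `h^N`. -/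
noncomputable def reduction (D : Type) [Ring D] [Algebra Scalars D] (N : ℕ) :
    hCompletion D →ₐ[Scalars] D ⧸ hIdeal D N :=
  (Pi.evalAlgHom Scalars (fun N => D ⧸ hIdeal D N) N).comp (hCompletion D).val

theorem reduction_apply (N : ℕ) (x : hCompletion D) : reduction D N x = x.1 N := rfl

theorem reduction_ext {x y : hCompletion D} (h : ∀ N, reduction D N x = reduction D N y) :
    x = y := Subtype.ext (funext h)

theorem hbar_pow_smul_quotient {N M : ℕ} (h : N ≤ M) (q : D ⧸ hIdeal D N) :
    hbar ^ M • q = 0 := by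
  obtain ⟨d, rfl⟩ := Ideal.Quotient.mk_surjective q
  obtain ⟨k, rfl⟩ := Nat.exists_eq_add_of_le h
  exact Ideal.Quotient.eq_zero_iff_mem.2 ⟨hbar ^ k • d, by
    rw [← mul_smul, ← pow_add]⟩

/-- To control `x` modulo `h^N`, take a representative `d` modulo `h^{N+1}`: then `h d = h^{N+1} y`,
and torsion-freeness of `D` gives `d = h^N y`. -/
theorem hbar_smul_eq_zero_completion (hD : ∀ d : D, hbar • d = 0 → d = 0) {x : hCompletion D}
    (h : hbar • x = 0) : x = 0 := by
  refine reduction_ext fun N => ?_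
  obtain ⟨d, hd⟩ := x.2 (N + 1)
  have h1 : hbar • x.1 (N + 1) = 0 := congrFun (congrArg Subtype.val h) (N + 1)
  rw [hd _ le_rfl] at h1
  obtain ⟨y, hy⟩ := Ideal.Quotient.eq_zero_iff_mem.1
    (show Ideal.Quotient.mk (hIdeal D (N + 1)) (hbar • d) = 0 from h1)
  have h2 : d = hbar ^ N • y := by
    rw [← sub_eq_zero]
    refine hD _ ?_
    rw [smul_sub, hy, smul_smul, pow_succ', sub_self]
  rw [reduction_apply, hd N (Nat.le_succ N), map_zero]
  exact Ideal.Quotient.eq_zero_iff_mem.2 ⟨y, h2⟩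

/-- The coefficient of `u^p` in `(u + a h)^i`. -/
noncomputable def shiftWeight (a i p : ℕ) : Scalars :=
  ((Polynomial.X + Polynomial.C ((a : Scalars) * hbar)) ^ i).coeff p

theorem shiftWeight_eq (a i p : ℕ) :
    shiftWeight a i p = ((a : Scalars) * hbar) ^ (i - p) * (i.choose p : Scalars) :=
  Polynomial.coeff_X_add_C_pow _ _ _

/-- Compares coefficients in `(u + ah)^{i+j} = (u + ah)^i (u + ah)^j`; this is the source of
multiplicativity of the shift. -/
theorem shiftWeight_add (a i j p : ℕ) : shiftWeight a (i + j) p =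
    ∑ x ∈ Finset.HasAntidiagonal.antidiagonal p, shiftWeight a i x.1 * shiftWeight a j x.2 := by
  rw [shiftWeight, pow_add, Polynomial.coeff_mul]
  rfl

theorem shiftWeight_smul_of_lt {a i p : ℕ} {M : Type} [AddCommGroup M] [Module Scalars M]
    (h : i < p) (q : M) : shiftWeight a i p • q = 0 := by
  rw [shiftWeight_eq, Nat.choose_eq_zero_of_lt h]
  simp

theorem shiftWeight_smul_of_le {a i p N : ℕ} (h : N + p ≤ i) (q : D ⧸ hIdeal D N) :
    shiftWeight a i p • q = 0 := by
  rw [shiftWeight_eq, mul_pow, mul_right_comm, mul_smul, hbar_pow_smul_quotient (by omega),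
    smul_zero]

/-- Modulo `h^N` the shift is a finite sum whose cutoff may be enlarged freely, because a weight
contains `h^{i-p}`. A common cutoff makes different coefficients comparable. -/
theorem reduction_coeff_hShift (a : ℕ) (g : PowerSeries (hCompletion D)) (p N : ℕ) {R : ℕ}
    (hR : N + p ≤ R) : reduction D N (coeff p (hShift a g)) =
      ∑ i ∈ Finset.range R, shiftWeight a i p • reduction D N (coeff i g) := by
  have h1 : ∑ i ∈ Finset.range R, shiftWeight a i p • reduction D N (coeff i g) =
      ∑ i ∈ Finset.Ico p (p + N), shiftWeight a i p • reduction D N (coeff i g) := by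
    refine (Finset.sum_subset (fun i hi => ?_) fun i _ hi => ?_).symm
    · rw [Finset.mem_Ico] at hi
      exact Finset.mem_range.2 (by omega)
    · rw [Finset.mem_Ico] at hi
      by_cases h : i < p
      · exact shiftWeight_smul_of_lt h _
      · exact shiftWeight_smul_of_le (by omega) _
  rw [h1, Finset.sum_Ico_eq_sum_range, Nat.add_sub_cancel_left, hShift, coeff_mk]
  rw [show ∀ y : ℕ → hCompletion D, reduction D N (hSum y) =
    ∑ m ∈ Finset.range N, hbar ^ m • reduction D N (y m) from fun _ => rfl]
  refine Finset.sum_congr rfl fun m _ => ?_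
  rw [map_nsmul, ← Nat.cast_smul_eq_nsmul Scalars, smul_smul, add_comm m p]
  refine congrArg (fun c : Scalars => c • reduction D N (coeff (p + m) g)) ?_
  rw [shiftWeight_eq, Nat.add_sub_cancel_left]
  push_cast
  ring

theorem hShift_mul (a : ℕ) (f g : PowerSeries (hCompletion D)) :
    hShift a (f * g) = hShift a f * hShift a g := by
  ext1 p
  refine reduction_ext fun N => ?_
  let T : ℕ × ℕ → D ⧸ hIdeal D N := fun x => shiftWeight a (x.1 + x.2) p •
    (reduction D N (coeff x.1 f) * reduction D N (coeff x.2 g))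
  have h1 : reduction D N (coeff p (hShift a (f * g))) =
      ∑ l ∈ Finset.range (N + p), ∑ x ∈ Finset.HasAntidiagonal.antidiagonal l, T x := by
    rw [reduction_coeff_hShift a _ p N le_rfl]
    refine Finset.sum_congr rfl fun l _ => ?_
    rw [coeff_mul, map_sum, Finset.smul_sum]
    refine Finset.sum_congr rfl fun x hx => ?_
    rw [map_mul, ← Finset.HasAntidiagonal.mem_antidiagonal.1 hx]
  have h2 : reduction D N (coeff p (hShift a f * hShift a g)) =
      ∑ x ∈ Finset.range (N + p) ×ˢ Finset.range (N + p), T x := by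
    have : ∀ x ∈ Finset.HasAntidiagonal.antidiagonal p,
        reduction D N (coeff x.1 (hShift a f) * coeff x.2 (hShift a g)) =
        ∑ y ∈ Finset.range (N + p) ×ˢ Finset.range (N + p),
          (shiftWeight a y.1 x.1 * shiftWeight a y.2 x.2) •
            (reduction D N (coeff y.1 f) * reduction D N (coeff y.2 g)) := by
      intro x hx
      have := Finset.HasAntidiagonal.mem_antidiagonal.1 hx
      rw [map_mul, reduction_coeff_hShift a f x.1 N (R := N + p) (by omega),
        reduction_coeff_hShift a g x.2 N (R := N + p) (by omega), Finset.sum_mul_sum,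
        Finset.sum_product]
      simp only [smul_mul_smul_comm]
    rw [coeff_mul, map_sum, Finset.sum_congr rfl this, Finset.sum_comm]
    simp only [T, shiftWeight_add, Finset.sum_smul]
  rw [h1, h2]
  have h3 : ∑ x ∈ Finset.range (N + p) ×ˢ Finset.range (N + p), T x =
      ∑ x ∈ (Finset.range (N + p) ×ˢ Finset.range (N + p)).filter fun x => x.1 + x.2 < N + p,
        T x := by
    refine (Finset.sum_subset (Finset.filter_subset _ _) fun x hx hx' => ?_).symm
    rw [Finset.mem_filter, not_and] at hx'
    exact shiftWeight_smul_of_le (not_lt.1 (hx' hx)) _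
  -- The terms of the square outside the triangle of total degree below `N + p` vanish modulo `h^N`.
  -- The triangle is then summed by degree, as in the coefficients of `f * g`.
  rw [h3, ← Finset.sum_fiberwise_of_maps_to (g := fun x : ℕ × ℕ => x.1 + x.2)
    (t := Finset.range (N + p)) fun x hx => Finset.mem_range.2 (Finset.mem_filter.1 hx).2]
  refine Finset.sum_congr rfl fun l hl => Finset.sum_congr ?_ fun _ _ => rfl
  ext x
  simp only [Finset.HasAntidiagonal.mem_antidiagonal, Finset.mem_filter, Finset.mem_product,
    Finset.mem_range] at *
  omega

theorem hShift_add (a : ℕ) (f g : PowerSeries (hCompletion D)) :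
    hShift a (f + g) = hShift a f + hShift a g := by
  ext1 p
  refine reduction_ext fun N => ?_
  rw [map_add, map_add]
  simp only [reduction_coeff_hShift a _ p N le_rfl, map_add, smul_add, Finset.sum_add_distrib]

theorem hShift_C (a : ℕ) (b : hCompletion D) : hShift a (C b) = C b := by
  ext1 p
  refine reduction_ext fun N => ?_
  -- The extra term keeps the index `0` in the range when `N = p = 0`.
  rw [reduction_coeff_hShift a _ p N (R := N + p + 1) (by omega), Finset.sum_eq_single 0]
  · rw [shiftWeight_eq, coeff_C, coeff_C]
    match p with
    | 0 => simp
    | p + 1 => simp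
  · intro i _ hi
    rw [coeff_C, if_neg hi, map_zero, smul_zero]
  · simp

theorem hShift_X (a : ℕ) : hShift a (X : PowerSeries (hCompletion D)) =
    X + C (((a : Scalars) * hbar) • (1 : hCompletion D)) := by
  ext1 p
  refine reduction_ext fun N => ?_
  rw [reduction_coeff_hShift a _ p N (R := N + p + 2) (by omega), Finset.sum_eq_single 1]
  · rw [shiftWeight_eq, coeff_X, if_pos rfl, map_add, coeff_X, coeff_C, map_add]
    match p with
    | 0 => simp
    | 1 => simp
    | p + 2 => simp [Nat.choose_eq_zero_of_lt (show 1 < p + 2 by omega)]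
  · intro i _ hi
    rw [coeff_X, if_neg hi, map_zero, smul_zero]
  · simp

/-- The shift `g(u) ↦ g(u + a h)` as a homomorphism of algebras. -/
noncomputable def shiftHom (D : Type) [Ring D] [Algebra Scalars D] (a : ℕ) :
    PowerSeries (hCompletion D) →ₐ[Scalars] PowerSeries (hCompletion D) where
  toFun := hShift a
  map_one' := by rw [← map_one C, hShift_C]
  map_mul' := hShift_mul a
  map_zero' := by rw [← map_zero C, hShift_C]
  map_add' := hShift_add a
  commutes' r := by
    rw [PowerSeries.algebraMap_apply, hShift_C]

theorem coeff_outer_mul_inner {B : Type} [Ring B] (f g : PowerSeries B) (p q : ℕ) :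
    coeff q (coeff p (outer f * inner g)) = coeff p f * coeff q g := by
  rw [outer, inner, coeff_mul_C, coeff_map, coeff_C_mul]

theorem coeff_inner_mul_outer {B : Type} [Ring B] (f g : PowerSeries B) (p q : ℕ) :
    coeff q (coeff p (inner g * outer f)) = coeff q g * coeff p f := by
  rw [outer, inner, coeff_C_mul, coeff_map, coeff_mul_C]

/-- An identity between sums of products `f(u) g(v)` and `g'(v) f'(u)` is one for every pair of
coefficients, and the shift takes the same combination of those pairs on both sides. -/
theorem hShift_bilinear {ι : Type} [Fintype ι] {f g f' g' : ι → PowerSeries (hCompletion D)}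
    (a b : ℕ) (h : ∑ x, outer (f x) * inner (g x) = ∑ x, inner (g' x) * outer (f' x)) :
    ∑ x, outer (hShift a (f x)) * inner (hShift b (g x)) =
      ∑ x, inner (hShift b (g' x)) * outer (hShift a (f' x)) := by
  have h' : ∀ i j, ∑ x, coeff i (f x) * coeff j (g x) = ∑ x, coeff j (g' x) * coeff i (f' x) := by
    intro i j
    have := congrArg (fun F => coeff j (coeff i F)) h
    simpa only [map_sum, coeff_outer_mul_inner, coeff_inner_mul_outer] using this
  ext1 p
  ext1 q
  refine reduction_ext fun N => ?_
  simp only [map_sum, coeff_outer_mul_inner, coeff_inner_mul_outer]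
  have e1 : ∀ x, reduction D N (coeff p (hShift a (f x)) * coeff q (hShift b (g x))) =
      ∑ i ∈ Finset.range (N + p), ∑ j ∈ Finset.range (N + q),
        (shiftWeight a i p * shiftWeight b j q) •
          reduction D N (coeff i (f x) * coeff j (g x)) := by
    intro x
    rw [map_mul, reduction_coeff_hShift a _ p N le_rfl, reduction_coeff_hShift b _ q N le_rfl,
      Finset.sum_mul_sum]
    simp only [smul_mul_smul_comm, map_mul]
  have e2 : ∀ x, reduction D N (coeff q (hShift b (g' x)) * coeff p (hShift a (f' x))) =
      ∑ i ∈ Finset.range (N + p), ∑ j ∈ Finset.range (N + q),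
        (shiftWeight a i p * shiftWeight b j q) •
          reduction D N (coeff j (g' x) * coeff i (f' x)) := by
    intro x
    rw [map_mul, reduction_coeff_hShift a _ p N le_rfl, reduction_coeff_hShift b _ q N le_rfl,
      Finset.sum_mul_sum, Finset.sum_comm]
    simp only [smul_mul_smul_comm, map_mul, mul_comm (shiftWeight b _ _)]
  simp only [e1, e2]
  rw [Finset.sum_comm, Finset.sum_comm (s := Finset.univ)]
  refine Finset.sum_congr rfl fun i _ => ?_
  rw [Finset.sum_comm, Finset.sum_comm (s := Finset.univ)]
  refine Finset.sum_congr rfl fun j _ => ?_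
  rw [← Finset.smul_sum, ← Finset.smul_sum, ← map_sum, ← map_sum, h']

/-- The specialisation `v = u`. It is legitimate for these power series because each coefficient
becomes a finite sum over an antidiagonal. -/
theorem diagonal_bilinear {B : Type} [Ring B] {ι : Type} [Fintype ι]
    {f g f' g' : ι → PowerSeries B}
    (h : ∑ x, outer (f x) * inner (g x) = ∑ x, inner (g' x) * outer (f' x)) :
    ∑ x, f x * g x = ∑ x, g' x * f' x := by
  have h' : ∀ i j, ∑ x, coeff i (f x) * coeff j (g x) = ∑ x, coeff j (g' x) * coeff i (f' x) := by
    intro i j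
    have := congrArg (fun F => coeff j (coeff i F)) h
    simpa only [map_sum, coeff_outer_mul_inner, coeff_inner_mul_outer] using this
  ext1 p
  simp only [map_sum, coeff_mul]
  rw [Finset.sum_comm, Finset.sum_comm (s := Finset.univ), ← Finset.Nat.sum_antidiagonal_swap]
  refine Finset.sum_congr rfl fun y _ => ?_
  simpa using h' y.2 y.1

/-- Successive outer coefficients give `y F₀ = 0` and `F_p = y F_{p+1}`, so all `F_p` vanish in
turn. -/
theorem eq_zero_of_outer_sub_inner_mul {B : Type} [Ring B] (F : PowerSeries (PowerSeries B))
    (h : (outer X - inner X) * F = 0) : F = 0 := by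
  have h1 : ∀ p, coeff p F = 0 := by
    have h0 : outer (X : PowerSeries B) = X := PowerSeries.map_X _
    have hX : ∀ f : PowerSeries B, X * f = 0 → f = 0 := fun f hf => by
      ext m
      have := congrArg (coeff (m + 1)) hf
      rwa [coeff_succ_X_mul] at this
    have hp := fun p => congrArg (coeff p) h
    simp only [sub_mul, h0, inner, map_sub, coeff_C_mul, map_zero] at hp
    intro p
    induction p with
    | zero =>
      have := hp 0
      rw [coeff_zero_X_mul, zero_sub, neg_eq_zero] at this
      exact hX _ this
    | succ p ih =>
      have := hp (p + 1)
      rw [coeff_succ_X_mul, ih, zero_sub, neg_eq_zero] at this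
      exact hX _ this
  ext1 p
  rw [h1, map_zero]

/-- A regular element plus a nilpotent multiple of `h` is regular: `r f = -ch f` implies `r^N f =
(-ch)^N f = 0`. -/
theorem eq_zero_of_add_smul {Q : Type} [Ring Q] [Algebra Scalars Q] {N : ℕ} {r : Q}
    (hr : ∀ f, r * f = 0 → f = 0) (hN : ∀ f : Q, hbar ^ N • f = 0) (c : Scalars) (f : Q)
    (h : r * f + (c * hbar) • f = 0) : f = 0 := by
  have h1 : ∀ M, r ^ M * f = (-(c * hbar)) ^ M • f := by
    intro M
    induction M with
    | zero => simp
    | succ M ih =>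
      rw [pow_succ', mul_assoc, ih, mul_smul_comm, eq_neg_of_add_eq_zero_left h, pow_succ,
        mul_smul _ (-(c * hbar)), neg_smul]
  have h2 : ∀ M, ∀ g, r ^ M * g = 0 → g = 0 := by
    intro M
    induction M with
    | zero => simp
    | succ M ih =>
      intro g hg
      rw [pow_succ, mul_assoc] at hg
      exact hr _ (ih _ hg)
  refine h2 N f ?_
  rw [h1, neg_pow, mul_pow, ← mul_assoc, mul_smul, hN, smul_zero]

/-- Checked modulo every `h^N`, where `h` is nilpotent. -/
theorem eq_zero_of_spectral_difference (c : Scalars)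
    (F : PowerSeries (PowerSeries (hCompletion D)))
    (h : (outer X - inner X) * F + (c * hbar) • F = 0) : F = 0 := by
  have key : ∀ N, PowerSeries.map (PowerSeries.map (reduction D N).toRingHom) F = 0 := by
    intro N
    have hs : ∀ (r : Scalars) (G : PowerSeries (PowerSeries (hCompletion D))),
        PowerSeries.map (PowerSeries.map (reduction D N).toRingHom) (r • G) =
          r • PowerSeries.map (PowerSeries.map (reduction D N).toRingHom) G := by
      intro r G
      ext p q
      exact map_smul (reduction D N) r _
    refine eq_zero_of_add_smul (N := N) (r := outer X - inner X)
      eq_zero_of_outer_sub_inner_mul (fun f => ?_) c _ ?_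
    · ext p q
      exact hbar_pow_smul_quotient le_rfl _
    · have := congrArg (PowerSeries.map (PowerSeries.map (reduction D N).toRingHom)) h
      rw [map_add, map_mul, hs, map_zero, map_sub] at this
      simpa [outer, inner] using this
  ext1 p
  ext1 q
  refine reduction_ext fun N => ?_
  have := congrArg (fun G => coeff q (coeff p G)) (key N)
  simpa using this

end Completion

/-! ### The R-matrix -/

section RMatrix

theorem invSub_hasSubst {K : Type} [CommRing K] (w : K) : HasSubst (invSub w) :=
  HasSubst.of_constantCoeff_zero' (by simp [invSub])

theorem isUnit_one_sub {K : Type} [CommRing K] (w : K) :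
    IsUnit (1 - X * C w : PowerSeries K) := by
  rw [PowerSeries.isUnit_iff_constantCoeff]
  simp

theorem coeff_invSub_pow_of_lt {K : Type} [CommRing K] (w : K) {d e : ℕ} (h : e < d) :
    coeff e (invSub w ^ d) = 0 := by
  rw [invSub, mul_pow, coeff_X_pow_mul', if_neg (by omega)]

/-- Over a commutative ring the shifted series is a genuine substitution `u ↦ u - w`, so identities
for `f` can be transported. -/
theorem fShift_eq_subst {K : Type} [CommRing K] [Algebra Scalars K] (n : ℕ) (w : K) :
    fShift n w = (PowerSeries.mk (fCoeff n)).subst (invSub w) := by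
  ext e
  rw [coeff_subst' (invSub_hasSubst w), fShift, coeff_mk,
    finsum_eq_sum_of_support_subset (s := Finset.range (e + 1))]
  · simp
  · intro d hd
    rw [Function.mem_support] at hd
    rw [Finset.coe_range, Set.mem_Iio]
    by_contra h
    exact hd (by rw [coeff_invSub_pow_of_lt _ (by omega), smul_zero])

theorem subst_C_scalars {K : Type} [CommRing K] [Algebra Scalars K] {b : PowerSeries K}
    (hb : HasSubst b) (c : Scalars) :
    (C c : PowerSeries Scalars).subst b = C (algebraMap Scalars K c) := by
  have h : (C c : PowerSeries Scalars) = algebraMap Scalars (PowerSeries Scalars) c := rfl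
  rw [h, ← coe_substAlgHom hb, AlgHom.commutes]
  exact MvPowerSeries.algebraMap_apply

/-- Both sides solve `(1 - X(w + c)) y = X`, whose leading factor is a unit; this is the composition
law for shifts. -/
theorem subst_invSub {K : Type} [CommRing K] [Algebra Scalars K] (c : Scalars) (w : K) :
    (invSub c).subst (invSub w) = invSub (w + algebraMap Scalars K c) := by
  have hs := invSub_hasSubst w
  have h1 := congrArg (subst (invSub w)) (one_sub_mul_invSub c)
  have h1' : (1 : PowerSeries Scalars).subst (invSub w) = 1 := by
    rw [← coe_substAlgHom hs, map_one]
  rw [subst_mul hs, subst_sub hs, subst_mul hs, subst_X hs, h1', subst_C_scalars hs] at h1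
  have h2 := one_sub_mul_invSub w
  have h3 := one_sub_mul_invSub (w + algebraMap Scalars K c)
  rw [map_add] at h3
  refine (isUnit_one_sub (w + algebraMap Scalars K c)).mul_left_cancel ?_
  rw [map_add]
  linear_combination (1 - X * C w) * h1 - h3 + (C (algebraMap Scalars K c) *
    (invSub c).subst (invSub w) + 1) * h2

/-- The functional equation of `f` with `u` replaced by `u - w`. -/
theorem fShift_add_comm {K : Type} [CommRing K] [Algebra Scalars K] {n : ℕ} (hn : n ≠ 0) (w : K) :
    fShift n (w + algebraMap Scalars K ((n : Scalars) * hbar)) =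
      (1 - hbar ^ 2 • invSub w ^ 2) * fShift n w := by
  have hs := invSub_hasSubst w
  rw [fShift_eq_subst, ← subst_invSub, ← subst_comp_subst_apply (invSub_hasSubst _) hs,
    ← fShift_eq_subst n ((n : Scalars) * hbar), fShift_functional_equation n hn,
    fShift_eq_subst n w, subst_mul hs, subst_sub hs, subst_mul hs, subst_pow hs, subst_X hs,
    subst_C_scalars hs, ← coe_substAlgHom hs, map_one, ← smul_eq_C_mul, algebraMap_smul]

theorem invSub_add_comm {K : Type} [CommRing K] (w c : K) :
    invSub (w + c) - invSub w = C c * (invSub w * invSub (w + c)) := by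
  have h2 := one_sub_mul_invSub w
  have h3 := one_sub_mul_invSub (w + c)
  rw [map_add] at h3
  refine (isUnit_one_sub w).mul_left_cancel ?_
  linear_combination h3 - h2 - C c * invSub (w + c) * h2

variable {S S' : Type} [Ring S] [Algebra Scalars S] [Ring S'] [Algebra Scalars S']

theorem map_smul_series (φ : S →ₐ[Scalars] S') (r : Scalars) (f : PowerSeries S) :
    PowerSeries.map φ.toRingHom (r • f) = r • PowerSeries.map φ.toRingHom f := by
  ext p
  exact map_smul φ r _

theorem map_invSub (φ : S →ₐ[Scalars] S') (w : S) :
    PowerSeries.map φ.toRingHom (invSub w) = invSub (φ w) := by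
  ext p
  cases p with
  | zero => simp [invSub]
  | succ p => simp [invSub, coeff_succ_X_mul]

theorem map_fShift (φ : S →ₐ[Scalars] S') (n : ℕ) (w : S) :
    PowerSeries.map φ.toRingHom (fShift n w) = fShift n (φ w) := by
  ext p
  rw [coeff_map, fShift, fShift, coeff_mk, coeff_mk, map_sum]
  refine Finset.sum_congr rfl fun k _ => ?_
  rw [← map_invSub, ← map_pow, coeff_map]
  exact map_smul φ _ _

/-- Only powers of the single element `w` occur, so identities can be proved over the commutative
ring `ℂ[[h]][X]` and evaluated at `w`. -/
theorem fShift_eq_map (n : ℕ) (w : S) : fShift n w =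
    PowerSeries.map (Polynomial.aeval w).toRingHom
      (fShift n (Polynomial.X : Polynomial Scalars)) := by
  rw [map_fShift, Polynomial.aeval_X]

theorem invSub_eq_map (w : S) : invSub w =
    PowerSeries.map (Polynomial.aeval (R := Scalars) w).toRingHom (invSub Polynomial.X) := by
  rw [map_invSub, Polynomial.aeval_X]

theorem isUnit_fShift (n : ℕ) (w : S) : IsUnit (fShift n w) := by
  rw [fShift_eq_map]
  refine IsUnit.map _ ?_
  rw [PowerSeries.isUnit_iff_constantCoeff, ← coeff_zero_eq_constantCoeff_apply, fShift, coeff_mk]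
  simp [fCoeff, fNum]

theorem isUnit_one_sub_sq (w : S) : IsUnit (1 - hbar ^ 2 • invSub w ^ 2) := by
  rw [invSub_eq_map, ← map_pow, ← map_smul_series,
    ← map_one (PowerSeries.map (Polynomial.aeval (R := Scalars) w).toRingHom), ← map_sub]
  refine IsUnit.map _ ?_
  rw [PowerSeries.isUnit_iff_constantCoeff, ← coeff_zero_eq_constantCoeff_apply]
  simp [invSub, coeff_zero_eq_constantCoeff_apply]

theorem fShift_add {n : ℕ} (hn : n ≠ 0) (w : S) :
    fShift n (w + algebraMap Scalars S ((n : Scalars) * hbar)) =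
      (1 - hbar ^ 2 • invSub w ^ 2) * fShift n w := by
  generalize hc : (n : Scalars) * hbar = c
  have h := congrArg (PowerSeries.map (Polynomial.aeval (R := Scalars) w).toRingHom)
    (fShift_add_comm hn (Polynomial.X : Polynomial Scalars))
  rw [hc, map_mul, map_sub, map_one, map_smul_series, map_pow, map_invSub, map_fShift, map_fShift,
    map_add, AlgHom.commutes, Polynomial.aeval_X] at h
  exact h

theorem invSub_add (w : S) (c : Scalars) :
    invSub (w + algebraMap Scalars S c) - invSub w =
      c • (invSub w * invSub (w + algebraMap Scalars S c)) := by
  have h := congrArg (PowerSeries.map (Polynomial.aeval (R := Scalars) w).toRingHom)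
    (invSub_add_comm (Polynomial.X : Polynomial Scalars) (algebraMap Scalars _ c))
  rw [← smul_eq_C_mul, algebraMap_smul, map_sub, map_smul_series, map_mul, map_invSub, map_invSub,
    map_add, AlgHom.commutes, Polynomial.aeval_X] at h
  exact h

theorem mem_center_of_coeff {R : Type} [Ring R] {f : PowerSeries R}
    (h : ∀ p, coeff p f ∈ Subring.center R) : f ∈ Subring.center (PowerSeries R) := by
  rw [Subring.mem_center_iff]
  intro g
  ext p
  rw [coeff_mul, coeff_mul, ← Finset.Nat.sum_antidiagonal_swap]
  exact Finset.sum_congr rfl fun x _ => Subring.mem_center_iff.1 (h _) _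

theorem smul_mem_center {x : S} (r : Scalars) (hx : x ∈ Subring.center S) :
    r • x ∈ Subring.center S := by
  rw [Subring.mem_center_iff] at *
  intro g
  rw [mul_smul_comm, smul_mul_assoc, hx]

theorem invSub_mem_center {S : Type} [Ring S] {w : S} (hw : w ∈ Subring.center S) :
    invSub w ∈ Subring.center (PowerSeries S) := by
  refine mem_center_of_coeff fun p => ?_
  cases p with
  | zero => simp [invSub]
  | succ p =>
    rw [invSub, coeff_succ_X_mul, coeff_mk]
    exact Subring.pow_mem _ hw p

theorem fShift_mem_center (n : ℕ) {w : S} (hw : w ∈ Subring.center S) :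
    fShift n w ∈ Subring.center (PowerSeries S) := by
  refine mem_center_of_coeff fun p => ?_
  rw [fShift, coeff_mk]
  refine Subring.sum_mem _ fun k _ => smul_mem_center _ ?_
  have := Subring.pow_mem _ (invSub_mem_center hw) k
  rw [Subring.mem_center_iff] at *
  intro g
  have := congrArg (coeff p) (this (C g))
  rwa [coeff_C_mul, coeff_mul_C] at this

end RMatrix

/-! ### Entries of the relations -/

section Entries

variable {n : ℕ} {B : Type} [Ring B]

theorem permMatrix_mul_apply {S : Type} [Ring S]
    (W : Matrix (Fin n × Fin n) (Fin n × Fin n) S) (i p : Fin n) (y : Fin n × Fin n) :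
    (permMatrix n S * W) (i, p) y = W (p, i) y := by
  rw [Matrix.mul_apply, Finset.sum_eq_single (p, i)]
  · simp [permMatrix]
  · rintro ⟨a, b⟩ _ h
    rw [permMatrix, Matrix.of_apply, if_neg, zero_mul]
    rintro ⟨h1, h2⟩
    exact h (by simp_all)
  · simp

theorem mul_permMatrix_apply {S : Type} [Ring S]
    (W : Matrix (Fin n × Fin n) (Fin n × Fin n) S) (j q : Fin n) (x : Fin n × Fin n) :
    (W * permMatrix n S) x (j, q) = W x (q, j) := by
  rw [Matrix.mul_apply, Finset.sum_eq_single (q, j)]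
  · simp [permMatrix]
  · rintro ⟨a, b⟩ _ h
    rw [permMatrix, Matrix.of_apply, if_neg, mul_zero]
    rintro ⟨h1, h2⟩
    exact h (by simp_all)
  · simp

theorem leg₁_mul_leg₂_apply (M N : Matrix (Fin n) (Fin n) (PowerSeries B)) (i j p q : Fin n) :
    (leg₁ M * leg₂ N) (i, p) (j, q) = outer (M i j) * inner (N p q) := by
  rw [Matrix.mul_apply, Finset.sum_eq_single (j, p)]
  · simp [leg₁, leg₂]
  · rintro ⟨a, b⟩ _ h
    simp only [leg₁, leg₂, Matrix.kroneckerMap_apply, Matrix.map_apply, Matrix.one_apply]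
    by_cases h1 : a = j
    · rw [if_neg (c := p = b) (by rintro rfl; exact h (by rw [h1]))]; simp
    · rw [if_neg h1]; simp
  · simp

theorem leg₂_mul_leg₁_apply (M N : Matrix (Fin n) (Fin n) (PowerSeries B)) (i j p q : Fin n) :
    (leg₂ N * leg₁ M) (i, p) (j, q) = inner (N p q) * outer (M i j) := by
  rw [Matrix.mul_apply, Finset.sum_eq_single (i, q)]
  · simp [leg₁, leg₂]
  · rintro ⟨a, b⟩ _ h
    simp only [leg₁, leg₂, Matrix.kroneckerMap_apply, Matrix.map_apply, Matrix.one_apply]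
    by_cases h1 : i = a
    · rw [if_neg (c := b = q) (by rintro rfl; exact h (by rw [h1]))]; simp
    · rw [if_neg h1]; simp
  · simp

end Entries

/-! ### Relations in the completed Yangian double -/

section Relations

variable (n : ℕ)

/-- `relIdeal` is saturated with respect to powers of `h`, so one more factor of `h` only raises the
exponent witnessing membership. -/
theorem hbar_smul_eq_zero_DYcr {d : DYcr n} (h : hbar • d = 0) : d = 0 := by
  obtain ⟨z, rfl⟩ := Ideal.Quotient.mk_surjective (I := relIdeal n) d
  obtain ⟨N, hN⟩ := Ideal.Quotient.eq_zero_iff_mem.1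
    (show Ideal.Quotient.mk (relIdeal n) (hbar • z) = 0 from h)
  refine Ideal.Quotient.eq_zero_iff_mem.2 ⟨N + 1, ?_⟩
  rwa [pow_succ, mul_smul]

theorem hbar_smul_eq_zero_DY {x : DY n} (h : hbar • x = 0) : x = 0 :=
  hbar_smul_eq_zero_completion (D := DYcr n) (fun _ => hbar_smul_eq_zero_DYcr n) h

/-- The canonical homomorphism from the free algebra. -/
noncomputable def freeToDY : Free n →ₐ[Scalars] DY n where
  toFun z := toCompletion (D := DYcr n) (Ideal.Quotient.mk (relIdeal n) z)
  map_one' := rfl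
  map_mul' _ _ := rfl
  map_zero' := rfl
  map_add' _ _ := rfl
  commutes' _ := rfl

theorem freeToDY_eq_zero {z : Free n} (h : z ∈ criticalRelators n) : freeToDY n z = 0 := by
  have : Ideal.Quotient.mk (relIdeal n) z = 0 := Ideal.Quotient.eq_zero_iff_mem.2
    ⟨0, by rw [pow_zero, one_smul]; exact TwoSidedIdeal.subset_span h⟩
  change toCompletion (D := DYcr n) (Ideal.Quotient.mk (relIdeal n) z) = 0
  rw [this]
  rfl

theorem freeToDY_genC : freeToDY n (genC n) = -(n : DY n) := by
  have h := freeToDY_eq_zero n (z := genC n + (n : Free n)) (Or.inr rfl)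
  rw [map_add, map_natCast] at h
  exact eq_neg_of_add_eq_zero_left h

theorem map_LMinus (i j : Fin n) :
    PowerSeries.map (freeToDY n).toRingHom (LMinus (genL n) i j) = LMinus (el n) i j := by
  simp only [LMinus, Matrix.add_apply, Matrix.of_apply, map_add]
  refine congrArg₂ (· + ·) ?_ ?_
  · simp only [Matrix.one_apply]
    split_ifs <;> simp
  · ext p
    rw [coeff_map, coeff_mk, coeff_mk]
    exact map_smul (freeToDY n) _ _

theorem map_LPlus (i j : Fin n) :
    PowerSeries.map (freeToDY n).toRingHom (LPlus (genL n) i j) = LPlus (el n) i j := by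
  simp only [LPlus, Matrix.sub_apply, Matrix.of_apply, map_sub, map_mul, PowerSeries.map_X]
  refine congrArg₂ (· - ·) ?_ (congrArg (X * ·) ?_)
  · simp only [Matrix.one_apply]
    split_ifs <;> simp
  · ext p
    rw [coeff_map, coeff_mk, coeff_mk]
    exact map_smul (freeToDY n) _ _

theorem map_outer {B B' : Type} [Ring B] [Ring B'] (φ : B →+* B') (f : PowerSeries B) :
    PowerSeries.map (PowerSeries.map φ) (outer f) = outer (PowerSeries.map φ f) := by
  ext p
  simp [outer]

theorem map_inner {B B' : Type} [Ring B] [Ring B'] (φ : PowerSeries B →+* PowerSeries B')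
    (f : PowerSeries B) : PowerSeries.map φ (inner f) = inner (φ f) := by
  simp [inner]

theorem outer_smul {B : Type} [Ring B] [Algebra Scalars B] (r : Scalars) (f : PowerSeries B) :
    outer (r • f) = r • outer f := by
  ext p q
  simp only [outer, coeff_map, coeff_smul, coeff_C]
  split_ifs <;> simp

theorem inner_smul {B : Type} [Ring B] [Algebra Scalars B] (r : Scalars) (f : PowerSeries B) :
    inner (r • f) = r • inner f := by
  ext p q
  simp only [inner, coeff_smul, coeff_C]
  split_ifs <;> simp

theorem linear_mul_apply {S : Type} [Ring S] (W : Matrix (Fin n × Fin n) (Fin n × Fin n) S)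
    (a b : S) (i p : Fin n) (y : Fin n × Fin n) :
    ((a • (1 : Matrix (Fin n × Fin n) (Fin n × Fin n) S) + b • permMatrix n S) * W) (i, p) y =
      a * W (i, p) y + b * W (p, i) y := by
  rw [add_mul, smul_mul_assoc, smul_mul_assoc, one_mul, Matrix.add_apply, Matrix.smul_apply,
    Matrix.smul_apply, permMatrix_mul_apply, smul_eq_mul, smul_eq_mul]

theorem mul_smul_apply_of_commute {S : Type} [Ring S]
    (W V : Matrix (Fin n × Fin n) (Fin n × Fin n) S) (a : S) (h : ∀ x y, Commute a (V x y))
    (x y : Fin n × Fin n) : (W * a • V) x y = (W * V) x y * a := by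
  simp only [Matrix.mul_apply, Finset.sum_mul, Matrix.smul_apply, smul_eq_mul, (h _ _).eq,
    mul_assoc]

theorem mul_linear_apply {S : Type} [Ring S] (W : Matrix (Fin n × Fin n) (Fin n × Fin n) S)
    (a b : S) (j q : Fin n) (x : Fin n × Fin n) :
    (W * (a • (1 : Matrix (Fin n × Fin n) (Fin n × Fin n) S) + b • permMatrix n S)) x (j, q) =
      W x (j, q) * a + W x (q, j) * b := by
  rw [mul_add, Matrix.add_apply, mul_smul_apply_of_commute, mul_smul_apply_of_commute, mul_one,
    mul_permMatrix_apply]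
  · intro x y
    simp only [permMatrix, Matrix.of_apply]
    split_ifs <;> simp
  · intro x y
    simp only [Matrix.one_apply]
    split_ifs <;> simp

theorem relMinusMinus_apply (i p j q : Fin n) : relMinusMinus n (i, p) (j, q) =
    (outer X - inner X) * (outer (LMinus (genL n) i j) * inner (LMinus (genL n) p q)) +
      hbar • (outer (LMinus (genL n) p j) * inner (LMinus (genL n) i q)) -
    (inner (LMinus (genL n) p q) * outer (LMinus (genL n) i j) * (outer X - inner X) +
      hbar • (inner (LMinus (genL n) p j) * outer (LMinus (genL n) i q))) := by
  simp only [relMinusMinus]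
  rw [Matrix.sub_apply, mul_assoc, linear_mul_apply, mul_linear_apply, leg₁_mul_leg₂_apply,
    leg₁_mul_leg₂_apply, leg₂_mul_leg₁_apply, leg₂_mul_leg₁_apply]
  simp only [smul_mul_assoc, mul_smul_comm, one_mul, mul_one]

/-- The relation `R(u - v) L₁⁻(u) L₂⁻(v) = L₂⁻(v) L₁⁻(u) R(u - v)`. -/
theorem rll_LMinus (i p j q : Fin n) :
    (outer X - inner X) * (outer (LMinus (el n) i j) * inner (LMinus (el n) p q)) +
      hbar • (outer (LMinus (el n) p j) * inner (LMinus (el n) i q)) =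
    inner (LMinus (el n) p q) * outer (LMinus (el n) i j) * (outer X - inner X) +
      hbar • (inner (LMinus (el n) p j) * outer (LMinus (el n) i q)) := by
  have h : PowerSeries.map (PowerSeries.map (freeToDY n).toRingHom)
      (relMinusMinus n (i, p) (j, q)) = 0 := by
    ext a b
    rw [coeff_map, coeff_map]
    exact freeToDY_eq_zero n (Or.inl (Or.inl (Or.inr ⟨_, _, a, b, rfl⟩)))
  have hs : ∀ (r : Scalars) (G : PowerSeries (PowerSeries (Free n))),
      PowerSeries.map (PowerSeries.map (freeToDY n).toRingHom) (r • G) =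
        r • PowerSeries.map (PowerSeries.map (freeToDY n).toRingHom) G := by
    intro r G
    ext p q
    exact map_smul (freeToDY n) r _
  rw [relMinusMinus_apply] at h
  simp only [map_sub, map_add, map_mul, hs, map_outer, map_inner, map_LMinus,
    PowerSeries.map_X] at h
  exact sub_eq_zero.1 h

/-- The homomorphism `g(v) ↦ g(v + a h)` on series over the Yangian double. -/
noncomputable def shiftDY (a : ℕ) : PowerSeries (DY n) →ₐ[Scalars] PowerSeries (DY n) :=
  shiftHom (DYcr n) a

theorem shiftDY_C (a : ℕ) (b : DY n) : shiftDY n a (C b) = C b := hShift_C (D := DYcr n) a b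

theorem shiftDY_X (a : ℕ) : shiftDY n a X = X + C (((a : Scalars) * hbar) • (1 : DY n)) :=
  hShift_X (D := DYcr n) a

theorem shiftDY_bilinear {ι : Type} [Fintype ι] {f g f' g' : ι → PowerSeries (DY n)}
    (a b : ℕ) (h : ∑ x, outer (f x) * inner (g x) = ∑ x, inner (g' x) * outer (f' x)) :
    ∑ x, outer (shiftDY n a (f x)) * inner (shiftDY n b (g x)) =
      ∑ x, inner (shiftDY n b (g' x)) * outer (shiftDY n a (f' x)) :=
  hShift_bilinear (D := DYcr n) a b h

theorem LMinusShift_apply (a : ℕ) (i j : Fin n) :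
    LMinusShift n a i j = shiftDY n a (LMinus (el n) i j) := rfl

/-- The spectral parameter `u + a h` as a series. -/
noncomputable def shiftedX (a : ℕ) : PowerSeries (DY n) :=
  X + C (((a : Scalars) * hbar) • (1 : DY n))

/-- The RLL relation with the spectral parameters absorbed into the one-variable factors. In this
separated form `hShift_bilinear` and `diagonal_bilinear` apply. -/
theorem rll_sum (a b : ℕ) (i p j q : Fin n) :
    ∑ x : Fin 3, outer (![shiftedX n a * LMinusShift n a i j, -LMinusShift n a i j,
        hbar • LMinusShift n a p j] x) *
      inner (![LMinusShift n b p q, shiftedX n b * LMinusShift n b p q, LMinusShift n b i q] x) =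
    ∑ x : Fin 3, inner (![LMinusShift n b p q, shiftedX n b * LMinusShift n b p q,
        LMinusShift n b p j] x) *
      outer (![shiftedX n a * LMinusShift n a i j, -LMinusShift n a i j,
        hbar • LMinusShift n a i q] x) := by
  have h := rll_LMinus n i p j q
  have cX : ∀ f : PowerSeries (DY n), outer f * inner X = inner X * outer f := by
    intro f
    ext s t
    rw [coeff_outer_mul_inner, coeff_inner_mul_outer, coeff_X]
    split_ifs <;> simp
  have cX' : ∀ f : PowerSeries (DY n), inner f * outer X = outer X * inner f := by
    intro f
    ext s t
    rw [coeff_outer_mul_inner, coeff_inner_mul_outer, coeff_X]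
    split_ifs <;> simp
  have cXX : ∀ f g : PowerSeries (DY n), inner g * outer f * inner X = inner (X * g) * outer f := by
    intro f g
    rw [mul_assoc, cX, map_mul, ← mul_assoc, ← map_mul inner g, ← map_mul inner X,
      (PowerSeries.commute_X g).eq]
  have := shiftDY_bilinear n a b (ι := Fin 3)
    (f := ![X * LMinus (el n) i j, -LMinus (el n) i j, hbar • LMinus (el n) p j])
    (g := ![LMinus (el n) p q, X * LMinus (el n) p q, LMinus (el n) i q])
    (f' := ![X * LMinus (el n) i j, -LMinus (el n) i j, hbar • LMinus (el n) i q])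
    (g' := ![LMinus (el n) p q, X * LMinus (el n) p q, LMinus (el n) p j]) (by
      simp only [Fin.sum_univ_three, Matrix.cons_val_zero, Matrix.cons_val_one, Matrix.cons_val,
        map_neg, outer_smul]
      rw [sub_mul, mul_sub, ← mul_assoc, ← map_mul, ← mul_assoc (inner X), ← cX, mul_assoc,
        ← map_mul, cXX, mul_assoc (inner _), ← map_mul outer _ X,
        (PowerSeries.commute_X (LMinus (el n) i j)).eq] at h
      simp only [smul_mul_assoc, mul_smul_comm, neg_mul, mul_neg, ← sub_eq_add_neg]
      rw [← h])
  simpa only [Fin.sum_univ_three, Matrix.cons_val_zero, Matrix.cons_val_one, Matrix.cons_val,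
    map_mul, map_neg, map_smul, shiftDY_X, ← LMinusShift_apply, shiftedX] using this

end Relations

/-! ### Fusion and the commuting series -/

section Fusion

variable (n : ℕ)

theorem commute_shiftedX (a : ℕ) (f : PowerSeries (DY n)) : Commute (shiftedX n a) f := by
  rw [shiftedX]
  refine Commute.add_left (PowerSeries.commute_X f).symm ?_
  rw [Commute, SemiconjBy]
  ext p
  rw [coeff_C_mul, coeff_mul_C, smul_mul_assoc, mul_smul_comm, one_mul, mul_one]

theorem hbar_smul_eq_zero_series {f : PowerSeries (DY n)} (h : hbar • f = 0) : f = 0 := by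
  ext p
  have := congrArg (coeff p) h
  rw [coeff_smul] at this
  exact hbar_smul_eq_zero_DY n this

theorem shiftedX_succ (a : ℕ) :
    shiftedX n (a + 1) = shiftedX n a + hbar • (1 : PowerSeries (DY n)) := by
  have h : hbar • (1 : PowerSeries (DY n)) = C (hbar • (1 : DY n)) := by
    ext p
    rw [coeff_smul, ← map_one C, coeff_C, coeff_C]
    split_ifs <;> simp
  rw [shiftedX, shiftedX, add_assoc, h, ← map_add, ← add_smul]
  push_cast
  rw [add_mul, one_mul]

/-- The hypothesis is the RLL relation at parameters `x` and `x + h`. The terms containing `x`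
cancel and a common factor `h` is left. -/
theorem fusible_of_rll {T : Type} [Ring T] [Algebra Scalars T]
    (hT : ∀ t : T, hbar • t = 0 → t = 0) {x : T} (hx : ∀ t, Commute x t)
    {L L' : Matrix (Fin n) (Fin n) T}
    (h : ∀ i p j q, x * L i j * L' p q + -L i j * ((x + hbar • 1) * L' p q) +
      hbar • L p j * L' i q = L' p q * (x * L i j) + (x + hbar • 1) * L' p q * -L i j +
        L' p j * (hbar • L i q)) : Fusible L L' := by
  have key : ∀ i p j q, hbar • (L p j * L' i q - L i j * L' p q) =
      hbar • (L' p j * L i q - L' p q * L i j) := by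
    intro i p j q
    have h := h i p j q
    have e1 : L' p q * (x * L i j) = x * (L' p q * L i j) := by
      rw [← mul_assoc, ← (hx _).eq, mul_assoc]
    have e2 : L i j * (x * L' p q) = x * (L i j * L' p q) := by
      rw [← mul_assoc, ← (hx _).eq, mul_assoc]
    simp only [add_mul, mul_add, smul_mul_assoc, mul_smul_comm, one_mul, neg_mul, mul_neg,
      smul_neg, mul_assoc, e1, e2] at h
    rw [smul_sub, smul_sub, ← sub_eq_zero]
    rw [← sub_eq_zero] at h
    rw [← h]
    abel
  intro i j k l
  rw [← sub_eq_zero]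
  refine hT _ ?_
  -- Multiplication on the right by `1 + P`: the right-hand side of `key` is antisymmetric in the
  -- two column indices, so it disappears from the sum.
  have h3 := congrArg₂ (· + ·) (key i k j l) (key i k l j)
  simp only [← smul_add] at h3
  rw [← sub_eq_zero, ← smul_sub] at h3
  rw [← neg_eq_zero, ← smul_neg, ← h3]
  refine congrArg (fun t : T => hbar • t) ?_
  abel

theorem fusible_LMinusShift (a : ℕ) : Fusible (LMinusShift n a) (LMinusShift n (a + 1)) := by
  refine fusible_of_rll n (fun _ => hbar_smul_eq_zero_series n) (commute_shiftedX n a)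
    fun i p j q => ?_
  have h := diagonal_bilinear (rll_sum n a (a + 1) i p j q)
  simp only [Fin.sum_univ_three, Matrix.cons_val_zero, Matrix.cons_val_one, Matrix.cons_val] at h
  rw [shiftedX_succ] at h
  exact h

end Fusion

/-! ### The traces `ℓ̄_k(u)` -/

section Traces

variable {n k : ℕ} {B B' : Type} [Ring B] [Algebra Scalars B] [Ring B'] [Algebra Scalars B']

theorem map_permRep {n : ℕ} {B B' : Type} [Ring B] [Ring B'] {Λ : Type} [Fintype Λ]
    [DecidableEq Λ] (φ : B →+* B') (σ : Equiv.Perm Λ) :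
    (permRep Λ n B σ).map φ = permRep Λ n B' σ := by
  ext I J
  rw [Matrix.map_apply, permRep_apply, permRep_apply]
  split_ifs <;> simp

theorem map_legOf {n : ℕ} {B B' : Type} [Ring B] [Ring B'] {Λ : Type} [Fintype Λ]
    [DecidableEq Λ] (φ : B →+* B') (a : Λ)
    (M : Matrix (Fin n) (Fin n) B) : (legOf a M).map φ = legOf a (M.map φ) := by
  ext I J
  rw [Matrix.map_apply, legOf_apply, legOf_apply]
  split_ifs <;> simp

theorem map_antisymmMatrix (φ : B →+* B') (hφ : ∀ (r : Scalars) b, φ (r • b) = r • φ b) :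
    (antisymmMatrix n k B).map φ = antisymmMatrix n k B' := by
  have h : ∀ W : Matrix (Fin k → Fin n) (Fin k → Fin n) B, W.map φ = φ.mapMatrix W :=
    fun _ => rfl
  have hs : ∀ (r : Scalars) (W : Matrix (Fin k → Fin n) (Fin k → Fin n) B),
      φ.mapMatrix (r • W) = r • φ.mapMatrix W := by
    intro r W
    ext I J
    exact hφ _ _
  rw [h, antisymmMatrix, antisymm, hs, map_sum, antisymmMatrix, antisymm]
  refine congrArg (fun W : Matrix (Fin k → Fin n) (Fin k → Fin n) B' => _ • W) ?_
  refine Finset.sum_congr rfl fun σ _ => ?_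
  rw [map_zsmul, ← h, map_permRep]

theorem map_trace_antisymmMatrix (φ : B →+* B') (hφ : ∀ (r : Scalars) b, φ (r • b) = r • φ b)
    (L : Fin k → Matrix (Fin n) (Fin n) B) :
    φ (Matrix.trace (antisymmMatrix n k B * ((List.finRange k).map fun a => legOf a (L a)).prod)) =
      Matrix.trace (antisymmMatrix n k B' *
        ((List.finRange k).map fun a => legOf a ((L a).map φ)).prod) := by
  have h : ∀ W : Matrix (Fin k → Fin n) (Fin k → Fin n) B, W.map φ = φ.mapMatrix W :=
    fun _ => rfl
  have ht : ∀ W : Matrix (Fin k → Fin n) (Fin k → Fin n) B,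
      φ (Matrix.trace W) = Matrix.trace (φ.mapMatrix W) := by
    intro W
    simp [Matrix.trace]
  rw [ht, ← map_antisymmMatrix φ hφ, map_mul, map_list_prod, List.map_map, h]
  refine congrArg (fun l : List (Matrix (Fin k → Fin n) (Fin k → Fin n) B') =>
    Matrix.trace (_ * l.prod)) (List.map_congr_left fun a _ => ?_)
  exact map_legOf φ a (L a)

theorem antisymmetrizer_map (n k : ℕ) :
    (antisymmetrizer n k).map (algebraMap Scalars B) = antisymmMatrix n k B := by
  ext I J
  simp only [antisymmetrizer, antisymmMatrix, antisymm, Matrix.map_apply, Matrix.smul_apply,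
    Matrix.sum_apply, permRep_apply, Matrix.of_apply, smul_eq_mul, map_mul, map_sum, map_zsmul]
  rw [Algebra.smul_def]
  refine congrArg (fun t : B => _ * t) (Finset.sum_congr rfl fun σ _ => ?_)
  refine congrArg (fun t : B => (Equiv.Perm.sign σ : ℤ) • t) ?_
  by_cases h : I ∘ σ = J
  · have h' : ∀ a, I (σ a) = J a := congrFun h
    rw [if_pos h, if_pos h', map_one]
  · have h' : ¬ ∀ a, I (σ a) = J a := fun h' => h (funext h')
    rw [if_neg h, if_neg h', map_zero]

theorem ellBar_eq_trace (n k : ℕ) : ellBar n k = Matrix.trace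
    (antisymmMatrix n k (PowerSeries (DY n)) *
      ((List.finRange k).map fun a : Fin k => legOf a (LMinusShift n a)).prod) := by
  rw [ellBar, List.ofFn_eq_map, antisymmetrizer_map]
  simp only [leg_eq_legOf]

end Traces

/-! ### Commutativity of the coefficients -/

section Commutativity

variable (n : ℕ)

theorem outer_X_mem_center {B : Type} [Ring B] :
    (outer X : PowerSeries (PowerSeries B)) ∈ Subring.center (PowerSeries (PowerSeries B)) := by
  rw [outer, PowerSeries.map_X, Subring.mem_center_iff]
  exact fun g => (PowerSeries.commute_X g).eq

theorem inner_X_mem_center {B : Type} [Ring B] :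
    (inner X : PowerSeries (PowerSeries B)) ∈ Subring.center (PowerSeries (PowerSeries B)) := by
  refine mem_center_of_coeff fun p => ?_
  rw [inner, coeff_C]
  split_ifs
  · rw [Subring.mem_center_iff]
    exact fun g => (PowerSeries.commute_X g).eq
  · exact Subring.zero_mem _

/-- A scalar as a central element. -/
noncomputable def centralScalar (B : Type) [Ring B] [Algebra Scalars B] (c : Scalars) :
    Subring.center B := ⟨c • 1, smul_mem_center _ (Subring.one_mem _)⟩

theorem centralScalar_smul {B : Type} [Ring B] [Algebra Scalars B] (c : Scalars) (b : B) :
    centralScalar B c • b = c • b := by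
  rw [Subring.smul_def, centralScalar, smul_eq_mul, smul_mul_assoc, one_mul]

theorem centralScalar_add {B : Type} [Ring B] [Algebra Scalars B] (c d : Scalars) :
    centralScalar B (c + d) = centralScalar B c + centralScalar B d :=
  Subtype.ext (add_smul _ _ _)

theorem C_smul_one {B : Type} [Ring B] [Algebra Scalars B] (c : Scalars) :
    (C (c • (1 : B)) : PowerSeries B) = c • 1 := by
  ext p
  rw [coeff_smul, ← map_one C, coeff_C, coeff_C]
  split_ifs <;> simp

/-- The parameter `u + a h` as a central series in both spectral parameters. -/
noncomputable def outerParameter (B : Type) [Ring B] [Algebra Scalars B] (a : ℕ) :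
    Subring.center (PowerSeries (PowerSeries B)) :=
  ⟨outer X, outer_X_mem_center⟩ + centralScalar _ ((a : Scalars) * hbar)

/-- The parameter `v + a h` as a central series in both spectral parameters. -/
noncomputable def innerParameter (B : Type) [Ring B] [Algebra Scalars B] (a : ℕ) :
    Subring.center (PowerSeries (PowerSeries B)) :=
  ⟨inner X, inner_X_mem_center⟩ + centralScalar _ ((a : Scalars) * hbar)

theorem outer_shiftedX (a : ℕ) :
    outer (shiftedX n a) = (outerParameter (DY n) a : PowerSeries (PowerSeries (DY n))) := by
  rw [shiftedX, map_add, C_smul_one, outer_smul, map_one]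
  rfl

theorem inner_shiftedX (a : ℕ) :
    inner (shiftedX n a) = (innerParameter (DY n) a : PowerSeries (PowerSeries (DY n))) := by
  rw [shiftedX, map_add, C_smul_one, inner_smul, map_one]
  rfl

theorem outerParameter_succ {B : Type} [Ring B] [Algebra Scalars B] (a : ℕ) :
    outerParameter B (a + 1) = outerParameter B a + centralScalar _ hbar := by
  rw [outerParameter, outerParameter, add_assoc, ← centralScalar_add]
  push_cast
  rw [add_mul, one_mul]

theorem innerParameter_succ {B : Type} [Ring B] [Algebra Scalars B] (a : ℕ) :
    innerParameter B (a + 1) = innerParameter B a + centralScalar _ hbar := by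
  rw [innerParameter, innerParameter, add_assoc, ← centralScalar_add]
  push_cast
  rw [add_mul, one_mul]

theorem parameter_difference_smul {B : Type} [Ring B] [Algebra Scalars B] (a b : ℕ)
    (d : Scalars) (z : PowerSeries (PowerSeries B)) :
    (outerParameter B a - innerParameter B b + centralScalar _ (d * hbar)) • z =
      (outer X - inner X) * z + ((a - b + d : Scalars) * hbar) • z := by
  rw [outerParameter, innerParameter, add_sub_add_comm, add_assoc, add_smul, add_smul, sub_smul,
    sub_smul, centralScalar_smul, centralScalar_smul, centralScalar_smul, Subring.smul_def,
    Subring.smul_def, smul_eq_mul, smul_eq_mul, sub_mul, add_mul, sub_mul, add_smul, sub_smul]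

theorem Fusible.map {B B' : Type} [Ring B] [Ring B'] {n : ℕ} {M N : Matrix (Fin n) (Fin n) B}
    (h : Fusible M N) (φ : B →+* B') : Fusible (M.map φ) (N.map φ) := by
  intro i j k l
  simpa only [map_add, map_mul, Matrix.map_apply] using congrArg φ (h i j k l)

theorem rll_of_sum {B : Type} [Ring B] [Algebra Scalars B] {x y : Subring.center B}
    {a₁ a₂ a₃ b₁ b₂ b₃ : B}
    (h : (x : B) * a₁ * b₁ + -a₁ * (y * b₁) + hbar • a₂ * b₂ =
      b₁ * (x * a₁) + y * b₁ * -a₁ + b₃ * (hbar • a₃)) :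
    (x - y) • (a₁ * b₁) + centralScalar B hbar • (a₂ * b₂) =
      (x - y) • (b₁ * a₁) + centralScalar B hbar • (b₃ * a₃) := by
  have hx : ∀ b : B, b * x = x * b := fun b => Subring.mem_center_iff.1 x.2 b
  have hy : ∀ b : B, b * y = y * b := fun b => Subring.mem_center_iff.1 y.2 b
  rw [centralScalar_smul, centralScalar_smul, sub_smul, sub_smul]
  simp only [Subring.smul_def, smul_eq_mul]
  rw [← mul_assoc b₁, hx, ← mul_assoc (-a₁), neg_mul, hy] at h
  simp only [smul_mul_assoc, mul_smul_comm, neg_mul, mul_neg, ← sub_eq_add_neg, mul_assoc] at h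
  exact h

/-- Both parameters are central in the ring of double series, which serves as the coefficient ring
of `trace_mul_trace_comm`, with its centre as scalars. -/
theorem commute_outer_inner_ellBar (k m : ℕ) :
    Commute (outer (ellBar n k)) (inner (ellBar n m)) := by
  rw [ellBar_eq_trace, ellBar_eq_trace,
    map_trace_antisymmMatrix outer outer_smul (fun a : Fin k => LMinusShift n a),
    map_trace_antisymmMatrix inner inner_smul (fun a : Fin m => LMinusShift n a)]
  refine trace_mul_trace_comm _ _ (fun a => outerParameter (DY n) a)
    (fun b => innerParameter (DY n) b) (centralScalar _ hbar) ?_ ?_ ?_ ?_ ?_ ?_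
  · intro a b hab
    rw [hab, outerParameter_succ]
  · intro a b hab
    rw [hab, innerParameter_succ]
  · intro a b hab
    rw [hab]
    exact (fusible_LMinusShift n a).map outer
  · intro a b hab
    rw [hab]
    exact (fusible_LMinusShift n a).map inner
  · intro a b i j p q
    have := rll_sum n a b i p j q
    simp only [Fin.sum_univ_three, Matrix.cons_val_zero, Matrix.cons_val_one, Matrix.cons_val,
      map_mul, map_neg, outer_smul, outer_shiftedX, inner_shiftedX] at this
    exact rll_of_sum this
  · intro a b z hz
    -- The scalar splits as `(u_a - v_b + h)(u_a - v_b - h)`, and each factor is the unshifted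
    -- difference plus a multiple of `h`.
    rw [sq_sub_sq, mul_smul] at hz
    have e1 : outerParameter (DY n) a - innerParameter (DY n) b + centralScalar _ hbar =
        outerParameter (DY n) a - innerParameter (DY n) b + centralScalar _ (1 * hbar) := by
      rw [one_mul]
    have e2 : outerParameter (DY n) a - innerParameter (DY n) b - centralScalar _ hbar =
        outerParameter (DY n) a - innerParameter (DY n) b + centralScalar _ (-1 * hbar) := by
      rw [sub_eq_add_neg]
      refine congrArg _ (Subtype.ext ?_)
      change -(hbar • (1 : PowerSeries (PowerSeries (DY n)))) = (-1 * hbar) • 1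
      rw [neg_mul, one_mul, neg_smul]
    rw [e1, e2, parameter_difference_smul, parameter_difference_smul] at hz
    exact eq_zero_of_spectral_difference (D := DYcr n) _ _
      (eq_zero_of_spectral_difference (D := DYcr n) _ _ hz)

theorem commute_coeff_ellBar (k m p q : ℕ) :
    Commute (coeff p (ellBar n k)) (coeff q (ellBar n m)) := by
  have h := congrArg (fun F => coeff q (coeff p F)) (commute_outer_inner_ellBar n k m).eq
  simp only [coeff_outer_mul_inner, coeff_inner_mul_outer] at h
  exact h

end Commutativity

/-! ### The permutation operator with values in a matrix algebra -/

section PermOperator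

variable {n : ℕ} {B : Type} [Ring B] {K : Type} [CommRing K] [Algebra K B]

/-- The permutation operator `P` on `ℂⁿ ⊗ ℂⁿ` as a matrix in the second factor with entries
acting in the first one. -/
def permOperator (n : ℕ) (B : Type) [Ring B] :
    Matrix (Fin n) (Fin n) (Matrix (Fin n) (Fin n) B) :=
  Matrix.of fun i j => Matrix.single j i 1

theorem permOperator_apply (i j : Fin n) : permOperator n B i j = Matrix.single j i 1 := rfl

theorem permOperator_apply_mul (i j k l : Fin n) : permOperator n B i j * permOperator n B k l =
    (if i = l then 1 else 0 : K) • permOperator n B k j := by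
  simp only [permOperator_apply]
  split_ifs with h
  · subst h
    simp
  · rw [Matrix.single_mul_single_of_ne _ _ _ _ h, zero_smul]

theorem one_apply_eq_smul (i j : Fin n) :
    (1 : Matrix (Fin n) (Fin n) (Matrix (Fin n) (Fin n) B)) i j =
      (if i = j then 1 else 0 : K) • (1 : Matrix (Fin n) (Fin n) B) := by
  rw [Matrix.one_apply]
  split_ifs <;> simp

theorem permOperator_mul_apply (W : Matrix (Fin n) (Fin n) (Matrix (Fin n) (Fin n) B))
    (p q i j : Fin n) : (permOperator n B * W) p q i j = W i q p j := by
  rw [Matrix.mul_apply, Matrix.sum_apply, Finset.sum_eq_single i]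
  · rw [permOperator_apply, Matrix.single_mul_apply_same, one_mul]
  · intro p' _ h
    rw [permOperator_apply, Matrix.single_mul_apply_of_ne _ _ _ _ _ h.symm]
  · simp

theorem mul_permOperator_apply (W : Matrix (Fin n) (Fin n) (Matrix (Fin n) (Fin n) B))
    (p q i j : Fin n) : (W * permOperator n B) p q i j = W p j i q := by
  rw [Matrix.mul_apply, Matrix.sum_apply, Finset.sum_eq_single j]
  · rw [permOperator_apply, Matrix.mul_single_apply_same, mul_one]
  · intro p' _ h
    rw [permOperator_apply, Matrix.mul_single_apply_of_ne _ _ _ _ _ h.symm]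
  · simp

theorem permOperator_mul_self : permOperator n B * permOperator n B = 1 := by
  ext p q i j
  rw [permOperator_mul_apply, permOperator_apply, Matrix.one_apply]
  by_cases h : p = q
  · subst h
    by_cases h' : i = j
    · subst h'; simp
    · simp [h']
  · rw [if_neg h]
    rw [Matrix.single_apply, if_neg fun e => h e.1.symm, Matrix.zero_apply]

/-- The Yang–Baxter equation for two copies of `1 + dP` sharing the auxiliary space. The condition
on `d₁`, `d₂` is that for inverse spectral parameters differing by `h`. -/
theorem fusible_linear {d₁ d₂ : K} (h : d₂ - d₁ + d₁ * d₂ = 0) :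
    Fusible (1 + d₁ • permOperator n B) (1 + d₂ • permOperator n B) := by
  intro i j k l
  simp only [Matrix.add_apply, Matrix.smul_apply, one_apply_eq_smul (K := K), add_mul, mul_add,
    smul_mul_assoc, mul_smul_comm, smul_smul, one_mul, mul_one, permOperator_apply_mul (K := K)]
  generalize permOperator n B i j = q₁
  generalize permOperator n B k l = q₂
  generalize permOperator n B k j = q₃
  generalize permOperator n B i l = q₄
  generalize (if i = j then 1 else 0 : K) = δ₁
  generalize (if k = l then 1 else 0 : K) = δ₂
  generalize (if k = j then 1 else 0 : K) = δ₃
  generalize (if i = l then 1 else 0 : K) = δ₄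
  linear_combination (norm := module) h • (δ₄ • q₃ + δ₁ • q₂ - δ₂ • q₁ - δ₃ • q₄)

/-- The summation contracts `P` with `P` in the transposed pattern, which produces `nP`. The
coefficient of `P` is thus `c' - c - n c c'`, and it vanishes. -/
theorem crossing_linear {c c' : K} (h : c' - c = n * (c * c')) (j l : Fin n) :
    ∑ i, (1 + (-c) • permOperator n B) i j * (1 + c' • permOperator n B) l i =
      if j = l then 1 else 0 := by
  have e : ∀ i : Fin n, (1 + (-c) • permOperator n B) i j * (1 + c' • permOperator n B) l i =
      (if i = j then (if l = i then 1 else 0 : K) else 0) • (1 : Matrix (Fin n) (Fin n) B) +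
      ((if i = j then c' • permOperator n B l i else 0) -
        (if l = i then c • permOperator n B i j else 0)) - (c * c') • permOperator n B l j := by
    intro i
    simp only [Matrix.add_apply, Matrix.smul_apply, one_apply_eq_smul (K := K), add_mul, mul_add,
      smul_mul_assoc, mul_smul_comm, smul_smul, one_mul, mul_one, permOperator_apply_mul (K := K),
      if_true]
    split_ifs <;> module
  simp only [e, Finset.sum_sub_distrib, Finset.sum_add_distrib, ← Finset.sum_smul,
    Finset.sum_ite_eq', Finset.sum_ite_eq, Finset.mem_univ, if_true, Finset.sum_const,
    Finset.card_univ, Fintype.card_fin]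
  rw [← Nat.cast_smul_eq_nsmul K, smul_eq_mul, ← h]
  by_cases hjl : j = l
  · subst hjl
    simp only [if_true]
    module
  · rw [if_neg hjl, if_neg fun e => hjl e.symm]
    module

/-- Here `c` and `c'` stand for the coefficients of `P` in the left and right R-matrices. The factor
`1 - c²` left by the normalisations is exactly the one produced by inverting `1 + cP`. -/
theorem exchange_relation (Z l : Matrix (Fin n) (Fin n) B) (c c' : K)
    (hc : ∀ b b' : B, (1 - c ^ 2) • b = (1 - c ^ 2) • b' → b = b')
    (h : ∀ i p j q, Z i j * l p q + c • (Z p j * l i q) =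
      (1 - c ^ 2) • (l p q * Z i j + c' • (l p j * Z i q))) :
    Matrix.scalar (Fin n) Z * l.map (Matrix.scalar (Fin n)) =
      (1 + (-c) • permOperator n B) * l.map (Matrix.scalar (Fin n)) * Matrix.scalar (Fin n) Z *
        (1 + c' • permOperator n B) := by
  have e₁ : ∀ p q i j, (Matrix.scalar (Fin n) Z * l.map (Matrix.scalar (Fin n))) p q i j =
      Z i j * l p q := by
    intro p q i j
    rw [Matrix.scalar_apply, Matrix.diagonal_mul, Matrix.map_apply, Matrix.scalar_apply,
      Matrix.mul_diagonal]
  have e₂ : ∀ p q i j, (l.map (Matrix.scalar (Fin n)) * Matrix.scalar (Fin n) Z) p q i j =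
      l p q * Z i j := by
    intro p q i j
    rw [Matrix.scalar_apply, Matrix.mul_diagonal, Matrix.map_apply, Matrix.scalar_apply,
      Matrix.diagonal_mul]
  have key : (1 + c • permOperator n B) *
      (Matrix.scalar (Fin n) Z * l.map (Matrix.scalar (Fin n))) =
      (1 - c ^ 2) • (l.map (Matrix.scalar (Fin n)) * Matrix.scalar (Fin n) Z *
        (1 + c' • permOperator n B)) := by
    ext p q i j
    rw [add_mul, one_mul, smul_mul_assoc, mul_add, mul_one, mul_smul_comm]
    simp only [Matrix.add_apply, Matrix.smul_apply, permOperator_mul_apply,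
      mul_permOperator_apply, e₁, e₂]
    exact h i p j q
  have hR : (1 + (-c) • permOperator n B) * (1 + c • permOperator n B) =
      (1 - c ^ 2) • (1 : Matrix (Fin n) (Fin n) (Matrix (Fin n) (Fin n) B)) := by
    simp only [add_mul, mul_add, smul_mul_assoc, mul_smul_comm, one_mul, mul_one,
      permOperator_mul_self, smul_smul, smul_add]
    module
  -- Since `(1 - cP)(1 + cP) = 1 - c²`, both sides acquire this scalar, and `hc` cancels it entry by
  -- entry.
  have := congrArg ((1 + (-c) • permOperator n B) * ·) key
  beta_reduce at this
  rw [← mul_assoc, hR, smul_mul_assoc, one_mul, mul_smul_comm] at this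
  ext p q i j
  refine hc _ _ ?_
  have h1 := congrFun (congrFun (congrFun (congrFun this p) q) i) j
  simp only [Matrix.smul_apply] at h1
  rw [h1]
  simp only [mul_assoc]

end PermOperator

/-! ### The exchange relation between `L⁺` and `L⁻` -/

section Exchange

variable (n : ℕ)

theorem RMatrix_eq {S : Type} [Ring S] [Algebra Scalars S] (w : S) : RMatrix n w =
    fShift n w • (1 : Matrix (Fin n × Fin n) (Fin n × Fin n) (PowerSeries S)) +
      (fShift n w * hbar • invSub w) • permMatrix n (PowerSeries S) := by
  rw [RMatrix, smul_add, smul_smul]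

/-- The spectral shift `h c / 2`. -/
noncomputable def centralShift : PowerSeries (Free n) := C ((const (1 / 2) * hbar) • genC n)

theorem relPlusMinus_apply (i p j q : Fin n) : relPlusMinus n (i, p) (j, q) =
    fShift n (X + centralShift n) * (outer (LPlus (genL n) i j) * inner (LMinus (genL n) p q)) +
      fShift n (X + centralShift n) * hbar • invSub (X + centralShift n) *
        (outer (LPlus (genL n) p j) * inner (LMinus (genL n) i q)) -
    (inner (LMinus (genL n) p q) * outer (LPlus (genL n) i j) * fShift n (X - centralShift n) +
      inner (LMinus (genL n) p j) * outer (LPlus (genL n) i q) *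
        (fShift n (X - centralShift n) * hbar • invSub (X - centralShift n))) := by
  have e : relPlusMinus n =
      RMatrix n (X + centralShift n) * leg₁ (LPlus (genL n)) * leg₂ (LMinus (genL n)) -
      leg₂ (LMinus (genL n)) * leg₁ (LPlus (genL n)) * RMatrix n (X - centralShift n) := rfl
  rw [e, RMatrix_eq, RMatrix_eq, Matrix.sub_apply, mul_assoc, linear_mul_apply, mul_linear_apply,
    leg₁_mul_leg₂_apply, leg₁_mul_leg₂_apply, leg₂_mul_leg₁_apply, leg₂_mul_leg₁_apply]

/-- Coefficientwise extension of a homomorphism of algebras to power series. -/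
noncomputable def seriesHom {S S' : Type} [Ring S] [Algebra Scalars S] [Ring S']
    [Algebra Scalars S'] (φ : S →ₐ[Scalars] S') : PowerSeries S →ₐ[Scalars] PowerSeries S' where
  toRingHom := PowerSeries.map φ.toRingHom
  commutes' r := by
    change PowerSeries.map φ.toRingHom (algebraMap Scalars (PowerSeries S) r) = _
    rw [Algebra.algebraMap_eq_smul_one, map_smul_series, map_one, ← Algebra.algebraMap_eq_smul_one]

/-- The homomorphism from series over the free algebra that shifts the spectral parameter. -/
noncomputable def freeShift (a : ℕ) : PowerSeries (Free n) →ₐ[Scalars] PowerSeries (DY n) :=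
  (shiftDY n a).comp (seriesHom (freeToDY n))

theorem freeShift_apply (a : ℕ) (f : PowerSeries (Free n)) :
    freeShift n a f = shiftDY n a (PowerSeries.map (freeToDY n).toRingHom f) := rfl

/-- The point `u + a h - n h / 2`. -/
noncomputable def spectralPoint (a : ℕ) : PowerSeries (DY n) :=
  shiftedX n a + algebraMap Scalars _ (-(const (1 / 2) * n * hbar))

theorem freeShift_centralShift (a : ℕ) : freeShift n a (centralShift n) =
    algebraMap Scalars _ (-(const (1 / 2) * n * hbar)) := by
  rw [freeShift_apply, centralShift, PowerSeries.map_C]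
  change shiftDY n a (C (freeToDY n ((const (1 / 2) * hbar) • genC n))) = _
  rw [map_smul, freeToDY_genC, shiftDY_C, PowerSeries.algebraMap_apply]
  refine congrArg C ?_
  rw [Algebra.algebraMap_eq_smul_one, smul_neg, neg_smul, ← nsmul_one (A := DY n) n,
    ← Nat.cast_smul_eq_nsmul Scalars, smul_smul, mul_right_comm]

theorem freeShift_add (a : ℕ) : freeShift n a (X + centralShift n) = spectralPoint n a := by
  rw [map_add, freeShift_centralShift, freeShift_apply, PowerSeries.map_X, shiftDY_X]
  rfl

theorem two_mul_const_half : const (1 / 2) + const (1 / 2) = 1 := by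
  rw [← map_add, ← map_one const]
  norm_num

theorem freeShift_sub (a : ℕ) : freeShift n a (X - centralShift n) =
    spectralPoint n a + algebraMap Scalars _ ((n : Scalars) * hbar) := by
  rw [map_sub, freeShift_centralShift, freeShift_apply, PowerSeries.map_X, shiftDY_X,
    spectralPoint, add_assoc, ← map_add, sub_eq_add_neg, ← map_neg, neg_neg]
  refine congrArg₂ (· + ·) rfl (congrArg _ ?_)
  -- At `c = -n` the two arguments are shifted by `∓nh/2`, hence differ by exactly one step `nh` of
  -- the equation for `f`.
  linear_combination (n : Scalars) * hbar * two_mul_const_half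

theorem spectralPoint_mem_center (a : ℕ) :
    spectralPoint n a ∈ Subring.center (PowerSeries (DY n)) := by
  rw [Subring.mem_center_iff]
  intro f
  rw [spectralPoint, mul_add, add_mul, (commute_shiftedX n a f).eq, Algebra.commutes]

theorem spectralPoint_succ (a : ℕ) :
    spectralPoint n (a + 1) = spectralPoint n a + algebraMap Scalars _ hbar := by
  rw [spectralPoint, spectralPoint, shiftedX_succ, Algebra.algebraMap_eq_smul_one hbar,
    add_right_comm]

theorem cancel_unit {B : Type} [Ring B] {f f' g g' r a b c d : B} (hf : IsUnit f)
    (hfc : f ∈ Subring.center B) (hr : r ∈ Subring.center B) (hg : g' ∈ Subring.center B)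
    (hf' : f' = r * f) (h : f * a + f * g * b - (c * f' + d * (f' * g')) = 0) :
    a + g * b = r * (c + g' * d) := by
  refine hf.mul_left_cancel ?_
  rw [sub_eq_zero] at h
  have h1 := Subring.mem_center_iff.1 hfc
  have h2 := Subring.mem_center_iff.1 hr
  have h3 := Subring.mem_center_iff.1 hg
  have e₁ : c * (r * f) = f * (r * c) := by rw [← mul_assoc, h1, h2]
  have e₂ : d * (r * f * g') = f * (r * (g' * d)) := by
    rw [← h1 (r * (g' * d)), ← h2 (g' * d), ← h3 d, h3 (r * f)]
    simp only [mul_assoc]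
  rw [mul_add, ← mul_assoc, h, hf', mul_add r, mul_add f, e₁, e₂]

theorem map_freeShift_relPlusMinus (a : ℕ) (x y : Fin n × Fin n) :
    PowerSeries.map (freeShift n a).toRingHom (relPlusMinus n x y) = 0 := by
  have h0 : PowerSeries.map (PowerSeries.map (freeToDY n).toRingHom) (relPlusMinus n x y) = 0 := by
    ext a b
    rw [coeff_map, coeff_map]
    exact freeToDY_eq_zero n (Or.inl (Or.inr ⟨_, _, a, b, rfl⟩))
  ext1 s
  have := congrArg (coeff s) h0
  rw [coeff_map, map_zero] at this
  rw [coeff_map, map_zero]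
  refine (freeShift_apply n a _).trans ?_
  rw [this, map_zero]

theorem map_freeShift_outer (a : ℕ) (f : PowerSeries (Free n)) :
    PowerSeries.map (freeShift n a).toRingHom (outer f) =
      outer (PowerSeries.map (freeToDY n).toRingHom f) := by
  ext1 s
  rw [coeff_map, outer, outer, coeff_map, coeff_map, coeff_map]
  refine (freeShift_apply n a _).trans ?_
  rw [PowerSeries.map_C, shiftDY_C]

theorem map_freeShift_inner (a : ℕ) (i j : Fin n) :
    PowerSeries.map (freeShift n a).toRingHom (inner (LMinus (genL n) i j)) =
      inner (LMinusShift n a i j) := by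
  rw [map_inner, LMinusShift_apply, ← map_LMinus]
  exact congrArg inner (freeShift_apply n a _)

theorem relPlusMinus_shift (a : ℕ) (i p j q : Fin n) :
    fShift n (spectralPoint n a) *
        (outer (LPlus (el n) i j) * inner (LMinusShift n a p q)) +
      fShift n (spectralPoint n a) * hbar • invSub (spectralPoint n a) *
        (outer (LPlus (el n) p j) * inner (LMinusShift n a i q)) -
    (inner (LMinusShift n a p q) * outer (LPlus (el n) i j) *
        fShift n (spectralPoint n a + algebraMap Scalars _ ((n : Scalars) * hbar)) +
      inner (LMinusShift n a p j) * outer (LPlus (el n) i q) *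
        (fShift n (spectralPoint n a + algebraMap Scalars _ ((n : Scalars) * hbar)) *
          hbar • invSub (spectralPoint n a + algebraMap Scalars _ ((n : Scalars) * hbar)))) =
      0 := by
  have h := map_freeShift_relPlusMinus n a (i, p) (j, q)
  rw [relPlusMinus_apply] at h
  have hL := freeShift_add n a
  have hR := freeShift_sub n a
  generalize X + centralShift n = wL at h hL
  generalize X - centralShift n = wR at h hR
  rw [map_sub, map_add, map_add, map_mul, map_mul, map_mul, map_mul, map_mul, map_mul, map_mul,
    map_mul, map_mul, map_mul, map_smul_series, map_smul_series, map_fShift, map_fShift,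
    map_invSub, map_invSub, hL, hR] at h
  simp only [map_freeShift_outer, map_freeShift_inner, map_LPlus] at h
  exact h

/-- The mixed relation after division by the unit `f(z - w)`: the normalisation at `w + nh` leaves
only the rational factor `1 - h²/(z - w)²`. -/
theorem exchange_LPlus_LMinusShift (hn : n ≠ 0) (a : ℕ) (i p j q : Fin n) :
    outer (LPlus (el n) i j) * inner (LMinusShift n a p q) +
      hbar • invSub (spectralPoint n a) *
        (outer (LPlus (el n) p j) * inner (LMinusShift n a i q)) =
    (1 - hbar ^ 2 • invSub (spectralPoint n a) ^ 2) *
      (inner (LMinusShift n a p q) * outer (LPlus (el n) i j) +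
        hbar • invSub (spectralPoint n a + algebraMap Scalars _ ((n : Scalars) * hbar)) *
          (inner (LMinusShift n a p j) * outer (LPlus (el n) i q))) := by
  have hw := spectralPoint_mem_center n a
  have hw' : spectralPoint n a + algebraMap Scalars _ ((n : Scalars) * hbar) ∈
      Subring.center (PowerSeries (DY n)) := Subring.add_mem _ hw (by
    rw [Algebra.algebraMap_eq_smul_one]
    exact smul_mem_center _ (Subring.one_mem _))
  exact cancel_unit (isUnit_fShift n _) (fShift_mem_center n hw)
    (Subring.sub_mem _ (Subring.one_mem _)
      (smul_mem_center _ (Subring.pow_mem _ (invSub_mem_center hw) 2)))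
    (smul_mem_center _ (invSub_mem_center hw')) (fShift_add hn _) (relPlusMinus_shift n a i p j q)

end Exchange

/-! ### Invariance of the vacuum images -/

section CoefficientIdeal

variable {R : Type} [Ring R]

/-- The left ideal of the series whose coefficients belong to a given left ideal. -/
def coeffIdeal (I : Ideal R) : Ideal (PowerSeries R) where
  carrier := {f | ∀ p, coeff p f ∈ I}
  zero_mem' := fun p => by rw [map_zero]; exact I.zero_mem
  add_mem' := fun hf hg p => by rw [map_add]; exact I.add_mem (hf p) (hg p)
  smul_mem' := fun g f hf p => by
    rw [smul_eq_mul, coeff_mul]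
    exact I.sum_mem fun x _ => I.mul_mem_left _ (hf _)

theorem outer_mem_coeffIdeal {I : Ideal R} {f : PowerSeries R} (hf : f ∈ coeffIdeal I) :
    outer f ∈ coeffIdeal (coeffIdeal I) := by
  intro p q
  rw [outer, coeff_map, coeff_C]
  split_ifs
  · exact hf p
  · exact I.zero_mem

end CoefficientIdeal

/-! ### The vacuum ideal and the conclusion of invariance -/

section Invariants

variable (n : ℕ)

theorem span_le_vacuumIdeal :
    Ideal.span {z : DY n | ∃ i j, ∃ r : ℤ, 0 ≤ r ∧ z = el n i j r} ≤ vacuumIdeal n :=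
  fun x hx _ => ⟨x, hx, 0, by rw [smul_zero, add_zero]⟩

theorem LPlus_sub_one_mem (i j : Fin n) :
    (LPlus (el n) - 1) i j ∈ coeffIdeal (vacuumIdeal n) := by
  have e : (LPlus (el n) - 1) i j = -(X * PowerSeries.mk fun r : ℕ => hbar • el n i j r) := by
    rw [LPlus, sub_sub_cancel_left, Matrix.neg_apply, Matrix.of_apply]
  rw [e]
  refine Submodule.neg_mem _ (Ideal.mul_mem_left _ _ fun r => ?_)
  rw [coeff_mk, Algebra.smul_def]
  exact Ideal.mul_mem_left _ _ (span_le_vacuumIdeal n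
    (Ideal.subset_span ⟨i, j, r, Int.natCast_nonneg r, rfl⟩))

/-- The scalar `h / (u - w)` for a central element `w`. -/
noncomputable def yangScalar {S : Type} [Ring S] [Algebra Scalars S] (w : Subring.center S) :
    Subring.center (PowerSeries S) :=
  ⟨hbar • invSub (w : S), smul_mem_center _ (invSub_mem_center w.2)⟩

/-- Partial fractions for `h/(u - w)`: the case `m = n` is the crossing relation, and `m = 1` gives
the fusion conditions. -/
theorem yangScalar_sub {S : Type} [Ring S] [Algebra Scalars S] {w w' : Subring.center S}
    {m : ℕ} (h : (w' : S) = w + algebraMap Scalars S (m * hbar)) :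
    yangScalar w' - yangScalar w = m * (yangScalar w * yangScalar w') := by
  refine Subtype.ext ?_
  change hbar • invSub (w' : S) - hbar • invSub (w : S) =
    (((m : ℕ) : Subring.center (PowerSeries S)) : PowerSeries S) *
      (hbar • invSub (w : S) * hbar • invSub (w' : S))
  rw [← smul_sub, h, invSub_add, Subring.coe_natCast, ← nsmul_eq_mul m (hbar • _ * _),
    ← Nat.cast_smul_eq_nsmul Scalars, smul_mul_assoc, mul_smul_comm, smul_smul, smul_smul,
    smul_smul]
  refine congrArg (· • (invSub (w : S) * invSub (w + algebraMap Scalars S (m * hbar)))) ?_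
  ring

theorem yangScalar_succ {S : Type} [Ring S] [Algebra Scalars S] {w w' : Subring.center S}
    (h : (w' : S) = w + algebraMap Scalars S hbar) :
    yangScalar w' - yangScalar w = yangScalar w * yangScalar w' := by
  rw [yangScalar_sub (m := 1) (by rw [h, Nat.cast_one, one_mul]), Nat.cast_one, one_mul]

theorem yangScalar_smul {S : Type} [Ring S] [Algebra Scalars S] (w : Subring.center S)
    (b : PowerSeries S) : yangScalar w • b = hbar • invSub (w : S) * b := rfl

theorem one_sub_yangScalar_sq_smul {S : Type} [Ring S] [Algebra Scalars S] (w : Subring.center S)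
    (b : PowerSeries S) :
    (1 - yangScalar w ^ 2) • b = (1 - hbar ^ 2 • invSub (w : S) ^ 2) * b := by
  rw [← smul_pow]
  rfl

/-- The central element `u + a h - n h / 2`. -/
noncomputable def leftPoint (a : ℕ) : Subring.center (PowerSeries (DY n)) :=
  ⟨spectralPoint n a, spectralPoint_mem_center n a⟩

/-- The central element `u + a h + n h / 2`. -/
noncomputable def rightPoint (a : ℕ) : Subring.center (PowerSeries (DY n)) :=
  ⟨spectralPoint n a + algebraMap Scalars _ ((n : Scalars) * hbar),
    Subring.add_mem _ (spectralPoint_mem_center n a)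
      (Subring.mem_center_iff.2 fun g => (Algebra.commutes _ g).symm)⟩

theorem leftPoint_succ (a : ℕ) : (leftPoint n (a + 1) : PowerSeries (DY n)) =
    leftPoint n a + algebraMap Scalars _ hbar := spectralPoint_succ n a

theorem rightPoint_succ (a : ℕ) : (rightPoint n (a + 1) : PowerSeries (DY n)) =
    rightPoint n a + algebraMap Scalars _ hbar := by
  change spectralPoint n (a + 1) + _ = spectralPoint n a + _ + _
  rw [spectralPoint_succ, add_right_comm]

/-- A series in the second spectral parameter as a scalar matrix. -/
noncomputable def innerScalar :
    PowerSeries (DY n) →+* Matrix (Fin n) (Fin n) (PowerSeries (PowerSeries (DY n))) :=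
  (Matrix.scalar (Fin n)).comp inner

theorem innerScalar_smul (r : Scalars) (b : PowerSeries (DY n)) :
    innerScalar n (r • b) = r • innerScalar n b := by
  change Matrix.scalar (Fin n) (inner (r • b)) = r • Matrix.scalar (Fin n) (inner b)
  rw [inner_smul, Matrix.scalar_apply, Matrix.scalar_apply, ← Matrix.diagonal_smul]
  rfl

theorem permOperator_linear_mem {B : Type} [Ring B] (c : Subring.center B) (i j : Fin n) :
    (1 + c • permOperator n B) i j ∈ (Subring.center B).matrix (n := Fin n) := by
  intro p q
  rw [Matrix.add_apply, Matrix.smul_apply, one_apply_eq_smul (K := Subring.center B),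
    permOperator_apply, Matrix.add_apply, Matrix.smul_apply, Matrix.smul_apply, Subring.smul_def,
    Subring.smul_def, Matrix.single_apply, Matrix.one_apply]
  refine Subring.add_mem _ (Subring.mul_mem _ (Subtype.prop _) ?_)
    (Subring.mul_mem _ (Subtype.prop _) ?_) <;> split_ifs
  all_goals first | exact Subring.one_mem _ | exact Subring.zero_mem _

theorem matrix_center_commute_scalar {B : Type} [Ring B] {s : Matrix (Fin n) (Fin n) B}
    (hs : s ∈ (Subring.center B).matrix (n := Fin n)) (b : B) :
    Commute s (Matrix.scalar (Fin n) b) := by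
  ext i j
  rw [Matrix.scalar_apply, Matrix.mul_diagonal, Matrix.diagonal_mul,
    Subring.mem_center_iff.1 (hs i j)]

theorem outer_map_sub_one :
    (LPlus (el n) - 1).map outer = (LPlus (el n)).map outer - 1 := by
  rw [Matrix.map_sub outer (map_sub outer), Matrix.map_one outer (map_zero outer) (map_one outer)]

/-- Right multiplication preserves this left ideal only because the entries of `s` are central and
can be moved to the left. -/
theorem outer_sub_one_mul_mem {s : Matrix (Fin n) (Fin n) (PowerSeries (PowerSeries (DY n)))}
    (hs : s ∈ (Subring.center (PowerSeries (PowerSeries (DY n)))).matrix (n := Fin n)) :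
    ((LPlus (el n)).map outer - 1) * s ∈
      (coeffIdeal (coeffIdeal (vacuumIdeal n))).matrix (Fin n) := by
  intro i j
  rw [Matrix.mul_apply]
  refine Submodule.sum_mem _ fun p _ => ?_
  have e : ((LPlus (el n)).map outer - 1) i p = outer ((LPlus (el n) - 1) i p) := by
    rw [← outer_map_sub_one, Matrix.map_apply]
  rw [Subring.mem_center_iff.1 (hs p j), e]
  exact Ideal.mul_mem_left _ _ (outer_mem_coeffIdeal (LPlus_sub_one_mem n i p))

theorem sub_one_mul_innerScalar_ellBar_mem (hn : n ≠ 0) (k : ℕ) :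
    ((LPlus (el n)).map outer - 1) * innerScalar n (ellBar n k) ∈
      (coeffIdeal (coeffIdeal (vacuumIdeal n))).matrix (Fin n) := by
  rw [ellBar_eq_trace, map_trace_antisymmMatrix (innerScalar n) (innerScalar_smul n)
    (fun a : Fin k => LMinusShift n a)]
  -- The coefficient ring consists of matrices over the auxiliary space of `L⁺`. The role of `S` is
  -- played by matrices with central entries, and that of `J` by matrices all of whose double-series
  -- coefficients lie in the vacuum ideal.
  refine sub_one_mul_trace_mem
    (fun a => 1 + (-yangScalar (leftPoint n a)) • permOperator n _) _
    (fun a => 1 + yangScalar (rightPoint n a) • permOperator n _) _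
    (Subring.center _).matrix _ (fun a => permOperator_linear_mem n _)
    (fun a => permOperator_linear_mem n _) ?_ ?_ ?_ ?_ ?_ ?_ fun s hs =>
      outer_sub_one_mul_mem n hs
  · intro s hs a i j
    exact matrix_center_commute_scalar n hs _
  · intro a b hab
    rw [hab]
    refine fusible_linear ?_
    linear_combination -yangScalar_succ (leftPoint_succ n a)
  · intro a b hab
    rw [hab]
    exact (fusible_LMinusShift n a).map (innerScalar n)
  · intro a b hab
    rw [hab]
    refine fusible_linear ?_
    linear_combination -yangScalar_succ (rightPoint_succ n a)
  · intro a
    exact crossing_linear (yangScalar_sub rfl)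
  · intro a
    refine exchange_relation ((LPlus (el n)).map outer) ((LMinusShift n a).map inner) _ _ ?_ ?_
    · intro b b' h
      rw [one_sub_yangScalar_sq_smul, one_sub_yangScalar_sq_smul] at h
      exact (isUnit_one_sub_sq _).mul_left_cancel h
    · intro i p j q
      rw [one_sub_yangScalar_sq_smul, yangScalar_smul, yangScalar_smul]
      exact exchange_LPlus_LMinusShift n hn a i p j q

theorem coeff_LPlus_sub_mul_mem (hn : n ≠ 0) (k p a : ℕ) (i j : Fin n) :
    coeff a ((LPlus (el n) - 1) i j) * coeff p (ellBar n k) ∈ vacuumIdeal n := by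
  have h := sub_one_mul_innerScalar_ellBar_mem n hn k i j a p
  have e : (((LPlus (el n)).map outer - 1) * innerScalar n (ellBar n k)) i j =
      outer ((LPlus (el n) - 1) i j) * inner (ellBar n k) := by
    rw [← outer_map_sub_one, innerScalar, RingHom.comp_apply, Matrix.scalar_apply,
      Matrix.mul_diagonal, Matrix.map_apply]
  rwa [e, coeff_outer_mul_inner] at h

theorem coeff_ellBar_smul_vacuum_mem (hn : n ≠ 0) (k p : ℕ) :
    coeff p (ellBar n k) • vacuum n ∈ invariants n := by
  intro i j a
  rw [← sub_eq_zero, ← sub_smul, ← map_sub, ← Matrix.sub_apply, smul_smul]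
  have h := coeff_LPlus_sub_mul_mem n hn k p a i j
  -- The vacuum is the class of `1`, so acting on it by a product means taking the class of that
  -- product times `1`.
  rw [← mul_one (_ * _)] at h
  exact (Submodule.Quotient.mk_eq_zero (vacuumIdeal n)).2 h

end Invariants

end YangianDouble

theorem corollary4p7 (n : ℕ) :
    (∀ k : ℕ, 1 ≤ k → k ≤ n → ∀ p : ℕ,
      PowerSeries.coeff p (YangianDouble.ellBar n k) • YangianDouble.vacuum n
        ∈ YangianDouble.invariants n) ∧
    (∀ k m : ℕ, 1 ≤ k → k ≤ n → 1 ≤ m → m ≤ n → ∀ p q : ℕ,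
      Commute (PowerSeries.coeff p (YangianDouble.ellBar n k))
        (PowerSeries.coeff q (YangianDouble.ellBar n m))) :=
  -- The bounds `1 ≤ k ≤ n` give `n ≠ 0`, which is needed because the recursion defining `f` divides
  -- by `n`.
  ⟨fun k hk hkn p => YangianDouble.coeff_ellBar_smul_vacuum_mem n (by omega) k p,
    fun k m _ _ _ _ p q => YangianDouble.commute_coeff_ellBar n k m p q⟩
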